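/- **Setting.** Let $k=(k_1,\dots,k_r)$, $r\ge 1$, be positive integers and $K=k_1+\dots+k_r$. $\mathrm{Path}(k)$ is the directed acyclic multigraph with inner vertices $1,\dots,n$, $n=K+1$, a source $0$ and a sink $n+1$; its inner edges join $i$ and $i+1$ ($1\le i\le K$) and form $r$ consecutive blocks ("legs") of $k_1,\dots,k_r$ edges; edges of the odd-numbered legs point from $i$ to $i+1$ and have label $2$, those of the even-numbered legs point from $i+1$ to $i$ and have label $1$. Edges from the source and to the sink, labelled $1$ or $2$, are added so that each inner vertex has exactly one incoming and exactly one outgoing edge of each label. For $r$ even, $\mathrm{Cycle}(k)$ is defined in the same way with $n=K$, the $K$-th inner edge joining $n$ and $1$ (in place of $i+1$ read $1$ when $i=n$). A *route* is a directed path from source to sink. Two partial routes ending at the same inner vertex are ordered by the labels of their edges immediately before their longest common final segment; two partial routes starting at the same inner vertex are ordered by the labels of their edges immediately after their longest common initial segment. Two routes are *in conflict* if for some common subroute $[u,v]$ (possibly one vertex) their parts before $u$ and their parts after $v$ are ordered oppositely; otherwise they are *coherent*. A route is *exceptional* if it is coherent with every route, and *long* or *short* according to whether or not it contains an entire leg.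 The $\mathbf g$-vector $\mathbf g(R)\in\mathbb R^n$ of a route $R$ has $v$-th coordinate $-1$ if $R$ enters $v$ by label $1$ and leaves by label $2$, $+1$ if it enters by $2$ and leaves by $1$, and $0$ otherwise. Exceptional routes have $\mathbf g$-vector $\mathbf 0$. The $\mathbf g$-polytope $P$ is the convex hull of all $\mathbf g$-vectors, and its *DKK triangulation* $\mathcal T$ has as cells the convex hulls of the $\mathbf g$-vectors of the maximal sets of pairwise coherent routes. *Pulling* a subdivision at a point $x$ keeps each cell not containing $x$ and replaces each cell $C\ni x$ by the cells $\mathrm{conv}(F\cup\{x\})$, $F$ a facet of $C$ with $x\notin F$. For a sequence $R_1,\dots,R_p$ of distinct non-exceptional routes let $\mathrm{pull}(P;\mathbf 0,R_1,\dots,R_p)$ be obtained from $\{P\}$ by pulling successively at $\mathbf 0,\mathbf g(R_1),\dots,\mathbf g(R_p)$. A subdivision is *refined* by $\mathcal T$ if each cell of $\mathcal T$ lies in one of its cells. **Coherence diagram.** A source or sink edge at $v$ lies on a unique exceptional route; if that route is short the edge is named $v$. If it is long, the edge is named $v^-$ for a source edge of label $2$ or a sink edge of label $1$, and $v^+$ for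 a source edge of label $1$ or a sink edge of label $2$. Names are ordered $1^-<1<1^+<2^-<2<2^+<\cdots$. Each route has a box in the row of its source edge and the column of its sink edge, rows running top to bottom and columns left to right in this order. In $\mathrm{Cycle}(k)$ the two rows of the source edges at $1$ are repeated at the bottom; routes entering at $1$ and continuing along the leg of length $k_r$ have their boxes in the bottom copy, and each of these two bottom rows is regarded as continued to the right by the top row of the same source edge. For a route $R$, let $N(R)$, $S(R)$ be the sets of routes whose boxes are strictly above, below the box of $R$ in its column, and $W(R)$, $E(R)$ the sets of those strictly to the left, right in its row (in a cycle, across the continuation). Given routes $R_1,\dots,R_{i-1}$ already pulled after $\mathbf 0$, let $V$ consist of these routes and all exceptional routes. The step pulling $R_i\notin V$ is a *DKK pull step* if $$\bigl(W(R_i)\subseteq V\ \text{or}\ N(R_i)\subseteq V\bigr)\quad\text{and}\quad\bigl(E(R_i)\subseteq V\ \text{or}\ S(R_i)\subseteq V\bigr).$$ **Corollary.** Let $P$ be the $\mathbf g$-polytope of $\mathrm{Path}(k)$, or of $\mathrm{Cycle}(k)$ with $k\ne(1,1)$, and let $R_1,\dots,R_p$ be distinct non-exceptional routes. 1. $\mathrm{pull}(P;\mathbf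 0,R_1,\dots,R_p)$ is refined by the DKK triangulation if and only if every step of the sequence is a DKK pull step. 2. If every non-exceptional route occurs among $R_1,\dots,R_p$, then $\mathrm{pull}(P;\mathbf 0,R_1,\dots,R_p)$ is equal to the DKK triangulation if and only if every step of the sequence is a DKK pull step. -/

import Mathlib

noncomputable section

namespace PullDKK

/-! Pulling subdivisions of polytopes. A subdivision is recorded by its set of maximal cells. -/

section Pulling

variable {n : ℕ}

/-- `F` is a facet of the polytope `S`: a nonempty exposed face of codimension one in `S`. -/
def IsFacet (S F : Set (Fin n → ℝ)) : Prop :=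
  F.Nonempty ∧ IsExposed ℝ S F ∧
    Module.finrank ℝ (vectorSpan ℝ F) + 1 = Module.finrank ℝ (vectorSpan ℝ S)

/-- Pulling the subdivision `𝒮` at the point `x`: cells that miss `x` are kept; a cell that contains
`x` is replaced by the pyramids with apex `x` over its facets not containing `x`. -/
def pull (𝒮 : Set (Set (Fin n → ℝ))) (x : Fin n → ℝ) : Set (Set (Fin n → ℝ)) :=
  {C | C ∈ 𝒮 ∧ x ∉ C} ∪
    {C | ∃ S ∈ 𝒮, x ∈ S ∧ ∃ F, IsFacet S F ∧ x ∉ F ∧ C = convexHull ℝ (insert x F)}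

/-- Successively pulling the trivial subdivision `{P}` at the points of a list, from left to
right. -/
def pullSeq (P : Set (Fin n → ℝ)) (xs : List (Fin n → ℝ)) : Set (Set (Fin n → ℝ)) :=
  xs.foldl pull {P}

/-- `𝒯` refines `𝒮`: every cell of `𝒯` is contained in some cell of `𝒮`. -/
def Refines (𝒯 𝒮 : Set (Set (Fin n → ℝ))) : Prop :=
  ∀ T ∈ 𝒯, ∃ S ∈ 𝒮, T ⊆ S

end Pulling

/-! Directed multigraphs with inner vertices `1, …, n`, source `0`, sink `n + 1`, and a framing of
the edges by labels in `{1, 2}`. -/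

/-- A directed multigraph whose edges are the members of `edges`, with inner vertices `1, …, n`,
source `0` and sink `n + 1`. The edges entering an inner vertex, and the edges leaving it, are
ordered by their labels. -/
structure FramedDAG (E : Type) where
  n : ℕ
  edges : Set E
  tail : E → ℕ
  head : E → ℕ
  label : E → ℕ

namespace FramedDAG

variable {E : Type} (G : FramedDAG E)

/-- A route: a directed path from the source to the sink, as the list of its edges. -/
def IsRoute (R : List E) : Prop :=
  (∀ e ∈ R, e ∈ G.edges) ∧
  (∃ e, R.head? = some e ∧ G.tail e = 0) ∧
  (∃ e, R.getLast? = some e ∧ G.head e = G.n + 1) ∧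
  R.IsChain (fun e f => G.head e = G.tail f)

/-- The strict order on partial routes `P`, `Q` ending at a common vertex: compare the labels of the
last edges before `P` and `Q` merge for good. -/
def InLT (P Q : List E) : Prop :=
  ∃ (A B C : List E) (a b : E), P = A ++ a :: C ∧ Q = B ++ b :: C ∧
    G.head a = G.head b ∧ G.label a < G.label b

/-- The strict order on partial routes `P`, `Q` starting at a common vertex: compare the labels of
the first edges at which `P` and `Q` differ. -/
def OutLT (P Q : List E) : Prop :=
  ∃ (A B C : List E) (a b : E), P = C ++ a :: A ∧ Q = C ++ b :: B ∧
    G.tail a = G.tail b ∧ G.label a < G.label b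

/-- `R` and `S` are in conflict at some common subroute `C` (possibly a single vertex, `C = []`):
the parts before `C` and the parts after `C` are ordered differently. -/
def InConflict (R S : List E) : Prop :=
  ∃ C R₁ R₂ S₁ S₂ : List E, R = R₁ ++ C ++ R₂ ∧ S = S₁ ++ C ++ S₂ ∧
    ((G.InLT R₁ S₁ ∧ G.OutLT S₂ R₂) ∨ (G.InLT S₁ R₁ ∧ G.OutLT R₂ S₂))

def Coherent (R S : List E) : Prop := ¬ G.InConflict R S

/-- An exceptional route: a route that is coherent with every route. -/
def IsExceptional (R : List E) : Prop :=
  G.IsRoute R ∧ ∀ S, G.IsRoute S → G.Coherent R S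

/-- A clique: a set of mutually coherent routes. -/
def IsClique (M : Set (List E)) : Prop :=
  (∀ R ∈ M, G.IsRoute R) ∧ ∀ R ∈ M, ∀ S ∈ M, G.Coherent R S

/-- `R` passes through the inner vertex `v` by an edge labelled `a` followed by an edge
labelled `b`. -/
def Turns (R : List E) (v a b : ℕ) : Prop :=
  ∃ e f, [e, f] <:+: R ∧ G.head e = v ∧ G.label e = a ∧ G.label f = b

open Classical in
/-- The `g`-vector of a route. The coordinate `i : Fin n` belongs to the inner vertex `i + 1`. -/
def gVec (R : List E) : Fin G.n → ℝ := fun i =>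
  if G.Turns R (i + 1) 1 2 then -1 else if G.Turns R (i + 1) 2 1 then 1 else 0

/-- The `g`-polytope: the convex hull of the `g`-vectors of all routes. -/
def gPolytope : Set (Fin G.n → ℝ) :=
  convexHull ℝ (G.gVec '' {R | G.IsRoute R})

/-- The DKK triangulation of the `g`-polytope: its cells are the convex hulls of the `g`-vectors of
the maximal cliques. -/
def DKK : Set (Set (Fin G.n → ℝ)) :=
  {C | ∃ M, Maximal G.IsClique M ∧ C = convexHull ℝ (G.gVec '' M)}

/-- The subdivision of the `g`-polytope obtained by pulling at the origin and then at the
`g`-vectors of the routes in the list `V`, in this order. -/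
def pullRoutes (V : List (List E)) : Set (Set (Fin G.n → ℝ)) :=
  pullSeq G.gPolytope (0 :: V.map G.gVec)

/-- The sequence consisting of the origin followed by `V` is pull-coherent. -/
def PullCoherent (V : List (List E)) : Prop :=
  Refines G.DKK (G.pullRoutes V)

end FramedDAG

/-! The DAGs `Path(k)` and `Cycle(k)` with the framing in which the inner routes are alternately
labelled `2, 1, 2, 1, …`. -/

/-- `inner i` joins the inner vertex `i` to the next one; `src v l` is an edge from the source to
`v` with label `l`; `snk v l` is an edge from `v` to the sink with label `l`. -/
inductive Edge where
  | inner (i : ℕ)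
  | src (v l : ℕ)
  | snk (v l : ℕ)

/-- The index (from `0`) of the block containing position `i` (from `0`), when consecutive blocks
have the lengths listed in `k`. -/
def blockIndex : List ℕ → ℕ → ℕ
  | [], _ => 0
  | a :: k, i => if i < a then 0 else blockIndex k (i - a) + 1

/-- The inner edge `i` (from `1`) lies on the first, third, fifth, … inner route. -/
def IsForward (k : List ℕ) (i : ℕ) : Prop := blockIndex k (i - 1) % 2 = 0

open Classical in
/-- The tail of the inner edge `i`, on the inner vertices `1, …, n`. The edge joins `i` and
`i % n + 1`, which is `i + 1` for `i < n` and is `1` for `i = n`. -/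
def innerTail (k : List ℕ) (n i : ℕ) : ℕ := if IsForward k i then i else i % n + 1

open Classical in
def innerHead (k : List ℕ) (n i : ℕ) : ℕ := if IsForward k i then i % n + 1 else i

open Classical in
def innerLabel (k : List ℕ) (i : ℕ) : ℕ := if IsForward k i then 2 else 1

/-- The DAG on the inner vertices `1, …, n` with inner edges `1, …, k.sum`, completed by source and
sink edges so that every inner vertex has exactly one incoming and one outgoing edge with each of
the labels `1` and `2`. -/
def legDAG (k : List ℕ) (n : ℕ) : FramedDAG Edge where
  n := n
  edges := {e | match e with
    | .inner i => 1 ≤ i ∧ i ≤ k.sum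
    | .src v l => (1 ≤ v ∧ v ≤ n) ∧ (l = 1 ∨ l = 2) ∧
        ∀ i, 1 ≤ i → i ≤ k.sum → ¬ (innerHead k n i = v ∧ innerLabel k i = l)
    | .snk v l => (1 ≤ v ∧ v ≤ n) ∧ (l = 1 ∨ l = 2) ∧
        ∀ i, 1 ≤ i → i ≤ k.sum → ¬ (innerTail k n i = v ∧ innerLabel k i = l)}
  tail
    | .inner i => innerTail k n i
    | .src _ _ => 0
    | .snk v _ => v
  head
    | .inner i => innerHead k n i
    | .src v _ => v
    | .snk _ _ => n + 1
  label
    | .inner i => innerLabel k i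
    | .src _ l => l
    | .snk _ l => l

/-- `Path(k)`: the inner graph is an undirected path with `k.sum` edges. -/
def pathDAG (k : List ℕ) : FramedDAG Edge := legDAG k (k.sum + 1)

/-- `Cycle(k)`, for `k` of positive even length: the inner graph is an undirected cycle with `k.sum`
edges. -/
def cycleDAG (k : List ℕ) : FramedDAG Edge := legDAG k k.sum

/-! The coherence diagram. -/

section Diagram

variable (G : FramedDAG Edge)

open Classical in
/-- The position of a source or sink edge in the linear order
`1⁻ < 1 < 1⁺ < 2⁻ < 2 < 2⁺ < ⋯` of edge names. A source (sink) edge at `v` lies on a short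
exceptional route, and is named `v`, when there is a sink (source) edge at `v` with the same label.
Otherwise it lies on a long exceptional route: a source edge is named `v⁻` if its label is `2` and
`v⁺` if its label is `1`, and a sink edge is named `v⁺` if its label is `2` and `v⁻` if its label is
`1`. -/
def edgePos : Edge → ℤ
  | .inner _ => 0
  | .src v l => 3 * v + if Edge.snk v l ∈ G.edges then 0 else if l = 2 then -1 else 1
  | .snk v l => 3 * v + if Edge.src v l ∈ G.edges then 0 else if l = 2 then 1 else -1

/-- The route enters at the vertex `1` and continues along the edge joining `1` to `n` (an edge that
only a cycle has). These are the routes whose boxes lie in the two additional rows at the bottom of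
the diagram of a cycle. -/
def Wraps (R : List Edge) : Prop := ∃ l R', R = Edge.src 1 l :: Edge.inner G.n :: R'

open Classical in
/-- The height of the row of the box of `R`, increasing from top to bottom. -/
def rowPos (R : List Edge) : ℤ :=
  (R.head?.map (edgePos G)).getD 0 + if Wraps G R then 3 * (G.n : ℤ) else 0

open Classical in
/-- The horizontal place of the box of `R` within its row, increasing from left to right. In a cycle
the two bottom rows are continued on the right by the two top rows, so their boxes are
shifted to the left of those. -/
def colPos (R : List Edge) : ℤ :=
  (R.getLast?.map (edgePos G)).getD 0 - if Wraps G R then 3 * (G.n : ℤ) else 0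

/-- Boxes above `R` in its column; the columns are indexed by the sink edges. -/
def north (R : List Edge) : Set (List Edge) :=
  {T | G.IsRoute T ∧ T.getLast? = R.getLast? ∧ rowPos G T < rowPos G R}

/-- Boxes below `R` in its column. -/
def south (R : List Edge) : Set (List Edge) :=
  {T | G.IsRoute T ∧ T.getLast? = R.getLast? ∧ rowPos G R < rowPos G T}

/-- Boxes to the left of `R` in its row; the rows are indexed by the source edges. -/
def west (R : List Edge) : Set (List Edge) :=
  {T | G.IsRoute T ∧ T.head? = R.head? ∧ colPos G T < colPos G R}

/-- Boxes to the right of `R` in its row. -/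
def east (R : List Edge) : Set (List Edge) :=
  {T | G.IsRoute T ∧ T.head? = R.head? ∧ colPos G R < colPos G T}

/-- The routes already pulled once the origin (the `g`-vector of every exceptional route) and then
the routes in the list `V` have been pulled. -/
def pulled (V : List (List Edge)) : Set (List Edge) :=
  {T | G.IsExceptional T ∨ T ∈ V}

/-- Pulling at `R`, after the origin and the routes in `V`, is a DKK pull step. -/
def IsDKKPullStep (V : List (List Edge)) (R : List Edge) : Prop :=
  (west G R ⊆ pulled G V ∨ north G R ⊆ pulled G V) ∧
    (east G R ⊆ pulled G V ∨ south G R ⊆ pulled G V)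

/-- Every step of the sequence consisting of the origin followed by `L` is a DKK pull step. -/
def AllDKKPullSteps (L : List (List Edge)) : Prop :=
  ∀ V R W, L = V ++ R :: W → IsDKKPullStep G V R

end Diagram

end PullDKK

end

namespace PullDKK

/-! Faces of convex hulls -/

section Faces

variable {E : Type*} [AddCommGroup E] [Module ℝ E]

/-! The subdivision is followed one maximal clique at a time. The combinatorial input is a
resolution rule (the field `resolve` of `CoherenceSystem`). If `x` and `y` are in conflict, then
either `g x + g y = 0` or `g x + g y = g z + g z'`, where `z`, `z'` are coherent with `x`, with `y`
and with everything coherent with both. In the second case `z` and `z'` lie in the two neighbour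
families on one side of `x`, exactly the families that occur in the definition of a pull step. For a
maximal clique `M` of non-exceptional elements, induction on the number of conflicts with `M` shows
that its vectors form a basis. The functional `h` equal to `1` on `M` is at most `1` on all vectors,
and the coordinate `c x` is nonnegative on everything coherent with `x` (`nonempty_dualData`).

As long as no step cuts the simplex of `M`, the cell containing it is known explicitly. It is
spanned by `0`, by the pulled members of `M`, and by the "remaining" elements: those with `h = 1`
whose coordinates at the pulled members of `M` vanish. Pulling at `x` leaves the simplex inside one
cell exactly when `x` is not remaining, or `x ∈ M` and `c x ≥ 0` on all remaining elements
(`cell_mem_cells`, `eq_cell_of_mem_cells`).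

Suppose that all steps are pull steps and `x` is remaining. The remaining set is closed under the
relations `g a + g b = g z + g z'`, so a conflict of `x` inside it would yield two unpulled
resolvents and contradict the step. Thus `x` is coherent with all remaining elements, and linear
independence of cliques forces `x ∈ M` (`AllSteps.allOK`). Conversely, a violated step provides
unpulled `y`, `y'` and some `z` in conflict with `x` such that `{y, y', z}` is a clique and `g x + g
z = g y + g y'`. The simplex of any maximal clique containing these three is cut
(`allSteps_of_allOK`). The delicate case is a cycle with two legs, where `g x + g z` may be `0`. A
leg with an interior vertex, which exists because `k ≠ (1,1)`, then supplies another witness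
(`lo_witness`, `hi_witness`).

For the equality statement, pull steps keep every cell an iterated pyramid over a face with unpulled
vertices (`exists_isPyramid`). Once everything is pulled the base is empty and the cell is the
simplex of a maximal clique.

To apply this, each route is identified with an arc on a single leg, coded by two natural numbers,
one per end, whose parity tells whether the route turns there. Coherence, vectors and the coherence
diagram all become inequalities between codes (`coherent_route_iff`, `gVec_route`,
`isDKKPullStep_iff`). -/

theorem convexHull_le_of_forall_le {s : Set E} (l : E →ₗ[ℝ] ℝ) {c : ℝ} (h : ∀ y ∈ s, l y ≤ c) {z : E}
    (hz : z ∈ convexHull ℝ s) : l z ≤ c :=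
  convexHull_min (t := {z | l z ≤ c}) h (convex_halfSpace_le l.isLinear c) hz

/-- The points with `l < c` together with the hull of the maximal generators already form a convex
set: a proper convex combination reaches the level `c` only if both of its members do. -/
theorem mem_convexHull_face {s : Set E} (l : E →ₗ[ℝ] ℝ) {c : ℝ} (h : ∀ y ∈ s, l y ≤ c) {z : E}
    (hz : z ∈ convexHull ℝ s) (hc : l z = c) : z ∈ convexHull ℝ {y ∈ s | l y = c} := by
  have key : convexHull ℝ s ⊆ {z | l z < c} ∪ convexHull ℝ {y ∈ s | l y = c} := by
    apply convexHull_min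
    · intro y hy
      rcases (h y hy).lt_or_eq with h1 | h1
      · exact Or.inl h1
      · exact Or.inr (subset_convexHull ℝ _ ⟨hy, h1⟩)
    · have hle : ∀ w ∈ {z | l z < c} ∪ convexHull ℝ {y ∈ s | l y = c}, l w ≤ c := by
        rintro w (hw | hw)
        · exact le_of_lt hw
        · exact convexHull_le_of_forall_le l (fun y hy => hy.2.le) hw
      intro x hx y hy a b ha hb hab
      have hxl := hle x hx
      have hyl := hle y hy
      rcases ha.eq_or_lt with rfl | ha'
      · have : b = 1 := by linarith
        subst this; simpa using hy
      rcases hb.eq_or_lt with rfl | hb'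
      · have : a = 1 := by linarith
        subst this; simpa using hx
      by_cases hx' : l x < c
      · left
        simp only [Set.mem_ofPred_eq, map_add, map_smul, smul_eq_mul]
        have : a * c + b * c = c := by rw [← add_mul, hab, one_mul]
        nlinarith
      by_cases hy' : l y < c
      · left
        simp only [Set.mem_ofPred_eq, map_add, map_smul, smul_eq_mul]
        have : a * c + b * c = c := by rw [← add_mul, hab, one_mul]
        nlinarith
      right
      exact convex_convexHull ℝ _ (hx.resolve_left hx') (hy.resolve_left hy') ha hb hab
  rcases key hz with h1 | h1
  · exact absurd hc (ne_of_lt h1)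
  · exact h1

theorem convexHull_sep_eq {s : Set E} (l : E →ₗ[ℝ] ℝ) {c : ℝ} (h : ∀ y ∈ s, l y ≤ c) :
    {z ∈ convexHull ℝ s | l z = c} = convexHull ℝ {y ∈ s | l y = c} := by
  apply Set.Subset.antisymm
  · rintro z ⟨hz, hc⟩
    exact mem_convexHull_face l h hz hc
  · intro z hz
    refine ⟨convexHull_mono (Set.sep_subset _ _) hz, ?_⟩
    exact convexHull_min (t := {z | l z = c}) (fun y hy => hy.2)
      (convex_hyperplane l.isLinear c) hz

end Faces

/-! ### Facets and their supporting functionals. -/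

section Facets

variable {n : ℕ}

/-- An exposed face is cut out by a linear functional. -/
theorem IsFacet.exists_functional {S F : Set (Fin n → ℝ)} (h : IsFacet S F) :
    ∃ (l : (Fin n → ℝ) →ₗ[ℝ] ℝ) (c : ℝ), (∀ y ∈ S, l y ≤ c) ∧ F = {z ∈ S | l z = c} := by
  obtain ⟨hne, hex, -⟩ := h
  obtain ⟨l, hl⟩ := hex hne
  obtain ⟨z0, hz0⟩ := hne
  have hz0' := hz0
  rw [hl] at hz0'
  refine ⟨l.toLinearMap, l z0, fun y hy => hz0'.2 y hy, ?_⟩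
  rw [hl]
  ext z
  constructor
  · rintro ⟨hz, hmax⟩
    exact ⟨hz, le_antisymm (hz0'.2 z hz) (hmax z0 hz0'.1)⟩
  · rintro ⟨hz, he⟩
    refine ⟨hz, fun y hy => ?_⟩
    have he' : l z = l z0 := he
    rw [he']; exact hz0'.2 y hy

theorem vectorSpan_le_ker {F : Set (Fin n → ℝ)} (l : (Fin n → ℝ) →ₗ[ℝ] ℝ) {c : ℝ}
    (h : ∀ y ∈ F, l y = c) : vectorSpan ℝ F ≤ LinearMap.ker l := by
  rw [vectorSpan_def, Submodule.span_le]
  rintro _ ⟨a, ha, b, hb, rfl⟩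
  simp [h a ha, h b hb]

theorem finrank_ker_add_one {l : (Fin n → ℝ) →ₗ[ℝ] ℝ} (hl : l ≠ 0) :
    Module.finrank ℝ (LinearMap.ker l) + 1 = n := by
  have h1 := LinearMap.finrank_range_add_finrank_ker l
  have h2 : LinearMap.range l = ⊤ := LinearMap.range_eq_top.2 (LinearMap.surjective hl)
  rw [h2] at h1
  simp at h1
  omega

theorem vectorSpan_eq_top_of_span {S : Set (Fin n → ℝ)} (h0 : (0 : Fin n → ℝ) ∈ S)
    (hS : Submodule.span ℝ S = ⊤) : vectorSpan ℝ S = ⊤ := by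
  rw [vectorSpan_eq_span_vsub_set_right ℝ h0]
  simpa using hS

/-- The face of a full-dimensional polytope with vertex `0` cut out by a functional `l` is a facet
as soon as its direction space together with one more vector spans. -/
theorem isFacet_of_span {S F : Set (Fin n → ℝ)} (l : (Fin n → ℝ) →ₗ[ℝ] ℝ) (c : ℝ)
    (hS : vectorSpan ℝ S = ⊤) (hle : ∀ y ∈ S, l y ≤ c) (hF : F = {z ∈ S | l z = c})
    (hne : F.Nonempty) (v : Fin n → ℝ) (hv : l v ≠ 0)
    (hspan : vectorSpan ℝ F ⊔ Submodule.span ℝ {v} = ⊤) : IsFacet S F := by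
  refine ⟨hne, ?_, ?_⟩
  · intro _
    obtain ⟨z0, hz0⟩ := hne
    rw [hF] at hz0
    refine ⟨LinearMap.toContinuousLinearMap l, ?_⟩
    rw [hF]
    ext z
    simp only [Set.mem_ofPred_eq, LinearMap.coe_toContinuousLinearMap']
    constructor
    · rintro ⟨hz, he⟩
      exact ⟨hz, fun y hy => he ▸ hle y hy⟩
    · rintro ⟨hz, hm⟩
      refine ⟨hz, le_antisymm (hle z hz) ?_⟩
      rw [← hz0.2]; exact hm z0 hz0.1
  -- A vector of the kernel is `a + t • v` with `a` a direction of `F`. Since `l` kills `a` but not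
  -- `v`, `t = 0`. So the face has codimension one by counting dimensions.
  · have hker : vectorSpan ℝ F = LinearMap.ker l := by
      have h1 : vectorSpan ℝ F ≤ LinearMap.ker l :=
        vectorSpan_le_ker l (c := c) (fun y hy => by rw [hF] at hy; exact hy.2)
      refine le_antisymm h1 ?_
      intro w hw
      have : w ∈ vectorSpan ℝ F ⊔ Submodule.span ℝ {v} := by rw [hspan]; trivial
      obtain ⟨a, ha, b, hb, rfl⟩ := Submodule.mem_sup.1 this
      obtain ⟨t, rfl⟩ := Submodule.mem_span_singleton.1 hb
      have hla : l a = 0 := h1 ha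
      have : t = 0 := by
        have : l (a + t • v) = 0 := hw
        simp [hla, hv] at this
        exact this
      simpa [this] using ha
    rw [hker, hS, finrank_top, Module.finrank_fin_fun]
    exact finrank_ker_add_one (fun h => hv (by rw [h]; rfl))

/-- A functional that vanishes on the kernel of another one is a multiple of it. -/
theorem exists_eq_smul_of_ker_le {E : Type*} [AddCommGroup E] [Module ℝ E] {l φ : E →ₗ[ℝ] ℝ}
    (h : LinearMap.ker φ ≤ LinearMap.ker l) : ∃ t : ℝ, l = t • φ := by
  by_cases hφ : φ = 0
  · refine ⟨0, ?_⟩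
    ext v
    have : v ∈ LinearMap.ker l := h (by simp [hφ])
    simpa using this
  · obtain ⟨v, hv⟩ : ∃ v, φ v ≠ 0 := by
      by_contra hc
      push Not at hc
      exact hφ (LinearMap.ext hc)
    refine ⟨l v / φ v, ?_⟩
    ext w
    have : w - (φ w / φ v) • v ∈ LinearMap.ker l := h (by simp [hv])
    simp only [LinearMap.mem_ker, map_sub, map_smul, smul_eq_mul, sub_eq_zero] at this
    simp only [LinearMap.smul_apply, smul_eq_mul, this]
    field_simp

end Facets

end PullDKK

/-! ### Abstract coherence systems and the basis of a maximal clique. -/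

namespace PullDKK

/-- An abstract system of routes (`box`) with exceptional elements `exc`, vectors `g`, a coherence
relation, and the four families of neighbours that define pull steps. -/
structure CoherenceSystem (ι : Type*) (n : ℕ) where
  box : Set ι
  exc : Set ι
  g : ι → Fin n → ℝ
  Coh : ι → ι → Prop
  loA : ι → Set ι
  loB : ι → Set ι
  hiA : ι → Set ι
  hiB : ι → Set ι
  finite_box : box.Finite
  coh_symm : ∀ x y, Coh x y → Coh y x
  coh_self : ∀ x ∈ box, Coh x x
  g_exc : ∀ x ∈ exc, g x = 0
  exposed : ∀ x ∈ box \ exc, ∃ ψ : (Fin n → ℝ) →ₗ[ℝ] ℝ, 0 < ψ (g x) ∧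
    ∀ y ∈ box \ exc, y ≠ x → ψ (g y) < ψ (g x)
  indep : ∀ M : Set ι, M ⊆ box \ exc → (∀ x ∈ M, ∀ y ∈ M, Coh x y) → LinearIndepOn ℝ g M
  span : Submodule.span ℝ (g '' (box \ exc)) = ⊤
  -- The clause about `w` makes the number of conflicts with a clique drop when `x` is replaced by
  -- `z` or `z'`. The last clause is the only axiom that mentions the families used by pull steps.
  resolve : ∀ x ∈ box \ exc, ∀ y ∈ box \ exc, ¬ Coh x y → g x + g y = 0 ∨
    ∃ z ∈ box, ∃ z' ∈ box, g x + g y = g z + g z' ∧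
      (Coh x z ∧ Coh x z' ∧ Coh y z ∧ Coh y z') ∧
      (∀ w ∈ box \ exc, Coh w x → Coh w y → Coh w z ∧ Coh w z') ∧
      ((z ∈ loA x ∧ z' ∈ loB x) ∨ (z ∈ hiA x ∧ z' ∈ hiB x))

namespace CoherenceSystem

variable {ι : Type*} {n : ℕ} (Γ : CoherenceSystem ι n)

/-- The non-exceptional elements. -/
def reg : Set ι := Γ.box \ Γ.exc

def IsCohClique (M : Set ι) : Prop := M ⊆ Γ.reg ∧ ∀ x ∈ M, ∀ y ∈ M, Γ.Coh x y

def polytope : Set (Fin n → ℝ) := convexHull ℝ (insert 0 (Γ.g '' Γ.reg))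

def simplex (M : Set ι) : Set (Fin n → ℝ) := convexHull ℝ (insert 0 (Γ.g '' M))

def done (V : List ι) : Set ι := {t | t ∈ Γ.exc ∨ t ∈ V}

def Step (V : List ι) (x : ι) : Prop :=
  (Γ.loA x ⊆ Γ.done V ∨ Γ.loB x ⊆ Γ.done V) ∧ (Γ.hiA x ⊆ Γ.done V ∨ Γ.hiB x ⊆ Γ.done V)

def AllSteps (L : List ι) : Prop := ∀ V x W, L = V ++ x :: W → Γ.Step V x

/-- A violated pull step is witnessed by a conflict resolved by two elements not yet pulled. -/
def HasWitnesses : Prop := ∀ V x, Γ.AllSteps V → (∀ y ∈ V, y ∈ Γ.reg) → x ∈ Γ.reg → x ∉ V →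
  ¬ Γ.Step V x → ∃ y ∈ Γ.reg, ∃ y' ∈ Γ.reg, ∃ z ∈ Γ.reg, Γ.Coh y y' ∧ Γ.Coh y z ∧ Γ.Coh y' z ∧
    ¬ Γ.Coh x z ∧ y ∉ V ∧ y' ∉ V ∧ Γ.g x + Γ.g z = Γ.g y + Γ.g y'

theorem reg_finite : Γ.reg.Finite := Γ.finite_box.subset Set.sdiff_subset

variable {Γ}

theorem g_mem_polytope {x : ι} (hx : x ∈ Γ.reg) : Γ.g x ∈ Γ.polytope :=
  subset_convexHull ℝ _ (Or.inr ⟨x, hx, rfl⟩)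

/-- Positivity of `ψ (g x)` takes care of the generator `0`, so `g x` is the unique maximum of `ψ`
on the whole polytope. -/
theorem exists_exposing {x : ι} (hx : x ∈ Γ.reg) : ∃ ψ : (Fin n → ℝ) →ₗ[ℝ] ℝ, 0 < ψ (Γ.g x) ∧
    ∀ f ∈ Γ.polytope, f ≠ Γ.g x → ψ f < ψ (Γ.g x) := by
  obtain ⟨ψ, h0, hψ⟩ := Γ.exposed x hx
  refine ⟨ψ, h0, fun f hf hne => ?_⟩
  have hle : ∀ y ∈ insert 0 (Γ.g '' Γ.reg), ψ y ≤ ψ (Γ.g x) := by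
    rintro _ (rfl | ⟨y, hy, rfl⟩)
    · simpa using h0.le
    · by_cases h : y = x
      · rw [h]
      · exact (hψ y hy h).le
  refine lt_of_le_of_ne (convexHull_le_of_forall_le ψ hle hf) fun he => hne ?_
  have := mem_convexHull_face ψ hle hf he
  have hs : {y ∈ insert 0 (Γ.g '' Γ.reg) | ψ y = ψ (Γ.g x)} ⊆ {Γ.g x} := by
    rintro _ ⟨rfl | ⟨y, hy, rfl⟩, h⟩
    · simp at h; exact absurd h.symm h0.ne'
    · by_cases hyx : y = x
      · rw [hyx]; rfl
      · exact absurd h (hψ y hy hyx).ne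
  simpa using convexHull_mono hs this

theorem mem_of_g_mem_convexHull {x : ι} (hx : x ∈ Γ.reg) {s : Set (Fin n → ℝ)}
    (hs : s ⊆ Γ.polytope) (h : Γ.g x ∈ convexHull ℝ s) : Γ.g x ∈ s := by
  by_contra hn
  obtain ⟨ψ, -, hψ⟩ := exists_exposing hx
  have : convexHull ℝ s ⊆ {z | ψ z < ψ (Γ.g x)} :=
    convexHull_min (fun y hy => hψ y (hs hy) (fun e => hn (e ▸ hy)))
      (convex_halfSpace_lt ψ.isLinear _)
  exact lt_irrefl (ψ (Γ.g x)) (this h)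

theorem g_injOn : Set.InjOn Γ.g Γ.reg := by
  intro x hx y hy h
  by_contra hne
  obtain ⟨ψ, -, hψ⟩ := Γ.exposed x hx
  have := hψ y hy (Ne.symm hne)
  rw [h] at this
  exact lt_irrefl _ this

theorem g_ne_zero {x : ι} (hx : x ∈ Γ.reg) : Γ.g x ≠ 0 := by
  obtain ⟨ψ, h0, -⟩ := Γ.exposed x hx
  intro h
  simp [h] at h0

theorem IsCohClique.exists_maximal {M : Set ι} (hM : Γ.IsCohClique M) :
    ∃ N, M ⊆ N ∧ Maximal Γ.IsCohClique N := by
  have hfin : {N | Γ.IsCohClique N}.Finite :=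
    Γ.reg_finite.powerset.subset fun N hN => hN.1
  obtain ⟨N, h1, h2⟩ := hfin.exists_le_maximal hM
  exact ⟨N, h1, h2⟩

/-- The coordinate functionals of the basis given by a maximal clique. -/
structure DualData (Γ : CoherenceSystem ι n) (M : Set ι) where
  c : ι → (Fin n → ℝ) →ₗ[ℝ] ℝ
  h : (Fin n → ℝ) →ₗ[ℝ] ℝ
  c_self : ∀ m ∈ M, c m (Γ.g m) = 1
  c_ne : ∀ m ∈ M, ∀ m' ∈ M, m ≠ m' → c m (Γ.g m') = 0
  h_one : ∀ m ∈ M, h (Γ.g m) = 1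
  span : Submodule.span ℝ (Γ.g '' M) = ⊤
  h_le : ∀ y ∈ Γ.box, h (Γ.g y) ≤ 1
  c_ext : ∀ v, (∀ m ∈ M, c m v = 0) → v = 0
  c_nonneg : ∀ x ∈ M, ∀ y ∈ Γ.reg, Γ.Coh x y → 0 ≤ c x (Γ.g y)

/-- An induction over the number of conflicts with a maximal clique. -/
theorem conflict_induction {M : Set ι} (hM : Maximal Γ.IsCohClique M) (p : ι → Prop)
    (hexc : ∀ y ∈ Γ.exc, p y) (hmem : ∀ y ∈ M, p y)
    (hneg : ∀ y ∈ Γ.reg, ∀ m ∈ M, ¬ Γ.Coh y m → Γ.g y + Γ.g m = 0 → p y)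
    (hres : ∀ y ∈ Γ.reg, ∀ m ∈ M, ¬ Γ.Coh y m → ∀ z ∈ Γ.box, ∀ z' ∈ Γ.box,
      Γ.g y + Γ.g m = Γ.g z + Γ.g z' → (∀ w ∈ M, Γ.Coh w y → Γ.Coh w z ∧ Γ.Coh w z') →
      p z → p z' → p y) :
    ∀ y ∈ Γ.box, p y := by
  have hMfin : M.Finite := Γ.reg_finite.subset hM.1.1
  have main : ∀ N : ℕ, ∀ y ∈ Γ.box, {m ∈ M | ¬ Γ.Coh m y}.ncard ≤ N → p y := by
    intro N
    induction N with
    | zero =>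
      intro y hy hc
      by_cases he : y ∈ Γ.exc
      · exact hexc y he
      apply hmem
      have hemp : {m ∈ M | ¬ Γ.Coh m y} = ∅ :=
        (Set.ncard_eq_zero (hMfin.subset (Set.sep_subset _ _))).1 (by omega)
      have hall : ∀ m ∈ M, Γ.Coh m y := by
        intro m hm
        by_contra hn
        have : m ∈ {m ∈ M | ¬ Γ.Coh m y} := ⟨hm, hn⟩
        rw [hemp] at this
        exact this
      -- Without conflicts `y` can be added to `M`, so maximality gives `y ∈ M`.
      have hcl : Γ.IsCohClique (insert y M) := by
        refine ⟨Set.insert_subset ⟨hy, he⟩ hM.1.1, ?_⟩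
        rintro a (rfl | ha) b (rfl | hb)
        · exact Γ.coh_self _ hy
        · exact Γ.coh_symm _ _ (hall b hb)
        · exact hall a ha
        · exact hM.1.2 a ha b hb
      exact hM.2 hcl (Set.subset_insert _ _) (Set.mem_insert _ _)
    | succ N ih =>
      intro y hy hc
      by_cases he : y ∈ Γ.exc
      · exact hexc y he
      by_cases hemp : {m ∈ M | ¬ Γ.Coh m y}.ncard ≤ N
      · exact ih y hy hemp
      obtain ⟨m, hm, hmy⟩ : {m ∈ M | ¬ Γ.Coh m y}.Nonempty := by
        rw [Set.nonempty_iff_ne_empty]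
        intro h0
        rw [h0] at hemp
        simp at hemp
      have hym : ¬ Γ.Coh y m := fun h => hmy (Γ.coh_symm _ _ h)
      rcases Γ.resolve y ⟨hy, he⟩ m (hM.1.1 hm) hym with h0 | ⟨z, hz, z', hz', hsum, hcoh, hw, -⟩
      · exact hneg y ⟨hy, he⟩ m hm hym h0
      · have hw' : ∀ w ∈ M, Γ.Coh w y → Γ.Coh w z ∧ Γ.Coh w z' := fun w hwM hwy =>
          hw w (hM.1.1 hwM) hwy (hM.1.2 w hwM m hm)
        -- Each resolvent is in conflict only with members of `M` that were in conflict with `y`,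
        -- and no longer with `m`. So the count strictly decreases.
        have hlt : ∀ u ∈ Γ.box, (∀ w ∈ M, Γ.Coh w y → Γ.Coh w u) → Γ.Coh m u → p u := by
          intro u hu hwu hmu
          apply ih u hu
          have : {m ∈ M | ¬ Γ.Coh m u}.ncard < {m ∈ M | ¬ Γ.Coh m y}.ncard := by
            apply Set.ncard_lt_ncard _ (hMfin.subset (Set.sep_subset _ _))
            refine ⟨fun w hw => ⟨hw.1, fun h => hw.2 (hwu w hw.1 h)⟩, fun hsub => ?_⟩
            exact (hsub ⟨hm, hmy⟩).2 hmu
          omega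
        exact hres y ⟨hy, he⟩ m hm hym z hz z' hz' hsum hw'
          (hlt z hz (fun w h1 h2 => (hw' w h1 h2).1) hcoh.2.2.1)
          (hlt z' hz' (fun w h1 h2 => (hw' w h1 h2).2) hcoh.2.2.2)
  exact fun y hy => main _ y hy le_rfl

/-- Every property comes from `conflict_induction` applied to `g y = g z + g z' - g m`. For `h` this
gives `h (g y) ≤ 1 + 1 - 1`. For `c x` with `y` coherent with `x`, the member `m` differs from `x`,
so `c x (g m) = 0`, and both resolvents are again coherent with `x`. -/
theorem nonempty_dualData {M : Set ι} (hM : Maximal Γ.IsCohClique M) :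
    Nonempty (DualData Γ M) := by
  classical
  have hMfin : M.Finite := Γ.reg_finite.subset hM.1.1
  have hspan : Submodule.span ℝ (Γ.g '' M) = ⊤ := by
    rw [eq_top_iff, ← Γ.span, Submodule.span_le]
    rintro _ ⟨y, hy, rfl⟩
    revert hy
    suffices h : ∀ y ∈ Γ.box, Γ.g y ∈ Submodule.span ℝ (Γ.g '' M) from fun hy => h y hy.1
    apply conflict_induction hM
    · intro y hy; rw [Γ.g_exc y hy]; exact Submodule.zero_mem _
    · intro y hy; exact Submodule.subset_span ⟨y, hy, rfl⟩
    · intro y _ m hm _ h0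
      rw [eq_neg_of_add_eq_zero_left h0]
      exact Submodule.neg_mem _ (Submodule.subset_span ⟨m, hm, rfl⟩)
    · intro y _ m hm _ z _ z' _ hs _ h1 h2
      rw [eq_sub_of_add_eq hs]
      exact Submodule.sub_mem _ (Submodule.add_mem _ h1 h2) (Submodule.subset_span ⟨m, hm, rfl⟩)
  have hind : LinearIndependent ℝ (fun m : M => Γ.g m) := Γ.indep M hM.1.1 hM.1.2
  let b : Module.Basis M ℝ (Fin n → ℝ) := Module.Basis.mk hind (by
    rw [← hspan, Set.image_eq_range])
  have hb : ∀ m : M, b m = Γ.g m := fun m => by simp [b]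
  let h : (Fin n → ℝ) →ₗ[ℝ] ℝ := b.constr ℝ (fun _ => (1 : ℝ))
  have hh : ∀ m ∈ M, h (Γ.g m) = 1 := fun m hm => by
    rw [← hb ⟨m, hm⟩]; simp [h, Module.Basis.constr_basis]
  let c : ι → (Fin n → ℝ) →ₗ[ℝ] ℝ := fun m => if hm : m ∈ M then b.coord ⟨m, hm⟩ else 0
  have hc1 : ∀ m ∈ M, c m (Γ.g m) = 1 := fun m hm => by
    rw [← hb ⟨m, hm⟩]; simp [c, hm]
  have hc2 : ∀ m ∈ M, ∀ m' ∈ M, m ≠ m' → c m (Γ.g m') = 0 := fun m hm m' hm' hne => by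
    rw [← hb ⟨m', hm'⟩]; simp [c, hm, Ne.symm hne]
  refine ⟨c, h, hc1, hc2, hh, hspan, ?_, ?_, ?_⟩
  · apply conflict_induction hM
    · intro y hy; rw [Γ.g_exc y hy]; simp
    · intro y hy; exact (hh y hy).le
    · intro y _ m hm _ h0
      have := congrArg h h0
      simp only [map_add, map_zero, hh m hm] at this
      linarith
    · intro y _ m hm _ z _ z' _ hs _ h1 h2
      have := congrArg h hs
      simp only [map_add, hh m hm] at this
      linarith
  · intro v hv
    apply b.ext_elem
    intro m
    have := hv m m.2
    simp only [c, m.2, dite_true, Module.Basis.coord_apply] at this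
    simpa using this
  · intro x hx y hy
    suffices h : ∀ y ∈ Γ.box, Γ.Coh x y → 0 ≤ c x (Γ.g y) from h y hy.1
    apply conflict_induction hM
    · intro y hy _; rw [Γ.g_exc y hy]; simp
    · intro y hy _
      by_cases hxy : x = y
      · subst hxy; rw [hc1 x hx]; exact zero_le_one
      · rw [hc2 x hx y hy hxy]
    · intro y _ m hm hym h0 hxy
      have hne : x ≠ m := by
        rintro rfl; exact hym (Γ.coh_symm _ _ hxy)
      have := congrArg (c x) h0
      simp only [map_add, map_zero, hc2 x hx m hm hne] at this
      linarith
    · intro y _ m hm hym z _ z' _ hs hw h1 h2 hxy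
      have hne : x ≠ m := by
        rintro rfl; exact hym (Γ.coh_symm _ _ hxy)
      have := congrArg (c x) hs
      simp only [map_add, hc2 x hx m hm hne] at this
      have h3 := hw x hx hxy
      have := h1 h3.1
      have := h2 h3.2
      linarith

end CoherenceSystem

end PullDKK

/-! ### The cell containing the simplex of a maximal clique. -/

namespace PullDKK

theorem pullSeq_concat {n : ℕ} (P : Set (Fin n → ℝ)) (xs : List (Fin n → ℝ)) (x : Fin n → ℝ) :
    pullSeq P (xs ++ [x]) = pull (pullSeq P xs) x := by
  simp [pullSeq]

namespace CoherenceSystem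

variable {ι : Type*} {n : ℕ} {Γ : CoherenceSystem ι n}

/-- The cells obtained by pulling at the origin and then along `L`. -/
def cells (Γ : CoherenceSystem ι n) (L : List ι) : Set (Set (Fin n → ℝ)) :=
  pullSeq Γ.polytope (0 :: L.map Γ.g)

theorem cells_nil : Γ.cells [] = pull {Γ.polytope} 0 := rfl

theorem cells_concat (L : List ι) (x : ι) : Γ.cells (L ++ [x]) = pull (Γ.cells L) (Γ.g x) := by
  rw [cells, cells, ← pullSeq_concat]
  simp

theorem AllSteps.of_prefix {V W : List ι} (h : Γ.AllSteps (V ++ W)) : Γ.AllSteps V := by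
  intro V' x W' hV
  exact h V' x (W' ++ W) (by rw [hV]; simp)

theorem zero_mem_polytope : (0 : Fin n → ℝ) ∈ Γ.polytope :=
  subset_convexHull ℝ _ (Set.mem_insert _ _)

namespace DualData

variable {M : Set ι} (D : DualData Γ M)

/-- The elements on the face of a cell still to be subdivided, for the cells that contain the
simplex of `M`. -/
def remaining (V : List ι) : Set ι :=
  {y | y ∈ Γ.reg ∧ D.h (Γ.g y) = 1 ∧ ∀ m ∈ M, m ∈ V → D.c m (Γ.g y) = 0}

/-- The pulled members of `M` are the apexes; the remaining elements span the base. -/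
def vertices (V : List ι) : Set ι := {m | m ∈ M ∧ m ∈ V} ∪ D.remaining V

def cell (V : List ι) : Set (Fin n → ℝ) := convexHull ℝ (insert 0 (Γ.g '' D.vertices V))

/-- Pulling at `x` after `V` does not cut the simplex of `M`. -/
def StepOK (V : List ι) (x : ι) : Prop :=
  x ∈ D.remaining V → x ∈ M ∧ ∀ y ∈ D.remaining V, 0 ≤ D.c x (Γ.g y)

def AllOK (L : List ι) : Prop := ∀ V x W, L = V ++ x :: W → D.StepOK V x

variable {D}

theorem AllOK.of_prefix {V W : List ι} (h : D.AllOK (V ++ W)) : D.AllOK V := by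
  intro V' x W' hV
  exact h V' x (W' ++ W) (by rw [hV]; simp)

theorem AllOK.concat {V : List ι} {x : ι} (h : D.AllOK V) (hx : D.StepOK V x) :
    D.AllOK (V ++ [x]) := by
  intro V' y W' hV
  rcases List.eq_nil_or_concat W' with rfl | ⟨W'', w, rfl⟩
  · obtain ⟨rfl, h2⟩ := List.append_inj' hV rfl
    simp at h2
    exact h2 ▸ hx
  · have : V ++ [x] = (V' ++ y :: W'') ++ [w] := by simpa using hV
    obtain ⟨rfl, -⟩ := List.append_inj' this rfl
    exact h _ _ _ rfl

theorem remaining_subset (V : List ι) : D.remaining V ⊆ Γ.reg := fun _ h => h.1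

theorem remaining_anti {V W : List ι} (h : V ⊆ W) : D.remaining W ⊆ D.remaining V :=
  fun _ hy => ⟨hy.1, hy.2.1, fun m hm hmV => hy.2.2 m hm (h hmV)⟩

theorem mem_remaining_of_mem (hM : M ⊆ Γ.reg) {V : List ι} {m : ι} (hm : m ∈ M) (hmV : m ∉ V) :
    m ∈ D.remaining V :=
  ⟨hM hm, D.h_one m hm, fun m' hm' hV => D.c_ne m' hm' m hm (fun e => hmV (e ▸ hV))⟩

theorem subset_vertices (hM : M ⊆ Γ.reg) (V : List ι) : M ⊆ D.vertices V := by
  intro m hm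
  by_cases hV : m ∈ V
  · exact Or.inl ⟨hm, hV⟩
  · exact Or.inr (mem_remaining_of_mem hM hm hV)

theorem vertices_subset (hM : M ⊆ Γ.reg) (V : List ι) : D.vertices V ⊆ Γ.reg := by
  rintro x (hx | hx)
  · exact hM hx.1
  · exact hx.1

theorem cell_subset (hM : M ⊆ Γ.reg) (V : List ι) : D.cell V ⊆ Γ.polytope :=
  convexHull_mono (Set.insert_subset_insert (Set.image_mono (vertices_subset hM V)))

theorem simplex_subset_cell (hM : M ⊆ Γ.reg) (V : List ι) : Γ.simplex M ⊆ D.cell V :=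
  convexHull_mono (Set.insert_subset_insert (Set.image_mono (subset_vertices hM V)))

theorem vertices_h {V : List ι} {y : ι} (hy : y ∈ D.vertices V) : D.h (Γ.g y) = 1 := by
  rcases hy with hy | hy
  · exact D.h_one y hy.1
  · exact hy.2.1

theorem g_mem_cell_iff (hM : M ⊆ Γ.reg) {V : List ι} {x : ι} (hx : x ∈ Γ.reg) :
    Γ.g x ∈ D.cell V ↔ x ∈ D.vertices V := by
  constructor
  · intro h
    have hs : insert 0 (Γ.g '' D.vertices V) ⊆ Γ.polytope := by
      rintro _ (rfl | ⟨y, hy, rfl⟩)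
      · exact zero_mem_polytope
      · exact g_mem_polytope (vertices_subset hM V hy)
    rcases mem_of_g_mem_convexHull hx hs h with h0 | ⟨y, hy, he⟩
    · exact absurd h0 (g_ne_zero hx)
    · rwa [← g_injOn (vertices_subset hM V hy) hx he]
  · intro h
    exact subset_convexHull ℝ _ (Or.inr ⟨x, h, rfl⟩)

theorem functional_ext {l l' : (Fin n → ℝ) →ₗ[ℝ] ℝ} (D : DualData Γ M)
    (h : ∀ m ∈ M, l (Γ.g m) = l' (Γ.g m)) : l = l' := by
  apply LinearMap.ext_on D.span
  rintro _ ⟨m, hm, rfl⟩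
  exact h m hm

theorem span_of_subset (D : DualData Γ M) {S : Set (Fin n → ℝ)} (h : Γ.g '' M ⊆ S) :
    Submodule.span ℝ S = ⊤ := by
  rw [eq_top_iff, ← D.span]; exact Submodule.span_mono h

theorem vectorSpan_cell (hM : M ⊆ Γ.reg) (V : List ι) : vectorSpan ℝ (D.cell V) = ⊤ := by
  apply vectorSpan_eq_top_of_span
  · exact subset_convexHull ℝ _ (Set.mem_insert _ _)
  · apply D.span_of_subset
    rintro _ ⟨m, hm, rfl⟩
    exact subset_convexHull ℝ _ (Or.inr ⟨m, subset_vertices hM V hm, rfl⟩)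

theorem sep_cell {V : List ι} (l : (Fin n → ℝ) →ₗ[ℝ] ℝ) (c : ℝ)
    (h0 : ∀ y ∈ insert 0 (Γ.g '' D.vertices V), l y ≤ c) :
    {z ∈ D.cell V | l z = c} = convexHull ℝ {y ∈ insert 0 (Γ.g '' D.vertices V) | l y = c} :=
  convexHull_sep_eq l h0

/-- After an admissible step at `x ∈ remaining V`, the new cell is the pyramid with apex `x` over
the facet where the coordinate of `x` vanishes. -/
theorem cell_concat {V : List ι} {x : ι} (hxM : x ∈ M) (hxV : x ∉ V)
    (hnn : ∀ y ∈ D.remaining V, 0 ≤ D.c x (Γ.g y)) :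
    D.cell (V ++ [x]) = convexHull ℝ (insert (Γ.g x) {z ∈ D.cell V | (-D.c x) z = 0}) := by
  -- On the vertices of the cell `c x` is nonnegative: it vanishes at `0` and at the old apexes, and
  -- `hnn` covers the base. So `c x = 0` cuts out a face.
  have hle : ∀ y ∈ insert 0 (Γ.g '' D.vertices V), (-D.c x) y ≤ 0 := by
    rintro _ (rfl | ⟨y, hy | hy, rfl⟩)
    · simp
    · have : x ≠ y := fun e => hxV (e ▸ hy.2)
      simp [D.c_ne x hxM y hy.1 this]
    · simpa using hnn y hy
  rw [sep_cell _ 0 hle, cell]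
  have h1 : convexHull ℝ (insert (Γ.g x)
      (convexHull ℝ {y ∈ insert 0 (Γ.g '' D.vertices V) | (-D.c x) y = 0})) =
      convexHull ℝ (insert (Γ.g x) {y ∈ insert 0 (Γ.g '' D.vertices V) | (-D.c x) y = 0}) := by
    apply Set.Subset.antisymm
    · apply convexHull_min _ (convex_convexHull ℝ _)
      apply Set.insert_subset
      · exact subset_convexHull ℝ _ (Set.mem_insert _ _)
      · exact convexHull_mono (Set.subset_insert _ _)
    · exact convexHull_mono (Set.insert_subset_insert (subset_convexHull ℝ _))
  rw [h1]
  congr 1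
  ext z
  constructor
  · rintro (rfl | ⟨y, hy | hy, rfl⟩)
    · exact Or.inr ⟨Or.inl rfl, by simp⟩
    · by_cases hyx : y = x
      · subst hyx; exact Or.inl rfl
      · right
        have hyV : y ∈ V := by
          have := hy.2; simp [hyx] at this; exact this
        exact ⟨Or.inr ⟨y, Or.inl ⟨hy.1, hyV⟩, rfl⟩, by simp [D.c_ne x hxM y hy.1 (Ne.symm hyx)]⟩
    · right
      refine ⟨Or.inr ⟨y, Or.inr (remaining_anti (by simp) hy), rfl⟩, ?_⟩
      simp [hy.2.2 x hxM (by simp)]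
  · rintro (rfl | ⟨rfl | ⟨y, hy | hy, rfl⟩, h0⟩)
    · exact Or.inr ⟨x, Or.inl ⟨hxM, by simp⟩, rfl⟩
    · exact Or.inl rfl
    · exact Or.inr ⟨y, Or.inl ⟨hy.1, by simp [hy.2]⟩, rfl⟩
    · refine Or.inr ⟨y, Or.inr ⟨hy.1, hy.2.1, fun m hm hmV => ?_⟩, rfl⟩
      rcases List.mem_append.1 hmV with h | h
      · exact hy.2.2 m hm h
      · simp at h; subst h; simpa using h0

theorem cell_concat_of_notMem (hM : M ⊆ Γ.reg) {V : List ι} {x : ι} (hxV : x ∉ V)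
    (hx : x ∉ D.remaining V) : D.cell (V ++ [x]) = D.cell V := by
  have hxM : x ∉ M := fun h => hx (mem_remaining_of_mem hM h hxV)
  have hne : ∀ m ∈ M, m ≠ x := fun m hm e => hxM (e ▸ hm)
  have : D.vertices (V ++ [x]) = D.vertices V := by
    ext y
    simp only [vertices, remaining, Set.mem_union, Set.mem_ofPred_eq, List.mem_append,
      List.mem_singleton]
    constructor
    · rintro (⟨h1, h2⟩ | ⟨h1, h2, h3⟩)
      · exact Or.inl ⟨h1, h2.resolve_right (hne y h1)⟩
      · exact Or.inr ⟨h1, h2, fun m hm hV => h3 m hm (Or.inl hV)⟩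
    · rintro (⟨h1, h2⟩ | ⟨h1, h2, h3⟩)
      · exact Or.inl ⟨h1, Or.inl h2⟩
      · exact Or.inr ⟨h1, h2, fun m hm hV => h3 m hm (hV.resolve_right (hne m hm))⟩
  rw [cell, cell, this]

theorem vertices_nil : D.vertices [] = {y ∈ Γ.reg | D.h (Γ.g y) = 1} := by
  ext y; simp [vertices, remaining]

theorem sep_polytope (D : DualData Γ M) :
    {z ∈ Γ.polytope | D.h z = 1} = convexHull ℝ (Γ.g '' D.vertices []) := by
  have hle : ∀ y ∈ insert 0 (Γ.g '' Γ.reg), D.h y ≤ 1 := by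
    rintro _ (rfl | ⟨y, hy, rfl⟩)
    · simp
    · exact D.h_le y hy.1
  rw [polytope, convexHull_sep_eq _ hle, vertices_nil]
  congr 1
  ext z
  constructor
  · rintro ⟨rfl | ⟨y, hy, rfl⟩, h⟩
    · simp at h
    · exact ⟨y, ⟨hy, h⟩, rfl⟩
  · rintro ⟨y, ⟨hy, h⟩, rfl⟩
    exact ⟨Or.inr ⟨y, hy, rfl⟩, h⟩

theorem cell_nil_eq (D : DualData Γ M) :
    D.cell [] = convexHull ℝ (insert 0 {z ∈ Γ.polytope | D.h z = 1}) := by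
  rw [sep_polytope, cell]
  apply Set.Subset.antisymm
  · exact convexHull_mono (Set.insert_subset_insert (subset_convexHull ℝ _))
  · apply convexHull_min _ (convex_convexHull ℝ _)
    apply Set.insert_subset
    · exact subset_convexHull ℝ _ (Set.mem_insert _ _)
    · exact convexHull_mono (Set.subset_insert _ _)

theorem polytope_h_le (D : DualData Γ M) {z : Fin n → ℝ} (hz : z ∈ Γ.polytope) : D.h z ≤ 1 := by
  refine convexHull_le_of_forall_le D.h ?_ hz
  rintro _ (rfl | ⟨y, hy, rfl⟩)
  · simp
  · exact D.h_le y hy.1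

theorem cell_nil_mem (D : DualData Γ M) (hM : M ⊆ Γ.reg) (hne : M.Nonempty) :
    D.cell [] ∈ Γ.cells [] := by
  obtain ⟨m0, hm0⟩ := hne
  right
  refine ⟨_, rfl, zero_mem_polytope, {z ∈ Γ.polytope | D.h z = 1}, ?_, ?_, D.cell_nil_eq⟩
  · have hmem : ∀ m ∈ M, Γ.g m ∈ {z ∈ Γ.polytope | D.h z = 1} := fun m hm =>
      ⟨g_mem_polytope (hM hm), D.h_one m hm⟩
    refine isFacet_of_span D.h 1 ?_ (fun y hy => D.polytope_h_le hy) rfl ⟨_, hmem m0 hm0⟩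
      (Γ.g m0) (by rw [D.h_one m0 hm0]; exact one_ne_zero) ?_
    · apply vectorSpan_eq_top_of_span zero_mem_polytope
      apply D.span_of_subset
      rintro _ ⟨m, hm, rfl⟩
      exact g_mem_polytope (hM hm)
    · rw [eq_top_iff, ← D.span, Submodule.span_le]
      rintro _ ⟨m, hm, rfl⟩
      have h1 := vsub_mem_vectorSpan ℝ (hmem m hm) (hmem m0 hm0)
      refine Submodule.mem_sup.2 ⟨_, h1, _, Submodule.mem_span_singleton_self _, ?_⟩
      simp
  · rintro ⟨-, h⟩
    simp at h

/-- If `x` is remaining, the step is admissible and the relevant facet is `c x = 0`: it contains `0`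
and all of `M` except `x`. Otherwise `g x` is outside the cell, which is therefore kept. -/
theorem cell_mem_cells (D : DualData Γ M) (hM : M ⊆ Γ.reg) (hne : M.Nonempty) (L : List ι)
    (hnd : L.Nodup) (hL : ∀ x ∈ L, x ∈ Γ.reg) (hok : D.AllOK L) : D.cell L ∈ Γ.cells L := by
  induction L using List.reverseRecOn with
  | nil => exact D.cell_nil_mem hM hne
  | append_singleton V x ih =>
    have hxV : x ∉ V := by
      rw [List.nodup_append] at hnd
      exact fun h => hnd.2.2 x h x (by simp) rfl
    have ih' := ih (List.nodup_append.1 hnd).1 (fun y hy => hL y (by simp [hy])) hok.of_prefix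
    have hx : x ∈ Γ.reg := hL x (by simp)
    have hstep : D.StepOK V x := hok V x [] rfl
    rw [cells_concat]
    by_cases hxr : x ∈ D.remaining V
    · obtain ⟨hxM, hnn⟩ := hstep hxr
      right
      have hle : ∀ z ∈ D.cell V, (-D.c x) z ≤ 0 := by
        intro z hz
        refine convexHull_le_of_forall_le (-D.c x) ?_ hz
        rintro _ (rfl | ⟨y, hy | hy, rfl⟩)
        · simp
        · have : x ≠ y := fun e => hxV (e ▸ hy.2)
          simp [D.c_ne x hxM y hy.1 this]
        · simpa using hnn y hy
      have h0 : (0 : Fin n → ℝ) ∈ {z ∈ D.cell V | (-D.c x) z = 0} :=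
        ⟨subset_convexHull ℝ _ (Set.mem_insert _ _), by simp⟩
      refine ⟨D.cell V, ih', (g_mem_cell_iff hM hx).2 (Or.inr hxr),
        {z ∈ D.cell V | (-D.c x) z = 0}, ?_, ?_, cell_concat hxM hxV hnn⟩
      · refine isFacet_of_span (-D.c x) 0 (vectorSpan_cell hM V) hle rfl ⟨0, h0⟩ (Γ.g x)
          (by simp [D.c_self x hxM]) ?_
        rw [eq_top_iff, ← D.span, Submodule.span_le]
        rintro _ ⟨m, hm, rfl⟩
        by_cases hmx : m = x
        · subst hmx
          exact Submodule.mem_sup_right (Submodule.mem_span_singleton_self _)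
        · apply Submodule.mem_sup_left
          have hmF : Γ.g m ∈ {z ∈ D.cell V | (-D.c x) z = 0} :=
            ⟨(g_mem_cell_iff hM (hM hm)).2 (subset_vertices hM V hm), by
              simp [D.c_ne x hxM m hm (Ne.symm hmx)]⟩
          simpa using vsub_mem_vectorSpan ℝ hmF h0
      · rintro ⟨-, h⟩
        simp [D.c_self x hxM] at h
    · left
      rw [cell_concat_of_notMem hM hxV hxr]
      refine ⟨ih', fun h => ?_⟩
      rcases (g_mem_cell_iff hM hx).1 h with h1 | h1
      · exact hxV h1.2
      · exact hxr h1

/-- `h` is `1` at every vertex other than `0`, hence positive on the rest of the cell; the origin is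
the unique minimum of `h`. -/
theorem zero_extreme (D : DualData Γ M) {V : List ι} {s : Set (Fin n → ℝ)} (hs : s ⊆ D.cell V)
    (h : (0 : Fin n → ℝ) ∈ convexHull ℝ s) : (0 : Fin n → ℝ) ∈ s := by
  by_contra hn
  have hpos : ∀ z ∈ D.cell V, z ≠ 0 → D.h z > 0 := by
    intro z hz hz0
    have hle : ∀ y ∈ insert 0 (Γ.g '' D.vertices V), (-D.h) y ≤ 0 := by
      rintro _ (rfl | ⟨y, hy, rfl⟩)
      · simp
      · simp [vertices_h hy]
    have h1 := convexHull_le_of_forall_le _ hle hz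
    refine lt_of_le_of_ne (by simpa using h1) fun he => hz0 ?_
    have h2 := mem_convexHull_face _ hle hz (by simp [← he])
    have hsub : {y ∈ insert 0 (Γ.g '' D.vertices V) | (-D.h) y = 0} ⊆ {0} := by
      rintro _ ⟨rfl | ⟨y, hy, rfl⟩, h⟩
      · rfl
      · simp [vertices_h hy] at h
    simpa using convexHull_mono hsub h2
  have : convexHull ℝ s ⊆ {z | 0 < D.h z} :=
    convexHull_min (fun y hy => hpos y (hs hy) (fun e => hn (e ▸ hy)))
      (convex_halfSpace_gt D.h.isLinear _)
  have h2 : 0 < D.h (0 : Fin n → ℝ) := this h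
  simp at h2

/-- A cell of the pulled subdivision containing the simplex of `M` is the expected one, and then no
step cuts the simplex of `M`. -/
theorem eq_cell_of_mem_cells (D : DualData Γ M) (hM : M ⊆ Γ.reg) (L : List ι)
    (hnd : L.Nodup) (hL : ∀ x ∈ L, x ∈ Γ.reg) {S : Set (Fin n → ℝ)} (hS : S ∈ Γ.cells L)
    (hMS : Γ.simplex M ⊆ S) : S = D.cell L ∧ D.AllOK L := by
  have h0S : (0 : Fin n → ℝ) ∈ Γ.simplex M := subset_convexHull ℝ _ (Set.mem_insert _ _)
  have hmS : ∀ m ∈ M, Γ.g m ∈ Γ.simplex M := fun m hm =>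
    subset_convexHull ℝ _ (Or.inr ⟨m, hm, rfl⟩)
  induction L using List.reverseRecOn generalizing S with
  | nil =>
    refine ⟨?_, fun V x W h => by simp at h⟩
    rw [cells_nil] at hS
    rcases hS with ⟨hS, hn⟩ | ⟨_, rfl, -, F, hF, h0F, rfl⟩
    · exact absurd (hMS h0S) hn
    obtain ⟨l, c, hle, hFeq⟩ := hF.exists_functional
    have hFP : F ⊆ Γ.polytope := by rw [hFeq]; exact Set.sep_subset _ _
    have hmF : ∀ m ∈ M, Γ.g m ∈ F := by
      intro m hm
      have := mem_of_g_mem_convexHull (hM hm)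
        (Set.insert_subset zero_mem_polytope hFP) (hMS (hmS m hm))
      exact this.resolve_left (g_ne_zero (hM hm))
    have hc : c ≠ 0 := by
      rintro rfl
      apply h0F
      rw [hFeq]
      exact ⟨zero_mem_polytope, by simp⟩
    -- The members of `M` are extreme points of the polytope, so they lie on `F` itself. As they
    -- span, they determine the functional of `F` up to scale.
    have hl : l = c • D.h := by
      apply functional_ext D
      intro m hm
      have := hmF m hm
      rw [hFeq] at this
      simp [D.h_one m hm, this.2]
    rw [cell_nil_eq, hFeq]
    congr 2
    ext z
    simp only [Set.mem_ofPred_eq, hl, LinearMap.smul_apply, smul_eq_mul]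
    constructor
    · rintro ⟨h1, h2⟩
      exact ⟨h1, mul_left_cancel₀ hc (by rw [h2, mul_one])⟩
    · rintro ⟨h1, h2⟩
      exact ⟨h1, by rw [h2, mul_one]⟩
  | append_singleton V x ih =>
    have hxV : x ∉ V := by
      rw [List.nodup_append] at hnd
      exact fun h => hnd.2.2 x h x (by simp) rfl
    have ih' := fun S hS hMS => ih (S := S) (List.nodup_append.1 hnd).1
      (fun y hy => hL y (by simp [hy])) hS hMS
    have hx : x ∈ Γ.reg := hL x (by simp)
    rw [cells_concat] at hS
    rcases hS with ⟨hS, hn⟩ | ⟨S, hS, hxS, F, hF, hxF, rfl⟩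
    · obtain ⟨rfl, hok⟩ := ih' S hS hMS
      have hxr : x ∉ D.remaining V := fun h => hn ((g_mem_cell_iff hM hx).2 (Or.inr h))
      exact ⟨(cell_concat_of_notMem hM hxV hxr).symm, hok.concat fun h => absurd h hxr⟩
    · obtain ⟨l, c, hle, hFeq⟩ := hF.exists_functional
      have hFS : F ⊆ S := by rw [hFeq]; exact Set.sep_subset _ _
      -- Convexity puts the new pyramid inside the old cell, which therefore contains the simplex of
      -- `M`, and the induction hypothesis applies.
      have hSconv : Convex ℝ S := by
        clear hxS hF hFS hFeq hle hMS
        revert S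
        have key : ∀ xs : List (Fin n → ℝ), ∀ S ∈ pullSeq Γ.polytope xs, Convex ℝ S := by
          intro xs
          induction xs using List.reverseRecOn with
          | nil =>
            rintro S rfl
            exact convex_convexHull ℝ _
          | append_singleton xs y ih =>
            intro S hS
            rw [pullSeq_concat] at hS
            rcases hS with hS | ⟨_, _, _, _, _, _, rfl⟩
            · exact ih S hS.1
            · exact convex_convexHull ℝ _
        intro S hS
        exact key _ S hS
      have hsub : convexHull ℝ (insert (Γ.g x) F) ⊆ S :=
        convexHull_min (Set.insert_subset hxS hFS) hSconv
      obtain ⟨rfl, hok⟩ := ih' S hS (hMS.trans hsub)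
      have hxr : x ∈ D.remaining V := by
        rcases (g_mem_cell_iff hM hx).1 hxS with h | h
        · exact absurd h.2 hxV
        · exact h
      have hins : insert (Γ.g x) F ⊆ Γ.polytope :=
        (Set.insert_subset hxS hFS).trans (cell_subset hM V)
      have hmF : ∀ m ∈ M, m ≠ x → Γ.g m ∈ F := by
        intro m hm hmx
        have := mem_of_g_mem_convexHull (hM hm) hins (hMS (hmS m hm))
        exact this.resolve_left fun e => hmx (g_injOn (hM hm) hx e)
      -- The origin is extreme in the cell and differs from the apex, so it lies on the facet and
      -- the level `c` is `0`.
      have h0F : (0 : Fin n → ℝ) ∈ F := by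
        have := D.zero_extreme (Set.insert_subset hxS hFS) (hMS h0S)
        exact this.resolve_left fun e => g_ne_zero hx e.symm
      have hc : c = 0 := by
        rw [hFeq] at h0F
        simpa using h0F.2.symm
      subst hc
      have hlm : ∀ m ∈ M, m ≠ x → l (Γ.g m) = 0 := by
        intro m hm hmx
        have := hmF m hm hmx
        rw [hFeq] at this
        exact this.2
      have hlx : l (Γ.g x) < 0 := by
        refine lt_of_le_of_ne (hle _ hxS) fun e => hxF ?_
        rw [hFeq]; exact ⟨hxS, e⟩
      -- Otherwise `l` would vanish on all of `M`, hence be zero, although it is negative at `x`.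
      have hxM : x ∈ M := by
        by_contra hxM
        have : l = 0 := by
          apply functional_ext D
          intro m hm
          rw [hlm m hm (fun e => hxM (e ▸ hm))]; rfl
        rw [this] at hlx
        simp at hlx
      have hl : l = l (Γ.g x) • D.c x := by
        apply functional_ext D
        intro m hm
        by_cases hmx : m = x
        · subst hmx; simp [D.c_self m hm]
        · simp [hlm m hm hmx, D.c_ne x hxM m hm (Ne.symm hmx)]
      have hlv : ∀ v, l v = l (Γ.g x) * D.c x v := fun v => by
        conv_lhs => rw [hl]
        simp
      -- `l` is a negative multiple of `c x` and is at most `0` on the cell.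
      have hnn : ∀ y ∈ D.remaining V, 0 ≤ D.c x (Γ.g y) := by
        intro y hy
        have h1 := hle (Γ.g y) ((g_mem_cell_iff hM hy.1).2 (Or.inr hy))
        rw [hlv] at h1
        by_contra hneg
        push Not at hneg
        nlinarith [mul_pos_of_neg_of_neg hlx hneg]
      refine ⟨?_, hok.concat fun _ => ⟨hxM, hnn⟩⟩
      rw [cell_concat hxM hxV hnn, hFeq]
      congr 2
      ext z
      simp only [Set.mem_ofPred_eq, hlv z, mul_eq_zero, hlx.ne, false_or, LinearMap.neg_apply,
        neg_eq_zero]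

end DualData

end CoherenceSystem

end PullDKK

/-! ### Pull steps are the steps that cut no maximal simplex. -/

namespace PullDKK

section

variable {n : ℕ}

theorem IsFacet.vectorSpan_eq_ker {S F : Set (Fin n → ℝ)} (hF : IsFacet S F)
    (hS : vectorSpan ℝ S = ⊤) {l : (Fin n → ℝ) →ₗ[ℝ] ℝ} {c : ℝ} (hl : l ≠ 0)
    (hc : ∀ z ∈ F, l z = c) : vectorSpan ℝ F = LinearMap.ker l := by
  have h1 := hF.2.2
  rw [hS, finrank_top, Module.finrank_fin_fun] at h1
  have h2 := finrank_ker_add_one hl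
  exact Submodule.eq_of_le_of_finrank_eq (vectorSpan_le_ker l hc) (by omega)

theorem eq_top_of_ker_le {l : (Fin n → ℝ) →ₗ[ℝ] ℝ} {U : Submodule ℝ (Fin n → ℝ)}
    (hU : LinearMap.ker l ≤ U) {v : Fin n → ℝ} (hv : v ∈ U) (hlv : l v ≠ 0) : U = ⊤ := by
  rw [eq_top_iff]
  intro w _
  have h1 : w - (l w / l v) • v ∈ U := hU (by simp [hlv])
  simpa using U.add_mem h1 (U.smul_mem (l w / l v) hv)

theorem vectorSpan_convexHull_le {s : Set (Fin n → ℝ)} :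
    vectorSpan ℝ (convexHull ℝ s) ≤ Submodule.span ℝ s := by
  have h : convexHull ℝ s ⊆ Submodule.span ℝ s :=
    convexHull_min Submodule.subset_span (Submodule.convex _)
  rw [vectorSpan_def, Submodule.span_le]
  rintro _ ⟨a, ha, b, hb, rfl⟩
  exact Submodule.sub_mem _ (h ha) (h hb)

theorem convexHull_insert_convexHull {E : Type*} [AddCommGroup E] [Module ℝ E] (x : E)
    (s : Set E) : convexHull ℝ (insert x (convexHull ℝ s)) = convexHull ℝ (insert x s) := by
  apply Set.Subset.antisymm
  · apply convexHull_min _ (convex_convexHull ℝ _)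
    apply Set.insert_subset
    · exact subset_convexHull ℝ _ (Set.mem_insert _ _)
    · exact convexHull_mono (Set.subset_insert _ _)
  · exact convexHull_mono (Set.insert_subset_insert (subset_convexHull ℝ _))

end

namespace CoherenceSystem

variable {ι : Type*} {n : ℕ} {Γ : CoherenceSystem ι n}

theorem AllSteps.concat {V : List ι} {x : ι} (h : Γ.AllSteps V) (hx : Γ.Step V x) :
    Γ.AllSteps (V ++ [x]) := by
  intro V' y W' hV
  rcases List.eq_nil_or_concat W' with rfl | ⟨W'', w, rfl⟩
  · obtain ⟨rfl, h2⟩ := List.append_inj' hV rfl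
    simp at h2
    exact h2 ▸ hx
  · have : V ++ [x] = (V' ++ y :: W'') ++ [w] := by simpa using hV
    obtain ⟨rfl, -⟩ := List.append_inj' this rfl
    exact h _ _ _ rfl

/-- `Y` is closed under the relations `g a + g b = g z + g z'`. -/
def RelClosed (Γ : CoherenceSystem ι n) (Y : Set ι) : Prop :=
  ∀ a ∈ Y, ∀ b ∈ Y, ∀ z ∈ Γ.box, ∀ z' ∈ Γ.box, Γ.g a + Γ.g b = Γ.g z + Γ.g z' → z ∈ Y ∧ z' ∈ Y

/-- At a pull step, everything left on a face through `x` is coherent with `x`. -/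
theorem Step.coh_of_mem {V : List ι} {x : ι} (hstep : Γ.Step V x) {Y : Set ι} (hY : Y ⊆ Γ.reg)
    (hcl : Γ.RelClosed Y) (hV : ∀ y ∈ Y, y ∉ V) {h : (Fin n → ℝ) →ₗ[ℝ] ℝ}
    (hh : ∀ y ∈ Y, h (Γ.g y) = 1) (hx : x ∈ Y) {y : ι} (hy : y ∈ Y) : Γ.Coh x y := by
  by_contra hxy
  -- Opposite vectors are impossible at the common height `1`. Otherwise both resolvents are in `Y`,
  -- so neither is exceptional or pulled, although one of the two families containing them has been
  -- dealt with entirely.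
  rcases Γ.resolve x (hY hx) y (hY hy) hxy with h0 | ⟨z, hz, z', hz', hsum, -, -, hpos⟩
  · have := congrArg h h0
    simp only [map_add, hh x hx, hh y hy, map_zero] at this
    norm_num at this
  · obtain ⟨h1, h2⟩ := hcl x hx y hy z hz z' hz' hsum
    have hnot : ∀ u ∈ Y, u ∉ Γ.done V := by
      rintro u hu (h | h)
      · exact (hY hu).2 h
      · exact hV u hu h
    rcases hpos with ⟨p1, p2⟩ | ⟨p1, p2⟩
    · rcases hstep.1 with h | h
      · exact hnot z h1 (h p1)
      · exact hnot z' h2 (h p2)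
    · rcases hstep.2 with h | h
      · exact hnot z h1 (h p1)
      · exact hnot z' h2 (h p2)

/-- Two values at most `1` with sum `2` are both `1`; exceptional elements are excluded because
their value is `0`. -/
theorem relClosed_of_functional {h : (Fin n → ℝ) →ₗ[ℝ] ℝ} (hle : ∀ y ∈ Γ.box, h (Γ.g y) ≤ 1) :
    Γ.RelClosed {y | y ∈ Γ.reg ∧ h (Γ.g y) = 1} := by
  rintro a ⟨-, ha⟩ b ⟨-, hb⟩ z hz z' hz' hs
  have h1 := congrArg h hs
  simp only [map_add, ha, hb] at h1
  have h2 := hle z hz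
  have h3 := hle z' hz'
  have key : ∀ u ∈ Γ.box, h (Γ.g u) = 1 → u ∈ Γ.reg ∧ h (Γ.g u) = 1 := by
    refine fun u hu he => ⟨⟨hu, fun hx => ?_⟩, he⟩
    rw [Γ.g_exc u hx] at he
    simp at he
  exact ⟨key z hz (by linarith), key z' hz' (by linarith)⟩

theorem relClosed_face {Y : Set ι} (hY : Γ.RelClosed Y) {l : (Fin n → ℝ) →ₗ[ℝ] ℝ}
    (hle : ∀ y ∈ Y, l (Γ.g y) ≤ 0) : Γ.RelClosed {y | y ∈ Y ∧ l (Γ.g y) = 0} := by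
  rintro a ⟨ha, hla⟩ b ⟨hb, hlb⟩ z hz z' hz' hs
  obtain ⟨h1, h2⟩ := hY a ha b hb z hz z' hz' hs
  have h3 := congrArg l hs
  simp only [map_add, hla, hlb] at h3
  have := hle z h1
  have := hle z' h2
  exact ⟨⟨h1, by linarith⟩, ⟨h2, by linarith⟩⟩

section Simplex

variable {M : Set ι} {D : DualData Γ M}

/-- The remaining set starts as the face `h = 1`. Each admissible step at a member of `M` intersects
it with the face where that coordinate vanishes, and passing to a face preserves closedness. -/
theorem DualData.relClosed_remaining (hM : M ⊆ Γ.reg) {V : List ι} (hnd : V.Nodup)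
    (hok : D.AllOK V) : Γ.RelClosed (D.remaining V) := by
  induction V using List.reverseRecOn with
  | nil =>
    have := relClosed_of_functional D.h_le
    convert this using 1
    ext y; simp [DualData.remaining]
  | append_singleton V x ih =>
    have hxV : x ∉ V := by
      rw [List.nodup_append] at hnd
      exact fun h => hnd.2.2 x h x (by simp) rfl
    have ih' := ih (List.nodup_append.1 hnd).1 hok.of_prefix
    by_cases hxM : x ∈ M
    · have hs := hok V x [] rfl (DualData.mem_remaining_of_mem hM hxM hxV)
      have := relClosed_face ih' (l := -D.c x) (fun y hy => by simpa using hs.2 y hy)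
      convert this using 1
      ext y
      simp only [DualData.remaining, List.mem_append, List.mem_singleton, Set.mem_ofPred_eq,
        LinearMap.neg_apply, neg_eq_zero]
      constructor
      · rintro ⟨h1, h2, h3⟩
        exact ⟨⟨h1, h2, fun m hm hV => h3 m hm (Or.inl hV)⟩, h3 x hxM (Or.inr rfl)⟩
      · rintro ⟨⟨h1, h2, h3⟩, h4⟩
        exact ⟨h1, h2, fun m hm hV => hV.elim (h3 m hm) (fun e => e ▸ h4)⟩
    · convert ih' using 1
      ext y
      simp only [DualData.remaining, List.mem_append, List.mem_singleton, Set.mem_ofPred_eq]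
      refine and_congr_right fun _ => and_congr_right fun _ => ?_
      refine ⟨fun h m hm hV => h m hm (Or.inl hV), fun h m hm hV => h m hm ?_⟩
      exact hV.resolve_right fun e => hxM (e ▸ hm)

/-- If `z` had been pulled, it was already remaining at that moment, so admissibility gave `z ∈ M`.
Then `c z (g z)` would have to be both `0` and `1`. -/
theorem DualData.notMem_of_mem_remaining {V : List ι} (hok : D.AllOK V) {z : ι}
    (hz : z ∈ D.remaining V) : z ∉ V := by
  intro hzV
  obtain ⟨V1, V2, rfl⟩ := List.append_of_mem hzV
  have hzM := (hok V1 z V2 rfl (DualData.remaining_anti (by simp) hz)).1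
  have := hz.2.2 z hzM (by simp)
  rw [D.c_self z hzM] at this
  exact one_ne_zero this

theorem DualData.mem_span_of_coords (D : DualData Γ M) {V : List ι} {v : Fin n → ℝ}
    (hv : ∀ m ∈ M, m ∈ V → D.c m v = 0) :
    v ∈ Submodule.span ℝ (Γ.g '' {m | m ∈ M ∧ m ∉ V}) := by
  have hU : Γ.g '' M = Γ.g '' {m | m ∈ M ∧ m ∈ V} ∪ Γ.g '' {m | m ∈ M ∧ m ∉ V} := by
    rw [← Set.image_union]
    congr 1
    ext m
    simp only [Set.mem_union, Set.mem_ofPred_eq]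
    tauto
  have hmem : v ∈ Submodule.span ℝ (Γ.g '' M) := by rw [D.span]; trivial
  rw [hU, Submodule.span_union] at hmem
  obtain ⟨u, hu, w, hw, rfl⟩ := Submodule.mem_sup.1 hmem
  have hvan : ∀ s : Set ι, s ⊆ M → ∀ m ∈ M, m ∉ s → ∀ t ∈ Submodule.span ℝ (Γ.g '' s),
      D.c m t = 0 := by
    intro s hs m hm hms t ht
    have : Submodule.span ℝ (Γ.g '' s) ≤ LinearMap.ker (D.c m) := by
      rw [Submodule.span_le]
      rintro _ ⟨y, hy, rfl⟩
      exact D.c_ne m hm y (hs hy) (fun e => hms (e ▸ hy))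
    exact this ht
  have hu0 : u = 0 := by
    apply D.c_ext
    intro m hm
    by_cases hmV : m ∈ V
    · have h1 := hvan {m | m ∈ M ∧ m ∉ V} (fun _ h => h.1) m hm (fun h => h.2 hmV) w hw
      have h2 := hv m hm hmV
      rw [map_add, h1, add_zero] at h2
      exact h2
    · exact hvan {m | m ∈ M ∧ m ∈ V} (fun _ h => h.1) m hm (fun h => hmV h.2) u hu
  rw [hu0, zero_add]
  exact hw

/-- A remaining `x` is coherent with all remaining elements, in particular with the unpulled part of
`M`, and its vector lies in the span of that part. If `x ∉ M`, adding `x` would give a linearly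
dependent clique. -/
theorem AllSteps.allOK (D : DualData Γ M) (hM : Γ.IsCohClique M) {L : List ι} (hnd : L.Nodup)
    (hL : Γ.AllSteps L) : D.AllOK L := by
  induction L using List.reverseRecOn with
  | nil => exact fun V x W h => by simp at h
  | append_singleton V x ih =>
    have ih' := ih (List.nodup_append.1 hnd).1 hL.of_prefix
    refine ih'.concat fun hx => ?_
    have hxV := DualData.notMem_of_mem_remaining ih' hx
    have hcoh : ∀ y ∈ D.remaining V, Γ.Coh x y := fun y hy =>
      (hL V x [] rfl).coh_of_mem (DualData.remaining_subset V)
        (DualData.relClosed_remaining hM.1 (List.nodup_append.1 hnd).1 ih')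
        (fun y hy => DualData.notMem_of_mem_remaining ih' hy) (fun y hy => hy.2.1) hx hy
    have hxM : x ∈ M := by
      by_contra hxM
      have hsub : ∀ m ∈ {m | m ∈ M ∧ m ∉ V}, Γ.Coh x m := fun m hm =>
        hcoh m (DualData.mem_remaining_of_mem hM.1 hm.1 hm.2)
      have hli := Γ.indep (insert x {m | m ∈ M ∧ m ∉ V})
        (Set.insert_subset hx.1 fun m hm => hM.1 hm.1) (by
          rintro a (rfl | ha) b (rfl | hb)
          · exact Γ.coh_self _ hx.1.1
          · exact hsub b hb
          · exact Γ.coh_symm _ _ (hsub a ha)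
          · exact hM.2 a ha.1 b hb.1)
      rw [linearIndepOn_insert (fun h => hxM h.1)] at hli
      exact hli.2 (D.mem_span_of_coords hx.2.2)
    exact ⟨hxM, fun y hy => D.c_nonneg x hxM y hy.1 (hcoh y hy)⟩

end Simplex

/-- If no maximal simplex is cut, all steps are pull steps. -/
theorem allSteps_of_allOK (hw : Γ.HasWitnesses) {L : List ι} (hnd : L.Nodup)
    (hreg : ∀ x ∈ L, x ∈ Γ.reg)
    (hok : ∀ M, Maximal Γ.IsCohClique M → ∀ D : DualData Γ M, D.AllOK L) : Γ.AllSteps L := by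
  induction L using List.reverseRecOn with
  | nil => exact fun V x W h => by simp at h
  | append_singleton V x ih =>
    have hxV : x ∉ V := by
      rw [List.nodup_append] at hnd
      exact fun h => hnd.2.2 x h x (by simp) rfl
    have hndV := (List.nodup_append.1 hnd).1
    have hregV : ∀ y ∈ V, y ∈ Γ.reg := fun y hy => hreg y (by simp [hy])
    have ih' := ih hndV hregV (fun M hM D => (hok M hM D).of_prefix)
    refine ih'.concat ?_
    by_contra hns
    have hx : x ∈ Γ.reg := hreg x (by simp)
    -- In a maximal clique containing `y`, `y'` and `z`, the expansion `g x = g y + g y' - g z`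
    -- shows which coordinates of `x` are nonzero.
    obtain ⟨y, hy, y', hy', z, hz, h1, h2, h3, hxz, hyV, hyV', hsum⟩ :=
      hw V x ih' hregV hx hxV hns
    have hcl : Γ.IsCohClique {y, y', z} := by
      refine ⟨by rintro _ (rfl | rfl | rfl) <;> assumption, ?_⟩
      rintro a (rfl | rfl | rfl) b (rfl | rfl | rfl) <;>
        first
        | exact Γ.coh_self _ (by first | exact hy.1 | exact hy'.1 | exact hz.1)
        | assumption
        | (apply Γ.coh_symm; assumption)
    obtain ⟨M, hsub, hM⟩ := hcl.exists_maximal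
    obtain ⟨D⟩ := nonempty_dualData hM
    have hyM : y ∈ M := hsub (by simp)
    have hyM' : y' ∈ M := hsub (by simp)
    have hzM : z ∈ M := hsub (by simp)
    have hxM : x ∉ M := fun h => hxz (hM.1.2 x h z hzM)
    have hOK := hok M hM D
    have hgx : Γ.g x = Γ.g y + Γ.g y' - Γ.g z := by rw [← hsum]; simp
    have hh : D.h (Γ.g x) = 1 := by
      rw [hgx]; simp [D.h_one y hyM, D.h_one y' hyM', D.h_one z hzM]
    have hcm : ∀ m ∈ M, m ∈ V → m ≠ z → D.c m (Γ.g x) = 0 := by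
      intro m hm hmV hmz
      have e1 : m ≠ y := fun e => hyV (e ▸ hmV)
      have e2 : m ≠ y' := fun e => hyV' (e ▸ hmV)
      rw [hgx]
      simp [D.c_ne m hm y hyM e1, D.c_ne m hm y' hyM' e2, D.c_ne m hm z hzM hmz]
    -- When `z` was pulled, `x` would have been remaining with coordinate `-1` at `z`, contrary to
    -- admissibility of that step.
    have hzV : z ∉ V := by
      intro hzV
      obtain ⟨V1, V2, rfl⟩ := List.append_of_mem hzV
      have hz1 : z ∉ V1 := by
        rw [List.nodup_append] at hndV
        exact fun h => hndV.2.2 z h z (by simp) rfl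
      have hxr : x ∈ D.remaining V1 := ⟨hx, hh, fun m hm hmV =>
        hcm m hm (by simp [hmV]) (fun e => hz1 (e ▸ hmV))⟩
      have hnn := (hOK V1 z (V2 ++ [x]) (by simp)
        (DualData.mem_remaining_of_mem hM.1.1 hzM hz1)).2 x hxr
      have e1 : z ≠ y := fun e => hyV (e ▸ hzV)
      have e2 : z ≠ y' := fun e => hyV' (e ▸ hzV)
      rw [hgx] at hnn
      simp only [map_sub, map_add, D.c_ne z hzM y hyM e1, D.c_ne z hzM y' hyM' e2,
        D.c_self z hzM] at hnn
      norm_num at hnn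
    -- All coordinates of `x` at pulled members of `M` vanish. Admissibility would put `x` in `M`,
    -- where it conflicts with `z`.
    have hxr : x ∈ D.remaining V := ⟨hx, hh, fun m hm hmV =>
      hcm m hm hmV (fun e => hzV (e ▸ hmV))⟩
    exact hxM (hOK V x [] rfl hxr).1

theorem maximal_nonempty (hn : 0 < n) {M : Set ι} (hM : Maximal Γ.IsCohClique M) :
    M.Nonempty := by
  obtain ⟨D⟩ := nonempty_dualData hM
  rw [Set.nonempty_iff_ne_empty]
  rintro rfl
  have hbt := D.span
  rw [Set.image_empty, Submodule.span_empty] at hbt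
  have : Nonempty (Fin n) := ⟨⟨0, hn⟩⟩
  exact bot_ne_top hbt

theorem refines_iff_allSteps (hn : 0 < n) (hw : Γ.HasWitnesses) {L : List ι} (hnd : L.Nodup)
    (hreg : ∀ x ∈ L, x ∈ Γ.reg) :
    (∀ M, Maximal Γ.IsCohClique M → ∃ S ∈ Γ.cells L, Γ.simplex M ⊆ S) ↔ Γ.AllSteps L := by
  constructor
  · intro h
    refine allSteps_of_allOK hw hnd hreg fun M hM D => ?_
    obtain ⟨S, hS, hsub⟩ := h M hM
    exact (D.eq_cell_of_mem_cells hM.1.1 L hnd hreg hS hsub).2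
  · intro h M hM
    obtain ⟨D⟩ := nonempty_dualData hM
    exact ⟨D.cell L, D.cell_mem_cells hM.1.1 (maximal_nonempty hn hM) L hnd hreg
      (h.allOK D hM.1 hnd), DualData.simplex_subset_cell hM.1.1 L⟩

end CoherenceSystem

end PullDKK

/-! ### Every cell produced by pull steps is a pyramid. -/

namespace PullDKK

namespace CoherenceSystem

variable {ι : Type*} {n : ℕ} {Γ : CoherenceSystem ι n}

/-- The shape of the cells obtained by pull steps: an iterated pyramid with apexes `X` and the
origin over a face with vertices `Y`, none of which has been pulled. -/
structure IsPyramid (Γ : CoherenceSystem ι n) (V : List ι) (S : Set (Fin n → ℝ)) (X Y : Set ι) :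
    Prop where
  subset_X : X ⊆ Γ.reg
  subset_Y : Y ⊆ Γ.reg
  eq_hull : S = convexHull ℝ (insert 0 (Γ.g '' (X ∪ Y)))
  not_pulled : ∀ y ∈ Y, y ∉ V
  span : Submodule.span ℝ (Γ.g '' (X ∪ Y)) = ⊤
  height : ∃ h : (Fin n → ℝ) →ₗ[ℝ] ℝ, ∀ y ∈ X ∪ Y, h (Γ.g y) = 1
  apex : ∀ a ∈ X, ∃ φ : (Fin n → ℝ) →ₗ[ℝ] ℝ, φ (Γ.g a) = 1 ∧
    ∀ b ∈ X ∪ Y, b ≠ a → φ (Γ.g b) = 0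
  closed : Γ.RelClosed Y
  coh : ∀ a ∈ X, ∀ b ∈ X ∪ Y, Γ.Coh a b

theorem vectorSpan_polytope : vectorSpan ℝ Γ.polytope = ⊤ := by
  apply vectorSpan_eq_top_of_span zero_mem_polytope
  rw [eq_top_iff, ← Γ.span, Submodule.span_le]
  rintro _ ⟨y, hy, rfl⟩
  exact Submodule.subset_span (g_mem_polytope hy)

/-- A facet missing the origin has a functional with positive level `c`. Dividing by `c` gives the
height, and the facet is the hull of the non-exceptional vectors of height `1`. -/
theorem exists_isPyramid_nil {S : Set (Fin n → ℝ)} (hS : S ∈ Γ.cells []) :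
    ∃ Y, Γ.IsPyramid [] S ∅ Y := by
  rw [cells_nil] at hS
  rcases hS with ⟨rfl, h0⟩ | ⟨_, rfl, -, F, hF, h0F, rfl⟩
  · exact absurd zero_mem_polytope h0
  obtain ⟨l, c, hle, hFeq⟩ := hF.exists_functional
  have hc0 : 0 ≤ c := by simpa using hle 0 zero_mem_polytope
  have hc : 0 < c := by
    refine lt_of_le_of_ne hc0 fun e => h0F ?_
    rw [hFeq]; exact ⟨zero_mem_polytope, by simp [← e]⟩
  have hleg : ∀ y ∈ insert 0 (Γ.g '' Γ.reg), l y ≤ c := fun y hy =>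
    hle y (subset_convexHull ℝ _ hy)
  set Y : Set ι := {y | y ∈ Γ.reg ∧ (c⁻¹ • l) (Γ.g y) = 1} with hYdef
  have hYl : ∀ y ∈ Y, l (Γ.g y) = c := by
    rintro y ⟨-, h⟩
    simp only [LinearMap.smul_apply, smul_eq_mul] at h
    field_simp at h
    exact h
  have hFY : F = convexHull ℝ (Γ.g '' Y) := by
    rw [hFeq, polytope, convexHull_sep_eq _ hleg]
    congr 1
    ext z
    constructor
    · rintro ⟨rfl | ⟨y, hy, rfl⟩, h⟩
      · simp at h; exact absurd h hc.ne
      · refine ⟨y, ⟨hy, ?_⟩, rfl⟩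
        simp [h, hc.ne']
    · rintro ⟨y, hy, rfl⟩
      exact ⟨Or.inr ⟨y, hy.1, rfl⟩, hYl y hy⟩
  refine ⟨Y, ⟨Set.empty_subset _, fun y hy => hy.1, ?_, by simp, ?_, ⟨c⁻¹ • l, ?_⟩, by simp, ?_,
    by simp⟩⟩
  · rw [hFY, convexHull_insert_convexHull, Set.empty_union]
  · obtain ⟨f, hf⟩ := hF.1
    have hlne : l ≠ 0 := by
      rintro rfl
      rw [hFeq] at hf
      exact hc.ne (by simpa using hf.2)
    have hker := hF.vectorSpan_eq_ker vectorSpan_polytope hlne (c := c)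
      (fun z hz => by rw [hFeq] at hz; exact hz.2)
    have hle' : LinearMap.ker l ≤ Submodule.span ℝ (Γ.g '' Y) := by
      rw [← hker, hFY]; exact vectorSpan_convexHull_le
    have hYne : Y.Nonempty := by
      rw [hFY] at hf
      by_contra hne
      rw [Set.not_nonempty_iff_eq_empty] at hne
      simp [hne] at hf
    obtain ⟨y, hy⟩ := hYne
    rw [Set.empty_union]
    exact eq_top_of_ker_le hle' (Submodule.subset_span ⟨y, hy, rfl⟩)
      (by rw [hYl y hy]; exact hc.ne')
  · rintro y (hy | hy)
    · exact absurd hy (Set.notMem_empty _)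
    · exact hy.2
  · apply relClosed_of_functional
    intro y hy
    by_cases hye : y ∈ Γ.exc
    · rw [Γ.g_exc y hye]; simp
    · have := hle _ (g_mem_polytope (Γ := Γ) ⟨hy, hye⟩)
      simp only [LinearMap.smul_apply, smul_eq_mul]
      rw [inv_mul_le_iff₀ hc]
      simpa using this

/-- A facet missing the origin would be the level `h = 1`, and a facet missing an old apex `a` would
be the face `φ = 0` opposite to `a`. Both contain `g x`, so a facet avoiding `g x` contains the
origin and all old apexes. It is thus a pyramid over a face of the base, and `x` becomes one more
apex, coherent with all the others by `coh_of_mem`. -/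
theorem IsPyramid.exists_of_pull {V : List ι} {S : Set (Fin n → ℝ)} {X Y : Set ι}
    (hp : Γ.IsPyramid V S X Y) {x : ι} (hx : x ∈ Γ.reg) (hxV : x ∉ V) (hXV : X ⊆ {y | y ∈ V})
    (hstep : Γ.Step V x) {F : Set (Fin n → ℝ)} (hxS : Γ.g x ∈ S) (hF : IsFacet S F)
    (hxF : Γ.g x ∉ F) :
    ∃ X' Y', Γ.IsPyramid (V ++ [x]) (convexHull ℝ (insert (Γ.g x) F)) X' Y' ∧
      X' ⊆ {y | y ∈ V ++ [x]} := by
  obtain ⟨l, c, hle, hFeq⟩ := hF.exists_functional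
  obtain ⟨h, hh⟩ := hp.height
  have hXY : X ∪ Y ⊆ Γ.reg := Set.union_subset hp.subset_X hp.subset_Y
  have h0S : (0 : Fin n → ℝ) ∈ S := by
    rw [hp.eq_hull]; exact subset_convexHull ℝ _ (Set.mem_insert _ _)
  have hgS : ∀ y ∈ X ∪ Y, Γ.g y ∈ S := fun y hy => by
    rw [hp.eq_hull]; exact subset_convexHull ℝ _ (Or.inr ⟨y, hy, rfl⟩)
  have hleg : ∀ y ∈ insert 0 (Γ.g '' (X ∪ Y)), l y ≤ c := by
    rintro _ (rfl | ⟨y, hy, rfl⟩)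
    · exact hle _ h0S
    · exact hle _ (hgS y hy)
  have hxXY : x ∈ X ∪ Y := by
    rw [hp.eq_hull] at hxS
    have := mem_of_g_mem_convexHull hx (by
      rintro _ (rfl | ⟨y, hy, rfl⟩)
      · exact zero_mem_polytope
      · exact g_mem_polytope (hXY hy)) hxS
    rcases this with h0 | ⟨y, hy, he⟩
    · exact absurd h0 (g_ne_zero hx)
    · rwa [← g_injOn (hXY hy) hx he]
  have hxX : x ∉ X := fun h => hxV (hXV h)
  have hxY : x ∈ Y := hxXY.resolve_left hxX
  have hlx : l (Γ.g x) < c := by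
    refine lt_of_le_of_ne (hle _ hxS) fun e => hxF ?_
    rw [hFeq]; exact ⟨hxS, e⟩
  have hlne : l ≠ 0 := by
    rintro rfl
    obtain ⟨f, hf⟩ := hF.1
    rw [hFeq] at hf
    have : (0 : ℝ) = c := hf.2
    simp [← this] at hlx
  have hFc : ∀ z ∈ F, l z = c := fun z hz => by rw [hFeq] at hz; exact hz.2
  have hSspan : vectorSpan ℝ S = ⊤ := by
    apply vectorSpan_eq_top_of_span h0S
    rw [eq_top_iff, ← hp.span]
    apply Submodule.span_mono
    rintro _ ⟨y, hy, rfl⟩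
    exact hgS y hy
  have hker := hF.vectorSpan_eq_ker hSspan hlne hFc
  have hFhull : F = convexHull ℝ {y ∈ insert 0 (Γ.g '' (X ∪ Y)) | l y = c} := by
    rw [hFeq, hp.eq_hull, convexHull_sep_eq _ hleg]
  obtain ⟨f, hf⟩ := hF.1
  -- the facet contains the origin
  have hc : c = 0 := by
    by_contra hc
    have hFh : ∀ z ∈ F, h z = 1 := by
      intro z hz
      rw [hFhull] at hz
      refine convexHull_min (t := {z | h z = 1}) ?_ (convex_hyperplane h.isLinear 1) hz
      rintro _ ⟨rfl | ⟨y, hy, rfl⟩, h1⟩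
      · simp at h1; exact absurd h1.symm hc
      · exact hh y hy
    have hle' : LinearMap.ker l ≤ LinearMap.ker h := by
      rw [← hker]; exact vectorSpan_le_ker h hFh
    obtain ⟨t, ht⟩ := exists_eq_smul_of_ker_le hle'
    have h1 := hFh f hf
    have h2 := hh x hxXY
    have ht0 : t * l (Γ.g x) = 1 := by rw [← h2, ht]; simp
    have ht1 : t * c = 1 := by rw [← h1, ht, ← hFc f hf]; simp
    have htne : t ≠ 0 := by rintro rfl; simp at ht1
    exact hlx.ne (mul_left_cancel₀ htne (ht0.trans ht1.symm))
  subst hc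
  -- the facet contains all the old apexes
  have hXl : ∀ a ∈ X, l (Γ.g a) = 0 := by
    intro a ha
    by_contra hla
    obtain ⟨φ, hφ1, hφ0⟩ := hp.apex a ha
    have hFφ : ∀ z ∈ F, φ z = 0 := by
      intro z hz
      rw [hFhull] at hz
      refine convexHull_min (t := {z | φ z = 0}) ?_ (convex_hyperplane φ.isLinear 0) hz
      rintro _ ⟨rfl | ⟨y, hy, rfl⟩, h1⟩
      · simp
      · exact hφ0 y hy (fun e => hla (e ▸ h1))
    have hle' : LinearMap.ker l ≤ LinearMap.ker φ := by
      rw [← hker]; exact vectorSpan_le_ker φ hFφ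
    obtain ⟨t, ht⟩ := exists_eq_smul_of_ker_le hle'
    have h1 : φ (Γ.g x) = 0 := hφ0 x hxXY (fun e => hxX (e ▸ ha))
    have h2 : t * l (Γ.g x) = 0 := by rw [← h1, ht]; simp
    have h3 : t * l (Γ.g a) = 1 := by rw [← hφ1, ht]; simp
    have htne : t ≠ 0 := by rintro rfl; simp at h3
    exact hlx.ne ((mul_eq_zero.1 h2).resolve_left htne)
  set Y' : Set ι := {y | y ∈ Y ∧ l (Γ.g y) = 0} with hY'
  have hFXY : F = convexHull ℝ (insert 0 (Γ.g '' (X ∪ Y'))) := by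
    rw [hFhull]
    congr 1
    ext z
    constructor
    · rintro ⟨rfl | ⟨y, hy | hy, rfl⟩, h1⟩
      · exact Or.inl rfl
      · exact Or.inr ⟨y, Or.inl hy, rfl⟩
      · exact Or.inr ⟨y, Or.inr ⟨hy, h1⟩, rfl⟩
    · rintro (rfl | ⟨y, hy | hy, rfl⟩)
      · exact ⟨Or.inl rfl, by simp⟩
      · exact ⟨Or.inr ⟨y, Or.inl hy, rfl⟩, hXl y hy⟩
      · exact ⟨Or.inr ⟨y, Or.inr hy.1, rfl⟩, hy.2⟩
  have hY'Y : Y' ⊆ Y := fun y hy => hy.1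
  have hcohx : ∀ y ∈ Y, Γ.Coh x y := fun y hy =>
    hstep.coh_of_mem hp.subset_Y hp.closed hp.not_pulled
      (fun y hy => hh y (Or.inr hy)) hxY hy
  have hsub : insert x X ∪ Y' ⊆ X ∪ Y := by
    rintro y ((rfl | hy) | hy)
    · exact hxXY
    · exact Or.inl hy
    · exact Or.inr hy.1
  refine ⟨insert x X, Y', ⟨Set.insert_subset hx hp.subset_X, hY'Y.trans hp.subset_Y, ?_, ?_, ?_,
    ⟨h, fun y hy => hh y (hsub hy)⟩, ?_, ?_, ?_⟩, ?_⟩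
  · rw [hFXY, convexHull_insert_convexHull, Set.insert_comm, Set.insert_union, Set.image_insert_eq]
  · intro y hy hyV
    rcases List.mem_append.1 hyV with h1 | h1
    · exact hp.not_pulled y hy.1 h1
    · simp at h1; subst h1; exact hlx.ne hy.2
  · refine eq_top_of_ker_le (l := l) ?_ (v := Γ.g x)
      (Submodule.subset_span ⟨x, Or.inl (Or.inl rfl), rfl⟩) hlx.ne
    rw [← hker, hFXY]
    refine vectorSpan_convexHull_le.trans ?_
    rw [Submodule.span_insert_zero]
    apply Submodule.span_mono
    apply Set.image_mono
    exact Set.union_subset_union_left _ (Set.subset_insert _ _)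
  · rintro a (rfl | ha)
    · refine ⟨(l (Γ.g a))⁻¹ • l, by simp [hlx.ne], ?_⟩
      rintro b ((rfl | hb) | hb) hne
      · exact absurd rfl hne
      · simp [hXl b hb]
      · simp [hb.2]
    · obtain ⟨φ, h1, h2⟩ := hp.apex a ha
      exact ⟨φ, h1, fun b hb => h2 b (hsub hb)⟩
  · exact relClosed_face hp.closed fun y hy => hle _ (hgS y (Or.inr hy))
  · rintro a (rfl | ha) b hb
    · rcases hb with (rfl | hb) | hb
      · exact Γ.coh_self _ hx.1
      · exact Γ.coh_symm _ _ (hp.coh b hb _ hxXY)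
      · exact hcohx b hb.1
    · exact hp.coh a ha b (hsub hb)
  · rintro y (rfl | hy)
    · simp
    · exact List.mem_append_left _ (hXV hy)

theorem exists_isPyramid {L : List ι} (hnd : L.Nodup) (hreg : ∀ x ∈ L, x ∈ Γ.reg)
    (hsteps : Γ.AllSteps L) {S : Set (Fin n → ℝ)} (hS : S ∈ Γ.cells L) :
    ∃ X Y, Γ.IsPyramid L S X Y ∧ X ⊆ {y | y ∈ L} := by
  induction L using List.reverseRecOn generalizing S with
  | nil =>
    obtain ⟨Y, h⟩ := exists_isPyramid_nil hS
    exact ⟨∅, Y, h, Set.empty_subset _⟩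
  | append_singleton V x ih =>
    have hxV : x ∉ V := by
      rw [List.nodup_append] at hnd
      exact fun h => hnd.2.2 x h x (by simp) rfl
    have ih' := fun S hS => ih (S := S) (List.nodup_append.1 hnd).1
      (fun y hy => hreg y (by simp [hy])) hsteps.of_prefix hS
    have hx : x ∈ Γ.reg := hreg x (by simp)
    rw [cells_concat] at hS
    rcases hS with ⟨hS, hn⟩ | ⟨S, hS, hxS, F, hF, hxF, rfl⟩
    · obtain ⟨X, Y, hp, hX⟩ := ih' S hS
      refine ⟨X, Y, { hp with not_pulled := ?_ }, fun y hy => List.mem_append_left _ (hX hy)⟩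
      intro y hy hyV
      rcases List.mem_append.1 hyV with h1 | h1
      · exact hp.not_pulled y hy h1
      · simp at h1
        subst h1
        apply hn
        rw [hp.eq_hull]
        exact subset_convexHull ℝ _ (Or.inr ⟨y, Or.inr hy, rfl⟩)
    · obtain ⟨X, Y, hp, hX⟩ := ih' S hS
      exact hp.exists_of_pull hx hxV hX (hsteps V x [] rfl) hxS hF hxF

/-- Pulling at all regular elements by pull steps gives the triangulation into the simplices of the
maximal cliques. -/
theorem cells_eq_iff_allSteps (hn : 0 < n) (hw : Γ.HasWitnesses) {L : List ι} (hnd : L.Nodup)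
    (hreg : ∀ x ∈ L, x ∈ Γ.reg) (hfull : ∀ x ∈ Γ.reg, x ∈ L) :
    Γ.cells L = {C | ∃ M, Maximal Γ.IsCohClique M ∧ C = Γ.simplex M} ↔ Γ.AllSteps L := by
  constructor
  · intro h
    rw [← refines_iff_allSteps hn hw hnd hreg, h]
    exact fun M hM => ⟨_, ⟨M, hM, rfl⟩, subset_rfl⟩
  · intro h
    apply Set.Subset.antisymm
    · intro S hS
      obtain ⟨X, Y, hp, -⟩ := exists_isPyramid hnd hreg h hS
      -- The base consists of unpulled regular elements, and everything regular has been pulled.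
      have hY : Y = ∅ := by
        rw [Set.eq_empty_iff_forall_notMem]
        exact fun y hy => hp.not_pulled y hy (hfull y (hp.subset_Y hy))
      subst hY
      have hXc : Γ.IsCohClique X := ⟨hp.subset_X, fun a ha b hb => hp.coh a ha b (Or.inl hb)⟩
      obtain ⟨M, hXM, hM⟩ := hXc.exists_maximal
      -- `X` already spans the space, so a larger clique could not be independent.
      have hMX : M ⊆ X := by
        intro m hm
        by_contra hmX
        have hli := Γ.indep (insert m X)
          (Set.insert_subset (hM.1.1 hm) hp.subset_X) fun a ha b hb =>
            hM.1.2 a (Set.insert_subset hm hXM ha) b (Set.insert_subset hm hXM hb)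
        rw [linearIndepOn_insert hmX] at hli
        have hs := hp.span
        rw [Set.union_empty] at hs
        exact hli.2 (hs ▸ Submodule.mem_top)
      refine ⟨M, hM, ?_⟩
      rw [hp.eq_hull, Set.union_empty, Set.Subset.antisymm hXM hMX, simplex]
    · rintro _ ⟨M, hM, rfl⟩
      obtain ⟨D⟩ := nonempty_dualData hM
      have hok := h.allOK D hM.1 hnd
      have hmem := D.cell_mem_cells hM.1.1 (maximal_nonempty hn hM) L hnd hreg hok
      -- A remaining element would be unpulled, so the explicit cell has shrunk to the simplex.
      have : D.vertices L = M := by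
        apply Set.Subset.antisymm
        · rintro y (hy | hy)
          · exact hy.1
          · exact absurd (hfull y hy.1) (DualData.notMem_of_mem_remaining hok hy)
        · exact DualData.subset_vertices hM.1.1 L
      rwa [DualData.cell, this] at hmem

end CoherenceSystem

end PullDKK

/-! ### Arcs on the legs of a path or cycle, and conflicts that cross within a leg. -/

namespace PullDKK

/-- A subdivision of the positions `1, …, K + 1` into legs, whose ends are the positions satisfying
`Bd`. The positions are the vertices of a path if `n = K + 1`; the first and the last position are
the same vertex of a cycle if `n = K`. -/
structure LegData where
  K : ℕ
  n : ℕ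
  Bd : ℕ → Prop
  n_eq : n = K ∨ n = K + 1
  K_pos : 1 ≤ K
  bd_one : Bd 1
  bd_last : Bd (K + 1)
  cycle : n = K → 3 ≤ K ∧ ∃ p, 1 < p ∧ p < K + 1 ∧ Bd p

namespace LegData

variable (Λ : LegData)

/-- The vertex at a position. -/
def vtx (p : ℕ) : ℕ := if p ≤ Λ.n then p else 1

end LegData

/-- The lower end of an arc, which is coded by a pair `(α, β)`: `α = 2 p` if the arc starts at `p`
with a turn, and `α = 2 p - 1` if it starts at the end `p` of a leg without a turn; `β = 2 q` if it
ends at `q` with a turn, and `β = 2 q + 1` if it ends at the end `q` of a leg without a turn. -/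
def lo (a : ℕ × ℕ) : ℕ := (a.1 + 1) / 2

/-- The upper end of an arc. -/
def hi (a : ℕ × ℕ) : ℕ := a.2 / 2

namespace LegData

variable (Λ : LegData)

/-- Single-vertex arcs are restricted by `triv` because the same route must not be coded twice. At a
leg end they occur only at the two extremes of a path, and there one of the two codes is prescribed.
-/
structure IsBox (a : ℕ × ℕ) : Prop where
  lo_pos : 1 ≤ lo a
  lo_le : lo a ≤ hi a
  hi_le : hi a ≤ Λ.K + 1
  inner : ∀ p, Λ.Bd p → ¬ (lo a < p ∧ p < hi a)
  bd_lo : a.1 % 2 = 1 → Λ.Bd (lo a)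
  bd_hi : a.2 % 2 = 1 → Λ.Bd (hi a)
  triv : lo a = hi a → (Λ.n = Λ.K + 1 ∧ lo a = 1 ∧ a.2 = 2) ∨
    (Λ.n = Λ.K + 1 ∧ lo a = Λ.K + 1 ∧ a.1 = 2 * (Λ.K + 1)) ∨ ¬ Λ.Bd (lo a)

/-- For a box, equal codes mean a short exceptional route through one vertex, and two odd codes mean
a long one along a whole leg. -/
def Exc (a : ℕ × ℕ) : Prop := a.1 = a.2 ∨ (a.1 % 2 = 1 ∧ a.2 % 2 = 1)

def IsReg (a : ℕ × ℕ) : Prop := Λ.IsBox a ∧ ¬ Exc a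

/-- The arc `a` has coordinate `-1` at `v`. -/
def Neg (a : ℕ × ℕ) (v : ℕ) : Prop := a.1 % 2 = 0 ∧ a.1 ≠ a.2 ∧ Λ.vtx (lo a) = v

/-- The arc `a` has coordinate `1` at `v`. -/
def Pos (a : ℕ × ℕ) (v : ℕ) : Prop := a.2 % 2 = 0 ∧ a.1 ≠ a.2 ∧ Λ.vtx (hi a) = v

/-- The arcs `r`, `s` are in conflict, with `r` to the upper left of `s` in the diagram. -/
def NW (r s : ℕ × ℕ) : Prop :=
  (r.1 < s.1 ∧ lo s < hi r ∧ r.2 < s.2) ∨ ∃ v, Λ.Pos r v ∧ Λ.Neg s v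

def Coh (r s : ℕ × ℕ) : Prop := ¬ Λ.NW r s ∧ ¬ Λ.NW s r

open Classical in
noncomputable def g (a : ℕ × ℕ) (i : Fin Λ.n) : ℝ :=
  (if Λ.Pos a (i + 1) then 1 else 0) - (if Λ.Neg a (i + 1) then 1 else 0)

/-- `t` lies on the leg to the left of that of `a`, and both contain the same edge at the common end
of these legs. -/
def Adj (t a : ℕ × ℕ) : Prop :=
  lo t < hi t ∧ lo a < hi a ∧ Λ.vtx (hi t) = Λ.vtx (lo a) ∧ (a.1 % 2 = 0 ↔ t.2 % 2 = 1)

/-- For an arc on a forward leg the families `loA`, `loB`, `hiA`, `hiB` correspond to west, north,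
east and south. On a backward leg they correspond to north, west, south and east. The `Adj`
alternative covers neighbours on the adjacent leg that share the source or sink edge. -/
def loA (a : ℕ × ℕ) : Set (ℕ × ℕ) := {t | Λ.IsBox t ∧ ((t.1 = a.1 ∧ t.2 < a.2) ∨ Λ.Adj t a)}
def loB (a : ℕ × ℕ) : Set (ℕ × ℕ) := {t | Λ.IsBox t ∧ t.2 = a.2 ∧ t.1 < a.1}
def hiA (a : ℕ × ℕ) : Set (ℕ × ℕ) := {t | Λ.IsBox t ∧ t.1 = a.1 ∧ a.2 < t.2}
def hiB (a : ℕ × ℕ) : Set (ℕ × ℕ) := {t | Λ.IsBox t ∧ ((t.2 = a.2 ∧ a.1 < t.1) ∨ Λ.Adj a t)}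

variable {Λ}

theorem IsBox.trivial_codes {x : ℕ × ℕ} (hx : Λ.IsBox x) (h : lo x = hi x) :
    x.1 = x.2 ∨ (lo x = 1 ∧ x.1 = 1 ∧ x.2 = 2) ∨
      (lo x = Λ.K + 1 ∧ x.1 = 2 * (Λ.K + 1) ∧ x.2 = 2 * (Λ.K + 1) + 1) := by
  have h1 := hx.bd_lo
  have h2 := hx.bd_hi
  rw [← h] at h2
  rcases hx.triv h with h3 | h3 | h3
  · simp only [lo, hi] at *; omega
  · simp only [lo, hi] at *; omega
  · have e1 : x.1 % 2 ≠ 1 := fun h => h3 (h1 h)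
    have e2 : x.2 % 2 ≠ 1 := fun h => h3 (h2 h)
    clear h1 h2 h3
    simp only [lo, hi] at *; omega

theorem IsBox.cycle {a : ℕ × ℕ} (h : Λ.IsBox a) (hn : Λ.n = Λ.K) :
    lo a ≤ Λ.K ∧ 2 ≤ hi a ∧ ¬ (lo a = 1 ∧ hi a = Λ.K + 1) := by
  have h1 := h.lo_pos
  have h2 := h.lo_le
  have h3 := h.hi_le
  refine ⟨?_, ?_, ?_⟩
  · by_contra hc
    have e : lo a = Λ.K + 1 := by omega
    rcases h.triv (by omega) with h | h | h
    · omega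
    · omega
    · exact h (e ▸ Λ.bd_last)
  · by_contra hc
    have e : lo a = 1 := by omega
    rcases h.triv (by omega) with h | h | h
    · omega
    · omega
    · exact h (e ▸ Λ.bd_one)
  · rintro ⟨e1, e2⟩
    obtain ⟨p, hp1, hp2, hp⟩ := (Λ.cycle hn).2
    exact h.inner p hp ⟨by omega, by omega⟩

/-- Positions `1` and `K + 1` of a cycle name the same vertex. This is the only way in which an
upper and a lower end can meet at different positions. -/
theorem vtx_eq_iff {r s : ℕ × ℕ} (hr : Λ.IsBox r) (hs : Λ.IsBox s) :
    Λ.vtx (hi r) = Λ.vtx (lo s) ↔ hi r = lo s ∨ (Λ.n = Λ.K ∧ hi r = Λ.K + 1 ∧ lo s = 1) := by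
  have h1 := hr.hi_le
  have h2 := hs.lo_le
  have h3 := hs.hi_le
  have h4 := hs.lo_pos
  have h5 := hr.lo_pos
  have h6 := hr.lo_le
  have := Λ.K_pos
  simp only [vtx]
  rcases Λ.n_eq with hn | hn
  · have := hr.cycle hn
    have := hs.cycle hn
    split_ifs <;> omega
  · split_ifs <;> omega

theorem vtx_hi_eq_iff {r s : ℕ × ℕ} (hr : Λ.IsBox r) (hs : Λ.IsBox s) :
    Λ.vtx (hi r) = Λ.vtx (hi s) ↔ hi r = hi s := by
  have h1 := hr.hi_le
  have h2 := hs.hi_le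
  simp only [vtx]
  rcases Λ.n_eq with hn | hn
  · have := hr.cycle hn
    have := hs.cycle hn
    split_ifs <;> omega
  · split_ifs <;> omega

theorem vtx_lo_eq_iff {r s : ℕ × ℕ} (hr : Λ.IsBox r) (hs : Λ.IsBox s) :
    Λ.vtx (lo r) = Λ.vtx (lo s) ↔ lo r = lo s := by
  have h1 := hr.hi_le
  have h2 := hs.lo_le
  have h3 := hs.hi_le
  have h6 := hr.lo_le
  simp only [vtx]
  rcases Λ.n_eq with hn | hn
  · have := hr.cycle hn
    have := hs.cycle hn
    split_ifs <;> omega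
  · split_ifs <;> omega

/-- The sign alternative is rewritten without a vertex variable, so that conflicts become statements
about integers which `omega` can decide. -/
theorem nw_iff {r s : ℕ × ℕ} (hr : Λ.IsBox r) (hs : Λ.IsBox s) : Λ.NW r s ↔
    (r.1 < s.1 ∧ lo s < hi r ∧ r.2 < s.2) ∨
    (r.2 % 2 = 0 ∧ r.1 ≠ r.2 ∧ s.1 % 2 = 0 ∧ s.1 ≠ s.2 ∧
      (hi r = lo s ∨ (Λ.n = Λ.K ∧ hi r = Λ.K + 1 ∧ lo s = 1))) := by
  rw [← vtx_eq_iff hr hs, NW]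
  apply or_congr Iff.rfl
  constructor
  · rintro ⟨v, ⟨h1, h2, h3⟩, h4, h5, h6⟩
    exact ⟨h1, h2, h4, h5, h3.trans h6.symm⟩
  · rintro ⟨h1, h2, h4, h5, h3⟩
    exact ⟨_, ⟨h1, h2, rfl⟩, h4, h5, h3.symm⟩

theorem Coh.symm {r s : ℕ × ℕ} (h : Λ.Coh r s) : Λ.Coh s r := ⟨h.2, h.1⟩

/-- An exceptional arc with two odd codes cannot overlap a conflicting arc, since one of its leg
ends would be strictly inside the other arc. An arc with equal codes is a point and has no room to
overlap. -/
theorem coh_exc {a b : ℕ × ℕ} (ha : Λ.IsBox a) (he : Exc a) (hb : Λ.IsBox b) : Λ.Coh a b := by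
  have h1 := fun h => hb.inner _ (ha.bd_lo h)
  have h2 := fun h => hb.inner _ (ha.bd_hi h)
  have := ha.lo_le
  have := hb.lo_le
  rw [Coh, nw_iff ha hb, nw_iff hb ha]
  simp only [Exc, lo, hi] at *
  omega

theorem coh_self {a : ℕ × ℕ} (ha : Λ.IsBox a) : Λ.Coh a a := by
  by_cases he : Exc a
  · exact coh_exc ha he ha
  have := ha.lo_le
  have := ha.cycle
  rw [Coh, nw_iff ha ha]
  simp only [Exc, lo, hi] at *
  omega

/-- The contribution of the upper end to the vector of an arc. -/
noncomputable def gHi (Λ : LegData) (β : ℕ) (i : Fin Λ.n) : ℝ :=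
  if β % 2 = 0 ∧ Λ.vtx (β / 2) = i + 1 then 1 else 0

/-- The contribution of the lower end to the vector of an arc. -/
noncomputable def gLo (Λ : LegData) (α : ℕ) (i : Fin Λ.n) : ℝ :=
  if α % 2 = 0 ∧ Λ.vtx (α / 2) = i + 1 then 1 else 0

/-- Separating the contributions of the two ends makes exchanging upper ends additive. For equal
codes both contributions are the same unit vector and cancel. -/
theorem g_eq (a : ℕ × ℕ) : Λ.g a = Λ.gHi a.2 - Λ.gLo a.1 := by
  ext i
  simp only [g, gHi, gLo, Pos, Neg, Pi.sub_apply, lo, hi]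
  by_cases h : a.1 = a.2
  · simp [h]
  · by_cases h2 : a.1 % 2 = 0
    · have : (a.1 + 1) / 2 = a.1 / 2 := by omega
      simp [h, h2, this]
    · simp [h, h2]

theorem gHi_odd {β : ℕ} (h : β % 2 = 1) : Λ.gHi β = 0 := by
  ext i; simp [gHi, h]

theorem gLo_odd {α : ℕ} (h : α % 2 = 1) : Λ.gLo α = 0 := by
  ext i; simp [gLo, h]

theorem g_exc {a : ℕ × ℕ} (he : Exc a) : Λ.g a = 0 := by
  rw [g_eq]
  rcases he with h | ⟨h1, h2⟩
  · rw [h]; exact sub_self _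
  · rw [gHi_odd h2, gLo_odd h1, sub_zero]

theorem coh_of_fst_eq {a b : ℕ × ℕ} (ha : Λ.IsBox a) (hb : Λ.IsBox b) (h : a.1 = b.1) :
    Λ.Coh a b := by
  have h1 := ha.lo_le
  have h2 := hb.lo_le
  have h3 := ha.trivial_codes
  have h4 := hb.trivial_codes
  have h5 := ha.cycle
  have h6 := hb.cycle
  rw [Coh, nw_iff ha hb, nw_iff hb ha]
  simp only [lo, hi] at *
  omega

theorem coh_of_snd_eq {a b : ℕ × ℕ} (ha : Λ.IsBox a) (hb : Λ.IsBox b) (h : a.2 = b.2) :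
    Λ.Coh a b := by
  have h1 := ha.lo_le
  have h2 := hb.lo_le
  have h3 := ha.trivial_codes
  have h4 := hb.trivial_codes
  have h5 := ha.cycle
  have h6 := hb.cycle
  rw [Coh, nw_iff ha hb, nw_iff hb ha]
  simp only [lo, hi] at *
  omega

/-- The arcs `x` and `y` cross within a leg. -/
def Crossing (Λ : LegData) (x y : ℕ × ℕ) : Prop :=
  x.1 < y.1 ∧ y.1 ≤ x.2 ∧ x.2 < y.2 ∧ (lo y < hi x ∨ (lo y = hi x ∧ y.1 = x.2 ∧ x.2 % 2 = 0 ∧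
    (¬ Λ.Bd (lo y) ∨ (Λ.n = Λ.K + 1 ∧ (lo y = 1 ∨ lo y = Λ.K + 1)))))

/-- The arcs `x` and `y` lie on different legs and have opposite coordinates at a common end. -/
def Opposite (Λ : LegData) (x y : ℕ × ℕ) : Prop :=
  x.2 % 2 = 0 ∧ y.1 % 2 = 0 ∧ Λ.Bd (hi x) ∧ Λ.Bd (lo y) ∧ lo x < hi x ∧ lo y < hi y ∧
  ((hi x = lo y ∧ 1 < lo y ∧ lo y < Λ.K + 1) ∨ (Λ.n = Λ.K ∧ hi x = Λ.K + 1 ∧ lo y = 1))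

theorem IsBox.lo_lt_hi_of_bd {x : ℕ × ℕ} (hx : Λ.IsBox x) (hb : Λ.Bd (lo x) ∨ Λ.Bd (hi x))
    (h : ¬ (Λ.n = Λ.K + 1 ∧ (lo x = 1 ∨ lo x = Λ.K + 1))) : lo x < hi x := by
  refine lt_of_le_of_ne hx.lo_le fun e => ?_
  rcases hx.triv e with h1 | h1 | h1
  · exact h ⟨h1.1, Or.inl h1.2.1⟩
  · exact h ⟨h1.1, Or.inr h1.2.1⟩
  · rw [← e] at hb; exact h1 (hb.elim id id)

/-- Overlapping arcs cross. Arcs with opposite signs at a common vertex cross in a point when the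
one-vertex arc is available there, that is, away from leg ends or at an extreme of a path. At the
other leg ends they lie on different legs. -/
theorem crossing_or_opposite_of_nw {x y : ℕ × ℕ} (hx : Λ.IsReg x) (hy : Λ.IsReg y)
    (h : Λ.NW x y) : Λ.Crossing x y ∨ Λ.Opposite x y := by
  obtain ⟨hx, hx'⟩ := hx
  obtain ⟨hy, hy'⟩ := hy
  have h1 := hx.lo_le
  have h2 := hy.lo_le
  have h3 := hx.lo_pos
  have h4 := hy.lo_pos
  have h5 := hx.hi_le
  have h6 := hy.hi_le
  have h9 := Λ.K_pos
  have h12 := Λ.n_eq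
  have h7 := hx.lo_lt_hi_of_bd
  have h8 := hy.lo_lt_hi_of_bd
  rw [nw_iff hx hy] at h
  have c1 := hx.cycle
  have c2 := hy.cycle
  rcases h with h | ⟨p1, p2, p3, p4, h | ⟨q1, q2, q3⟩⟩
  · left
    simp only [Crossing, lo, hi] at *
    omega
  · by_cases hb : Λ.Bd (lo y)
    · by_cases hend : Λ.n = Λ.K + 1 ∧ (lo y = 1 ∨ lo y = Λ.K + 1)
      · left
        simp only [Crossing, lo, hi] at *
        omega
      · right
        have b1 := h8 (Or.inl hb) hend
        have b2 := h7 (Or.inr (h ▸ hb))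
        refine ⟨p1, p3, h ▸ hb, hb, ?_⟩
        clear h7 h8
        simp only [lo, hi] at *
        omega
    · left
      refine ⟨?_, ?_, ?_, Or.inr ⟨h.symm, ?_, p1, Or.inl hb⟩⟩ <;>
      · clear h7 h8 hb
        simp only [lo, hi] at *
        omega
  · right
    refine ⟨p1, p3, q2 ▸ Λ.bd_last, q3 ▸ Λ.bd_one, ?_⟩
    clear h7 h8
    omega

theorem Crossing.nw {x y : ℕ × ℕ} (hx : Λ.IsReg x) (hy : Λ.IsReg y)
    (h : Λ.Crossing x y) : Λ.NW x y := by
  rw [nw_iff hx.1 hy.1]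
  obtain ⟨h1, h2, h3, h4⟩ := h
  have := hx.2
  have := hy.2
  simp only [Exc, lo, hi] at *
  omega

theorem Opposite.nw {x y : ℕ × ℕ} (hx : Λ.IsReg x) (hy : Λ.IsReg y)
    (h : Λ.Opposite x y) : Λ.NW x y := by
  rw [nw_iff hx.1 hy.1]
  obtain ⟨h1, h2, -, -, h3, h4, h5⟩ := h
  have := hx.2
  have := hy.2
  simp only [Exc, lo, hi] at *
  omega

section Crossing

variable {x y : ℕ × ℕ}

/-- A leg end strictly inside the union is not inside `x` or `y`, so it must be the touching point
`lo y = hi x`. The last clause of `Crossing` excludes this, except at an extreme of the path, which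
is not strictly inside. -/
theorem Crossing.isBox_outer (hx : Λ.IsReg x) (hy : Λ.IsReg y) (h : Λ.Crossing x y) :
    Λ.IsBox (x.1, y.2) := by
  obtain ⟨h1, h2, h3, h4⟩ := h
  have a1 := hx.1.lo_le
  have a2 := hy.1.lo_le
  have a3 := hx.1.lo_pos
  have a4 := hy.1.hi_le
  have a5 := hx.2
  have a6 := hy.2
  have hlt : lo x < hi y := by
    have c1 := hx.1.trivial_codes
    have c2 := hy.1.trivial_codes
    have := Λ.K_pos
    simp only [lo, hi, Exc] at *
    omega
  refine ⟨a3, le_of_lt hlt, a4, ?_, hx.1.bd_lo, hy.1.bd_hi, fun e => absurd e hlt.ne⟩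
  intro p hp
  have b1 := hx.1.inner p hp
  have b2 := hy.1.inner p hp
  have b3 : p = lo y → lo y < hi x ∨ (Λ.n = Λ.K + 1 ∧ (lo y = 1 ∨ lo y = Λ.K + 1)) := by
    rintro rfl
    rcases h4 with h4 | ⟨-, -, -, h4 | h4⟩
    · exact Or.inl h4
    · exact absurd hp h4
    · exact Or.inr h4
  clear hx hy
  simp only [lo, hi] at *
  omega

theorem Crossing.isBox_inner (hx : Λ.IsReg x) (hy : Λ.IsReg y) (h : Λ.Crossing x y) :
    Λ.IsBox (y.1, x.2) := by
  obtain ⟨h1, h2, h3, h4⟩ := h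
  have a1 := hx.1.lo_le
  have a2 := hy.1.lo_le
  have a3 := hy.1.lo_pos
  have a4 := hx.1.hi_le
  have a5 := hx.2
  have a6 := hy.2
  have hle : lo y ≤ hi x := by simp only [lo, hi] at *; omega
  refine ⟨a3, hle, a4, ?_, hy.1.bd_lo, hx.1.bd_hi, ?_⟩
  · intro p hp
    have b1 := hx.1.inner p hp
    have b2 := hy.1.inner p hp
    clear hx hy
    simp only [lo, hi] at *
    omega
  · intro e
    have e' : lo y = hi x := e
    rcases h4 with h4 | ⟨-, h5, h6, h4 | ⟨h7, h8 | h8⟩⟩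
    · exact absurd e' h4.ne
    · exact Or.inr (Or.inr h4)
    · left
      refine ⟨h7, h8, ?_⟩
      simp only [lo, hi] at *
      omega
    · right; left
      refine ⟨h7, h8, ?_⟩
      simp only [lo, hi] at *
      omega

theorem g_add_swap (x y : ℕ × ℕ) :
    Λ.g x + Λ.g y = Λ.g (x.1, y.2) + Λ.g (y.1, x.2) := by
  simp only [g_eq]
  abel

/-- Comparing the codes of `w` with those of `x` and `y` turns any conflict with the outer arc into
one with `x` or with `y`. Only the case of crossing in a single point needs extra care. -/
theorem Crossing.coh_outer (hx : Λ.IsReg x) (hy : Λ.IsReg y) (h : Λ.Crossing x y) {w : ℕ × ℕ}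
    (hw : Λ.IsReg w) (hwx : Λ.Coh w x) (hwy : Λ.Coh w y) : Λ.Coh w (x.1, y.2) := by
  have b1 := h.isBox_outer hx hy
  rw [Coh, nw_iff hw.1 hx.1, nw_iff hx.1 hw.1] at hwx
  rw [Coh, nw_iff hw.1 hy.1, nw_iff hy.1 hw.1] at hwy
  rw [Coh, nw_iff hw.1 b1, nw_iff b1 hw.1]
  obtain ⟨h1, h2, h3, h4⟩ := h
  have a1 := hx.1.lo_le
  have a2 := hy.1.lo_le
  have a3 := hw.1.lo_le
  have a5 := hx.2
  have a6 := hy.2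
  have a7 := hw.2
  clear b1
  have h4' : lo y < hi x ∨ lo y = hi x ∧ y.1 = x.2 ∧ x.2 % 2 = 0 := by
    rcases h4 with h | ⟨h, h', h'', -⟩
    · exact Or.inl h
    · exact Or.inr ⟨h, h', h''⟩
  -- An odd code of `w` at the touching point would make that point a leg end, which the crossing
  -- allows only at the extremes of a path.
  have t1 : lo y = hi x → w.2 = 2 * lo y + 1 → lo y = 1 ∨ lo y = Λ.K + 1 := by
    intro e e2
    rcases h4 with h | ⟨-, -, -, h | ⟨-, h⟩⟩
    · omega
    · have e3 : hi w = lo y := by simp only [hi] at *; omega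
      exact absurd (e3 ▸ hw.1.bd_hi (by omega)) h
    · exact h
  have t2 : lo y = hi x → w.1 + 1 = 2 * lo y → lo y = 1 ∨ lo y = Λ.K + 1 := by
    intro e e2
    rcases h4 with h | ⟨-, -, -, h | ⟨-, h⟩⟩
    · omega
    · have e3 : lo w = lo y := by simp only [lo] at *; omega
      exact absurd (e3 ▸ hw.1.bd_lo (by omega)) h
    · exact h
  have k1 := hx.1.lo_pos
  have k2 := hy.1.hi_le
  have k3 := hw.1.hi_le
  have k4 := hw.1.lo_pos
  clear h4
  obtain ⟨u1, u2⟩ := hwx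
  obtain ⟨u3, u4⟩ := hwy
  have t := hw.1.trivial_codes
  clear hx hy hw
  constructor
  · clear u2 u4 t2
    rintro (⟨p1, p2, p3⟩ | p)
    · simp only [lo, hi, Exc] at *
      omega
    · simp only [lo, hi, Exc] at *
      omega
  · clear u1 u3 t1
    rintro (⟨p1, p2, p3⟩ | p)
    · simp only [lo, hi, Exc] at *
      omega
    · simp only [lo, hi, Exc] at *
      omega

theorem Crossing.coh_inner (hx : Λ.IsReg x) (hy : Λ.IsReg y) (h : Λ.Crossing x y) {w : ℕ × ℕ}
    (hw : Λ.IsReg w) (hwx : Λ.Coh w x) (hwy : Λ.Coh w y) : Λ.Coh w (y.1, x.2) := by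
  have b1 := h.isBox_inner hx hy
  by_cases he : Exc (y.1, x.2)
  · exact (coh_exc b1 he hw.1).symm
  rw [Coh, nw_iff hw.1 hx.1, nw_iff hx.1 hw.1] at hwx
  rw [Coh, nw_iff hw.1 hy.1, nw_iff hy.1 hw.1] at hwy
  rw [Coh, nw_iff hw.1 b1, nw_iff b1 hw.1]
  obtain ⟨h1, h2, h3, -⟩ := h
  have a1 := hx.1.lo_le
  have a2 := hy.1.lo_le
  have a3 := hw.1.lo_le
  have a5 := hx.2
  have a6 := hy.2
  have a7 := hw.2
  clear b1
  obtain ⟨u1, u2⟩ := hwx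
  obtain ⟨u3, u4⟩ := hwy
  clear hx hy hw
  constructor
  · clear u2 u4
    rintro (⟨p1, p2, p3⟩ | p)
    · simp only [lo, hi, Exc] at *
      omega
    · simp only [lo, hi, Exc] at *
      omega
  · clear u1 u3
    rintro (⟨p1, p2, p3⟩ | p)
    · simp only [lo, hi, Exc] at *
      omega
    · simp only [lo, hi, Exc] at *
      omega

end Crossing

end LegData
end PullDKK

/-! ### Opposite arcs at a leg end, and the resolution rule. -/

namespace PullDKK

namespace LegData

variable {Λ : LegData}

/-- On a cycle, an arc on the first leg and one on the last leg do not overlap. -/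
theorem IsBox.hi_le_lo_of_wrap {x y : ℕ × ℕ} (hx : Λ.IsBox x) (hy : Λ.IsBox y) (hn : Λ.n = Λ.K)
    (h1 : hi x = Λ.K + 1) (h2 : lo y = 1) : ∃ p, Λ.Bd p ∧ hi y ≤ p ∧ p ≤ lo x := by
  obtain ⟨p, hp1, hp2, hp⟩ := (Λ.cycle hn).2
  have a1 := hx.inner p hp
  have a2 := hy.inner p hp
  exact ⟨p, hp, by omega, by omega⟩

section Opposite

variable {x y : ℕ × ℕ}

/-- Passing from `x.2` to `x.2 + 1` keeps the end vertex and removes the turn there, which is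
legitimate because that vertex is a leg end. -/
theorem Opposite.isBox_hi (hx : Λ.IsReg x) (h : Λ.Opposite x y) : Λ.IsBox (x.1, x.2 + 1) := by
  obtain ⟨h1, h2, h3, h4, h5, h6, h7⟩ := h
  have e : hi (x.1, x.2 + 1) = hi x := by simp only [hi]; omega
  have e' : lo (x.1, x.2 + 1) = lo x := rfl
  refine ⟨hx.1.lo_pos, ?_, ?_, ?_, hx.1.bd_lo, fun _ => e ▸ h3, ?_⟩
  · rw [e]; exact hx.1.lo_le
  · rw [e]; exact hx.1.hi_le
  · rw [e]; exact hx.1.inner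
  · rw [e, e']; exact fun h => absurd h h5.ne

theorem Opposite.isBox_lo (hy : Λ.IsReg y) (h : Λ.Opposite x y) : Λ.IsBox (y.1 - 1, y.2) := by
  obtain ⟨h1, h2, h3, h4, h5, h6, h7⟩ := h
  have hp := hy.1.lo_pos
  have e : lo (y.1 - 1, y.2) = lo y := by simp only [lo] at *; omega
  have e' : hi (y.1 - 1, y.2) = hi y := rfl
  refine ⟨?_, ?_, hy.1.hi_le, ?_, fun _ => e ▸ h4, hy.1.bd_hi, ?_⟩
  · rw [e]; exact hp
  · rw [e]; exact hy.1.lo_le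
  · rw [e]; exact hy.1.inner
  · rw [e, e']; exact fun h => absurd h h6.ne

theorem Opposite.vtx_eq (hx : Λ.IsReg x) (hy : Λ.IsReg y) (h : Λ.Opposite x y) :
    Λ.vtx (hi x) = Λ.vtx (lo y) := by
  rw [vtx_eq_iff hx.1 hy.1]
  have := h.2.2.2.2.2.2
  tauto

theorem Opposite.gHi_eq_gLo (hx : Λ.IsReg x) (hy : Λ.IsReg y) (h : Λ.Opposite x y) :
    Λ.gHi x.2 = Λ.gLo y.1 := by
  ext i
  have h1 := h.vtx_eq hx hy
  have h2 := h.1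
  have h3 := h.2.1
  have : (y.1 + 1) / 2 = y.1 / 2 := by omega
  simp only [hi, lo, this] at h1
  simp [gHi, gLo, h2, h3, h1]

theorem Opposite.g_add (hx : Λ.IsReg x) (hy : Λ.IsReg y) (h : Λ.Opposite x y) :
    Λ.g x + Λ.g y = Λ.g (x.1, x.2 + 1) + Λ.g (y.1 - 1, y.2) := by
  have h1 := h.1
  have h2 := h.2.1
  have h3 := hy.1.lo_pos
  simp only [g_eq]
  rw [h.gHi_eq_gLo hx hy, gHi_odd (β := x.2 + 1) (by omega),
    gLo_odd (α := y.1 - 1) (by simp only [lo] at h3; omega)]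
  abel

/-- If the arcs are opposite at both ends, each covers a leg of a cycle with two legs and turns at
both of its ends. Their vectors are negatives of each other. -/
theorem Opposite.g_add_eq_zero (hx : Λ.IsReg x) (hy : Λ.IsReg y) (h : Λ.Opposite x y)
    (h' : Λ.Opposite y x) : Λ.g x + Λ.g y = 0 := by
  simp only [g_eq]
  rw [h.gHi_eq_gLo hx hy, h'.gHi_eq_gLo hy hx]
  abel

/-- The reverse conflict cannot be a crossing because the arcs are on different legs. On a cycle,
`hi_le_lo_of_wrap` separates them by a leg end. -/
theorem Opposite.of_nw_symm (hx : Λ.IsReg x) (hy : Λ.IsReg y) (h : Λ.Opposite x y)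
    (h' : Λ.NW y x) : Λ.Opposite y x := by
  refine (crossing_or_opposite_of_nw hy hx h').resolve_left fun hc => ?_
  obtain ⟨c1, c2, c3, c4⟩ := hc
  obtain ⟨h1, h2, h3, h4, h5, h6, h7⟩ := h
  rcases h7 with h7 | ⟨hn, h8, h9⟩
  · simp only [lo, hi] at *; omega
  · obtain ⟨p, hp, p1, p2⟩ := hx.1.hi_le_lo_of_wrap hy.1 hn h8 h9
    rcases c4 with c4 | ⟨c4, -, -, c5 | ⟨c5, -⟩⟩
    · omega
    · have : p = lo x := by omega
      exact c5 (this ▸ hp)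
    · omega

/-- Removing the turn of `x` can create a conflict with `w` only if `w.2 = x.2`. Then `w` has
coordinate `1` at the shared vertex and is already in conflict with `y`. -/
theorem Opposite.coh_hi (hx : Λ.IsReg x) (hy : Λ.IsReg y) (h : Λ.Opposite x y) {w : ℕ × ℕ}
    (hw : Λ.IsReg w) (hwx : Λ.Coh w x) (hwy : Λ.Coh w y) : Λ.Coh w (x.1, x.2 + 1) := by
  have b1 := h.isBox_hi hx
  rw [Coh, nw_iff hw.1 hx.1, nw_iff hx.1 hw.1] at hwx
  rw [Coh, nw_iff hw.1 hy.1, nw_iff hy.1 hw.1] at hwy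
  rw [Coh, nw_iff hw.1 b1, nw_iff b1 hw.1]
  obtain ⟨h1, h2, h3, h4, h5, h6, h7⟩ := h
  have a4 := hw.1.inner _ h3
  have a5 : x.1 ≠ x.2 := fun e => hx.2 (Or.inl e)
  have a6 : y.1 ≠ y.2 := fun e => hy.2 (Or.inl e)
  have a7 : w.1 ≠ w.2 := fun e => hw.2 (Or.inl e)
  constructor
  · rintro (⟨p1, p2, p3⟩ | ⟨p1, p2, p3, p4, p5⟩)
    · have p1' : w.1 < x.1 := p1
      have p3' : w.2 < x.2 + 1 := p3
      rcases Nat.lt_or_ge w.2 x.2 with h | h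
      · exact hwx.1 (Or.inl ⟨p1, p2, h⟩)
      · have e : w.2 = x.2 := by omega
        have e' : hi w = hi x := by rw [hi, hi, e]
        refine hwy.1 (Or.inr ⟨e ▸ h1, a7, h2, a6, ?_⟩)
        rw [e']
        exact h7.imp (fun h => h.1) id
    · exact hwx.1 (Or.inr ⟨p1, p2, p3, a5, p5⟩)
  · rintro (⟨p1, p2, p3⟩ | ⟨p1, -⟩)
    · apply a4
      simp only [hi] at *
      omega
    · simp only at p1
      omega

theorem Opposite.coh_lo (hx : Λ.IsReg x) (hy : Λ.IsReg y) (h : Λ.Opposite x y) {w : ℕ × ℕ}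
    (hw : Λ.IsReg w) (hwx : Λ.Coh w x) (hwy : Λ.Coh w y) : Λ.Coh w (y.1 - 1, y.2) := by
  have b1 := h.isBox_lo hy
  rw [Coh, nw_iff hw.1 hx.1, nw_iff hx.1 hw.1] at hwx
  rw [Coh, nw_iff hw.1 hy.1, nw_iff hy.1 hw.1] at hwy
  rw [Coh, nw_iff hw.1 b1, nw_iff b1 hw.1]
  obtain ⟨h1, h2, h3, h4, h5, h6, h7⟩ := h
  have a2 := hy.1.lo_pos
  have a4 := hw.1.inner _ h4
  have a5 : x.1 ≠ x.2 := fun e => hx.2 (Or.inl e)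
  have a6 : y.1 ≠ y.2 := fun e => hy.2 (Or.inl e)
  have a7 : w.1 ≠ w.2 := fun e => hw.2 (Or.inl e)
  constructor
  · rintro (⟨p1, p2, p3⟩ | ⟨-, -, p1, -⟩)
    · apply a4
      simp only [lo] at *
      omega
    · simp only [lo] at *
      omega
  · rintro (⟨p1, p2, p3⟩ | ⟨p1, p2, p3, p4, p5⟩)
    · have p1' : y.1 - 1 < w.1 := p1
      rcases Nat.lt_or_ge y.1 w.1 with h | h
      · exact hwy.2 (Or.inl ⟨h, p2, p3⟩)
      · have e : w.1 = y.1 := by simp only [lo] at a2; omega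
        have e' : lo w = lo y := by rw [lo, lo, e]
        refine hwx.2 (Or.inr ⟨h1, a5, e ▸ h2, a7, ?_⟩)
        rw [e']
        exact h7.imp (fun h => h.1) id
    · exact hwy.2 (Or.inr ⟨p1, a6, p3, p4, p5⟩)

theorem Opposite.coh_left_lo (hx : Λ.IsReg x) (hy : Λ.IsReg y) (h : Λ.Opposite x y)
    (h' : ¬ Λ.NW y x) : Λ.Coh x (y.1 - 1, y.2) := by
  have b1 := h.isBox_lo hy
  rw [nw_iff hy.1 hx.1] at h'
  rw [Coh, nw_iff hx.1 b1, nw_iff b1 hx.1]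
  have a0 := hx.1.hi_le_lo_of_wrap hy.1
  obtain ⟨h1, h2, h3, h4, h5, h6, h7⟩ := h
  have a2 := hy.1.lo_pos
  have a3 := hx.1.lo_pos
  have a5 := hx.2
  have a6 := hy.2
  have a7 : Λ.n = Λ.K → hi x = Λ.K + 1 → lo y = 1 → hi y ≤ lo x := by
    intro e1 e2 e3
    obtain ⟨p, -, p1, p2⟩ := a0 e1 e2 e3
    omega
  clear b1 hx hy h3 h4 a0
  constructor
  · rintro (⟨p1, p2, p3⟩ | p) <;>
    · simp only [lo, hi, Exc] at *
      omega
  · rintro (⟨p1, p2, p3⟩ | p) <;>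
    · simp only [lo, hi, Exc] at *
      omega

theorem Opposite.coh_right_hi (hx : Λ.IsReg x) (hy : Λ.IsReg y) (h : Λ.Opposite x y)
    (h' : ¬ Λ.NW y x) : Λ.Coh y (x.1, x.2 + 1) := by
  have b1 := h.isBox_hi hx
  rw [nw_iff hy.1 hx.1] at h'
  rw [Coh, nw_iff hy.1 b1, nw_iff b1 hy.1]
  have a0 := hx.1.hi_le_lo_of_wrap hy.1
  obtain ⟨h1, h2, h3, h4, h5, h6, h7⟩ := h
  have a2 := hy.1.lo_pos
  have a3 := hx.1.lo_pos
  have a5 := hx.2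
  have a6 := hy.2
  have a7 : Λ.n = Λ.K → hi x = Λ.K + 1 → lo y = 1 → hi y ≤ lo x := by
    intro e1 e2 e3
    obtain ⟨p, -, p1, p2⟩ := a0 e1 e2 e3
    omega
  clear b1 hx hy h3 h4 a0
  constructor
  · rintro (⟨p1, p2, p3⟩ | p) <;>
    · simp only [lo, hi, Exc] at *
      omega
  · rintro (⟨p1, p2, p3⟩ | p) <;>
    · simp only [lo, hi, Exc] at *
      omega

end Opposite

/-- Resolution of a conflict. -/
theorem NW.resolve {x y : ℕ × ℕ} (hx : Λ.IsReg x) (hy : Λ.IsReg y) (h : Λ.NW x y) :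
    Λ.g x + Λ.g y = 0 ∨ ∃ z z', Λ.g x + Λ.g y = Λ.g z + Λ.g z' ∧
      (Λ.Coh x z ∧ Λ.Coh x z' ∧ Λ.Coh y z ∧ Λ.Coh y z') ∧
      (∀ w, Λ.IsReg w → Λ.Coh w x → Λ.Coh w y → Λ.Coh w z ∧ Λ.Coh w z') ∧
      z ∈ Λ.hiA x ∧ z' ∈ Λ.hiB x ∧
      ((z ∈ Λ.loA y ∧ z' ∈ Λ.loB y) ∨ (z' ∈ Λ.loA y ∧ z ∈ Λ.loB y)) := by
  rcases crossing_or_opposite_of_nw hx hy h with hc | ho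
  · right
    have b1 := hc.isBox_outer hx hy
    have b2 := hc.isBox_inner hx hy
    refine ⟨_, _, g_add_swap x y, ⟨coh_of_fst_eq hx.1 b1 rfl, coh_of_snd_eq hx.1 b2 rfl,
      coh_of_snd_eq hy.1 b1 rfl, coh_of_fst_eq hy.1 b2 rfl⟩,
      fun w hw hwx hwy => ⟨hc.coh_outer hx hy hw hwx hwy, hc.coh_inner hx hy hw hwx hwy⟩,
      ⟨b1, rfl, hc.2.2.1⟩, ⟨b2, Or.inl ⟨rfl, hc.1⟩⟩,
      Or.inr ⟨⟨b2, Or.inl ⟨rfl, hc.2.2.1⟩⟩, ⟨b1, rfl, hc.1⟩⟩⟩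
  -- Only when the conflict is one-sided are the shortened arcs coherent with both original arcs;
  -- the two-sided case is the one with zero sum.
  · by_cases hyx : Λ.NW y x
    · exact Or.inl (ho.g_add_eq_zero hx hy (ho.of_nw_symm hx hy hyx))
    · right
      have b1 := ho.isBox_hi hx
      have b2 := ho.isBox_lo hy
      have hv := ho.vtx_eq hx hy
      have hlp := hy.1.lo_pos
      have e1 : hi (x.1, x.2 + 1) = hi x := by have := ho.1; simp only [hi]; omega
      have e2 : lo (y.1 - 1, y.2) = lo y := by
        have := ho.2.1; simp only [lo] at *; omega
      refine ⟨_, _, ho.g_add hx hy, ⟨coh_of_fst_eq hx.1 b1 rfl, ho.coh_left_lo hx hy hyx,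
        ho.coh_right_hi hx hy hyx, coh_of_snd_eq hy.1 b2 rfl⟩,
        fun w hw hwx hwy => ⟨ho.coh_hi hx hy hw hwx hwy, ho.coh_lo hx hy hw hwx hwy⟩,
        ⟨b1, rfl, by simp⟩, ⟨b2, Or.inr ⟨ho.2.2.2.2.1, ?_, ?_, ?_⟩⟩,
        Or.inl ⟨⟨b1, Or.inr ⟨?_, ho.2.2.2.2.2.1, ?_, ?_⟩⟩, ⟨b2, rfl, ?_⟩⟩⟩
      · rw [e2]; exact ho.2.2.2.2.2.1
      · rw [e2]; exact hv
      · have := ho.1; have := ho.2.1; simp only [lo] at *; omega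
      · rw [e1]; exact ho.2.2.2.2.1
      · rw [e1]; exact hv
      · have := ho.1; have := ho.2.1; simp only; omega
      · have := ho.2.1; simp only [lo] at *; omega

end LegData
end PullDKK

/-! ### Vectors of arcs: spanning, extremality and independence of cliques. -/

namespace PullDKK

namespace LegData

variable {Λ : LegData}

theorem IsBox.fst_le_snd {a : ℕ × ℕ} (ha : Λ.IsBox a) : a.1 ≤ a.2 := by
  have := ha.lo_le
  simp only [lo, hi] at this
  omega

theorem finite_isBox : {a | Λ.IsBox a}.Finite := by
  apply ((Set.finite_Iic (2 * Λ.K + 3)).prod (Set.finite_Iic (2 * Λ.K + 3))).subset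
  intro a ha
  have h1 := IsBox.fst_le_snd ha
  have h2 := IsBox.hi_le ha
  simp only [hi] at h2
  constructor <;> simp only [Set.mem_Iic] <;> omega

theorem IsBox.vtx_lo_mem {a : ℕ × ℕ} (ha : Λ.IsBox a) :
    1 ≤ Λ.vtx (lo a) ∧ Λ.vtx (lo a) ≤ Λ.n := by
  have := ha.lo_pos
  have := Λ.n_eq
  have := Λ.K_pos
  simp only [vtx]
  split_ifs <;> omega

theorem IsBox.vtx_hi_mem {a : ℕ × ℕ} (ha : Λ.IsBox a) :
    1 ≤ Λ.vtx (hi a) ∧ Λ.vtx (hi a) ≤ Λ.n := by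
  have := ha.lo_pos
  have := ha.lo_le
  have := Λ.n_eq
  have := Λ.K_pos
  simp only [vtx]
  split_ifs <;> omega

section Endpoints

theorem exists_bd_lt {q : ℕ} (hq : 2 ≤ q) :
    ∃ p, 1 ≤ p ∧ p < q ∧ Λ.Bd p ∧ ∀ r, Λ.Bd r → ¬ (p < r ∧ r < q) := by
  induction q, hq using Nat.le_induction with
  | base => exact ⟨1, le_rfl, by omega, Λ.bd_one, fun r _ h => by omega⟩
  | succ q hq ih =>
    by_cases hb : Λ.Bd q
    · exact ⟨q, by omega, by omega, hb, fun r _ h => by omega⟩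
    · obtain ⟨p, h1, h2, h3, h4⟩ := ih
      refine ⟨p, h1, by omega, h3, fun r hr h => ?_⟩
      by_cases e : r = q
      · exact hb (e ▸ hr)
      · exact h4 r hr ⟨h.1, by omega⟩

theorem exists_bd_gt {p : ℕ} (hp : p ≤ Λ.K) :
    ∃ q, p < q ∧ q ≤ Λ.K + 1 ∧ Λ.Bd q ∧ ∀ r, Λ.Bd r → ¬ (p < r ∧ r < q) := by
  classical
  have hex : ∃ q, p < q ∧ Λ.Bd q := ⟨Λ.K + 1, by omega, Λ.bd_last⟩
  refine ⟨Nat.find hex, (Nat.find_spec hex).1, Nat.find_min' hex ⟨by omega, Λ.bd_last⟩,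
    (Nat.find_spec hex).2, fun r hr h => ?_⟩
  exact Nat.find_min hex h.2 ⟨h.1, hr⟩

/-- The arc runs without a turn from the preceding leg end and turns at `v`, so its vector is a unit
vector. Vertex `1` of a cycle is reached at position `K + 1`, and the first vertex of a path needs
the single-vertex arc `(1, 2)`. -/
theorem exists_pos {v : ℕ} (h1 : 1 ≤ v) (h2 : v ≤ Λ.n) :
    ∃ a, Λ.IsReg a ∧ a.1 % 2 = 1 ∧ Λ.Pos a v := by
  have key : ∀ q, 2 ≤ q → q ≤ Λ.K + 1 → Λ.vtx q = v → ∃ a, Λ.IsReg a ∧ a.1 % 2 = 1 ∧ Λ.Pos a v := by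
    intro q hq1 hq2 hv
    obtain ⟨p, hp1, hp2, hp3, hp4⟩ := Λ.exists_bd_lt hq1
    have e1 : lo (2 * p - 1, 2 * q) = p := by simp only [lo]; omega
    have e2 : hi (2 * p - 1, 2 * q) = q := by simp only [hi]; omega
    refine ⟨(2 * p - 1, 2 * q), ⟨⟨?_, ?_, ?_, ?_, ?_, ?_, ?_⟩, ?_⟩, ?_, ?_, ?_, ?_⟩
    · rw [e1]; exact hp1
    · rw [e1, e2]; exact hp2.le
    · rw [e2]; exact hq2
    · rw [e1, e2]; exact hp4
    · rw [e1]; exact fun _ => hp3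
    · simp only; omega
    · rw [e1, e2]; omega
    · simp only [Exc]; omega
    · simp only; omega
    · simp only; omega
    · simp only; omega
    · rw [e2]; exact hv
  rcases Λ.n_eq with hn | hn
  · have := (Λ.cycle hn).1
    by_cases hv : v = 1
    · exact key (Λ.K + 1) (by omega) le_rfl (by simp [vtx, hn, hv])
    · exact key v (by omega) (by omega) (by simp [vtx, h2])
  · by_cases hv : v = 1
    · refine ⟨(1, 2), ⟨⟨by decide, by decide, ?_, ?_, fun _ => Λ.bd_one, ?_, ?_⟩, ?_⟩, rfl, rfl,
        by decide, ?_⟩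
      · simp [hi]
      · intro p _; simp only [lo, hi]; omega
      · simp
      · exact fun _ => Or.inl ⟨hn, rfl, rfl⟩
      · simp [Exc]
      · simp [hi, vtx, hv]
    · exact key v (by omega) (by omega) (by simp [vtx, h2])

theorem exists_neg {v : ℕ} (h1 : 1 ≤ v) (h2 : v ≤ Λ.n) :
    ∃ a, Λ.IsReg a ∧ a.2 % 2 = 1 ∧ Λ.Neg a v := by
  by_cases hv : v ≤ Λ.K
  · obtain ⟨q, hq1, hq2, hq3, hq4⟩ := Λ.exists_bd_gt hv
    have e1 : lo (2 * v, 2 * q + 1) = v := by simp only [lo]; omega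
    have e2 : hi (2 * v, 2 * q + 1) = q := by simp only [hi]; omega
    refine ⟨(2 * v, 2 * q + 1), ⟨⟨?_, ?_, ?_, ?_, ?_, ?_, ?_⟩, ?_⟩, ?_, ?_, ?_, ?_⟩
    · rw [e1]; exact h1
    · rw [e1, e2]; exact hq1.le
    · rw [e2]; exact hq2
    · rw [e1, e2]; exact hq4
    · simp only; omega
    · rw [e2]; exact fun _ => hq3
    · rw [e1, e2]; omega
    · simp only [Exc]; omega
    · simp only; omega
    · simp only; omega
    · simp only; omega
    · rw [e1]; simp [vtx, h2]
  · have hn := Λ.n_eq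
    have hn' : Λ.n = Λ.K + 1 := by omega
    have e1 : lo (2 * v, 2 * v + 1) = v := by simp only [lo]; omega
    have e2 : hi (2 * v, 2 * v + 1) = v := by simp only [hi]; omega
    have hvK : v = Λ.K + 1 := by omega
    refine ⟨(2 * v, 2 * v + 1), ⟨⟨?_, ?_, ?_, ?_, ?_, ?_, ?_⟩, ?_⟩, ?_, ?_, ?_, ?_⟩
    · rw [e1]; exact h1
    · rw [e1, e2]
    · rw [e2]; omega
    · rw [e1, e2]; intro p _ h; omega
    · simp only; omega
    · rw [e2, hvK]; exact fun _ => Λ.bd_last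
    · rw [e1]; exact fun _ => Or.inr (Or.inl ⟨hn', hvK, by simp only; omega⟩)
    · simp only [Exc]; omega
    · simp only; omega
    · simp only; omega
    · simp only; omega
    · rw [e1]; simp [vtx, h2]

theorem exists_exc : ∃ a, Λ.IsBox a ∧ Exc a := by
  obtain ⟨q, hq1, hq2, hq3, hq4⟩ := Λ.exists_bd_gt Λ.K_pos
  have e1 : lo (1, 2 * q + 1) = 1 := by simp [lo]
  have e2 : hi (1, 2 * q + 1) = q := by simp only [hi]; omega
  refine ⟨(1, 2 * q + 1), ⟨e1.ge, ?_, ?_, ?_, fun _ => ?_, ?_, ?_⟩, Or.inr ⟨rfl, ?_⟩⟩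
  · rw [e1, e2]; exact hq1.le
  · rw [e2]; exact hq2
  · rw [e1, e2]; exact hq4
  · rw [e1]; exact Λ.bd_one
  · rw [e2]; exact fun _ => hq3
  · rw [e1, e2]; omega
  · simp only; omega

end Endpoints

section Vectors

theorem g_eq_single {a : ℕ × ℕ} (h : a.1 % 2 = 1) (i : Fin Λ.n) (hp : Λ.Pos a (i + 1)) :
    Λ.g a = Pi.single i 1 := by
  rw [g_eq, gLo_odd h, sub_zero]
  ext j
  obtain ⟨h1, -, h2⟩ := hp
  simp only [hi] at h2
  simp only [gHi, h1, h2, true_and, Pi.single_apply]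
  congr 1
  rw [eq_iff_iff, Fin.ext_iff]
  omega

theorem span_g : Submodule.span ℝ (Λ.g '' {a | Λ.IsReg a}) = ⊤ := by
  rw [eq_top_iff, ← (Pi.basisFun ℝ (Fin Λ.n)).span_eq, Submodule.span_le]
  rintro _ ⟨i, rfl⟩
  obtain ⟨a, ha, h1, h2⟩ := Λ.exists_pos (v := i + 1) (by omega) (by omega)
  apply Submodule.subset_span
  exact ⟨a, ha, by rw [g_eq_single h1 i h2, Pi.basisFun_apply]⟩

/-- The weights are integers, so comparing values on arcs becomes integer arithmetic. -/
theorem exists_functional (c : ℕ → ℤ) : ∃ ψ : (Fin Λ.n → ℝ) →ₗ[ℝ] ℝ, ∀ a, Λ.IsBox a →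
    ψ (Λ.g a) = (((if a.2 % 2 = 0 then c (Λ.vtx (hi a)) else 0) -
      (if a.1 % 2 = 0 then c (Λ.vtx (lo a)) else 0) : ℤ) : ℝ) := by
  refine ⟨∑ i : Fin Λ.n, (c (i + 1) : ℝ) • LinearMap.proj i, fun a ha => ?_⟩
  have key : ∀ (P : Prop) [Decidable P] (v : ℕ), 1 ≤ v → v ≤ Λ.n →
      ∑ i : Fin Λ.n, (c (i + 1) : ℝ) * (if P ∧ v = i + 1 then 1 else 0) =
        ((if P then c v else 0 : ℤ) : ℝ) := by
    intro P _ v h1 h2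
    by_cases hP : P
    · rw [Finset.sum_eq_single (⟨v - 1, by omega⟩ : Fin Λ.n)]
      · have : v = v - 1 + 1 := by omega
        simp only [hP, true_and, if_true, ← this, mul_one]
      · intro j _ hj
        have : v ≠ j + 1 := fun e => hj (Fin.ext (by simp only; omega))
        simp [this]
      · simp
    · simp [hP]
  have h1 := key (a.2 % 2 = 0) (Λ.vtx (hi a)) ha.vtx_hi_mem.1 ha.vtx_hi_mem.2
  have h2 := key (a.1 % 2 = 0) (Λ.vtx (lo a)) ha.vtx_lo_mem.1 ha.vtx_lo_mem.2
  rw [Int.cast_sub, ← h1, ← h2, g_eq, map_sub]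
  simp only [LinearMap.sum_apply, LinearMap.smul_apply, LinearMap.proj_apply, smul_eq_mul]
  congr 1
  apply Finset.sum_congr rfl
  intro i _
  by_cases h : a.1 % 2 = 0
  · have : (a.1 + 1) / 2 = a.1 / 2 := by omega
    simp only [gLo, lo, this]
  · simp [gLo, h]

theorem eq_of_ends {x y : ℕ × ℕ} (h1 : lo x = lo y) (h2 : hi x = hi y)
    (h3 : x.1 % 2 = y.1 % 2) (h4 : x.2 % 2 = y.2 % 2) : x = y := by
  simp only [lo, hi] at *
  ext <;> omega

/-- A lower end without a turn is the nearest leg end below the upper end, so it is determined by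
the latter. -/
theorem lo_eq_of_hi_eq {x y : ℕ × ℕ} (hx : Λ.IsReg x) (hy : Λ.IsReg y) (h : hi x = hi y)
    (h1 : x.1 % 2 = 1) (h2 : y.1 % 2 = 1) : lo x = lo y := by
  have key : ∀ {x y : ℕ × ℕ}, Λ.IsReg x → Λ.IsReg y → hi x = hi y → x.1 % 2 = 1 →
      ¬ lo y < lo x := by
    intro x y hx hy h h1 hlt
    have a1 := hy.1.inner _ (hx.1.bd_lo h1)
    have a2 := hx.1.trivial_codes
    have a3 := hx.1.lo_le
    have a4 := hy.1.lo_pos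
    have a5 := hx.2
    simp only [Exc, lo, hi] at *
    omega
  have := key hx hy h h1
  have := key hy hx h.symm h2
  omega

theorem hi_eq_of_lo_eq {x y : ℕ × ℕ} (hx : Λ.IsReg x) (hy : Λ.IsReg y) (h : lo x = lo y)
    (h1 : x.2 % 2 = 1) (h2 : y.2 % 2 = 1) : hi x = hi y := by
  have key : ∀ {x y : ℕ × ℕ}, Λ.IsReg x → Λ.IsReg y → lo x = lo y → x.2 % 2 = 1 →
      ¬ hi x < hi y := by
    intro x y hx hy h h1 hlt
    have a1 := hy.1.inner _ (hx.1.bd_hi h1)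
    have a2 := hx.1.trivial_codes
    have a3 := hx.1.lo_le
    have a4 := hy.1.hi_le
    have a5 := hx.2
    simp only [Exc, lo, hi] at *
    omega
  have := key hx hy h h1
  have := key hy hx h.symm h2
  omega

/-- If `x` turns at both ends, weights `1` at the upper and `-1` at the lower vertex give it the
value `2`, reached by no other arc. If only the lower end turns, the weights are `-1` everywhere and
`-3` at that vertex. Then `x` has value `3` and arcs turning at both ends have at most `2`. The
remaining case is the mirror image, with weights `1` and `3`. -/
theorem exposed {x : ℕ × ℕ} (hx : Λ.IsReg x) : ∃ ψ : (Fin Λ.n → ℝ) →ₗ[ℝ] ℝ, 0 < ψ (Λ.g x) ∧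
    ∀ y, Λ.IsReg y → y ≠ x → ψ (Λ.g y) < ψ (Λ.g x) := by
  have hne : ¬ (x.1 % 2 = 1 ∧ x.2 % 2 = 1) := fun h => hx.2 (Or.inr h)
  have hself : Λ.vtx (hi x) = Λ.vtx (lo x) → x.1 % 2 = 0 → x.2 % 2 = 0 → False := by
    intro h h1 h2
    have h3 : x.1 ≠ x.2 := fun e => hx.2 (Or.inl e)
    exact (coh_self hx.1).1 (Or.inr ⟨_, ⟨h2, h3, h⟩, h1, h3, rfl⟩)
  by_cases h1 : x.1 % 2 = 0
  · by_cases h2 : x.2 % 2 = 0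
    · obtain ⟨ψ, hψ⟩ := Λ.exists_functional (fun v =>
        (if v = Λ.vtx (hi x) then 1 else 0) - (if v = Λ.vtx (lo x) then 1 else 0))
      refine ⟨ψ, ?_, fun y hy hyx => ?_⟩
      · rw [hψ x hx.1, Int.cast_pos]
        have := fun h => hself h h1 h2
        split_ifs <;> omega
      · rw [hψ x hx.1, hψ y hy.1, Int.cast_lt]
        have e := fun h => hself h h1 h2
        have e1 := vtx_hi_eq_iff hy.1 hx.1
        have e2 := vtx_lo_eq_iff hy.1 hx.1
        have e3 : ¬ (lo y = lo x ∧ hi y = hi x ∧ y.1 % 2 = x.1 % 2 ∧ y.2 % 2 = x.2 % 2) :=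
          fun h => hyx (eq_of_ends h.1 h.2.1 h.2.2.1 h.2.2.2)
        clear hψ hself
        split_ifs <;> omega
    · obtain ⟨ψ, hψ⟩ := Λ.exists_functional (fun v =>
        -1 - (if v = Λ.vtx (lo x) then 2 else 0))
      refine ⟨ψ, ?_, fun y hy hyx => ?_⟩
      · rw [hψ x hx.1, Int.cast_pos]
        simp [h1, h2]
      · rw [hψ x hx.1, hψ y hy.1, Int.cast_lt]
        have e2 := vtx_lo_eq_iff hy.1 hx.1
        have e3 := fun a b c d => hyx (eq_of_ends (x := y) (y := x) a b c d)
        have e4 := hi_eq_of_lo_eq hy hx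
        have h2' : x.2 % 2 = 1 := by omega
        by_cases hy1 : y.1 % 2 = 0
        · by_cases hy2 : y.2 % 2 = 0
          · clear hψ hself e4
            split_ifs <;> omega
          · have hy2' : y.2 % 2 = 1 := by omega
            have : lo y ≠ lo x := fun h => e3 h (e4 h hy2' h2') (by omega) (by omega)
            clear hψ hself e4
            split_ifs <;> omega
        · clear hψ hself e4
          split_ifs <;> omega
  · have h2 : x.2 % 2 = 0 := by omega
    have h1' : x.1 % 2 = 1 := by omega
    obtain ⟨ψ, hψ⟩ := Λ.exists_functional (fun v =>
        1 + (if v = Λ.vtx (hi x) then 2 else 0))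
    refine ⟨ψ, ?_, fun y hy hyx => ?_⟩
    · rw [hψ x hx.1, Int.cast_pos]
      simp [h1, h2]
    · rw [hψ x hx.1, hψ y hy.1, Int.cast_lt]
      have e2 := vtx_hi_eq_iff hy.1 hx.1
      have e3 := fun a b c d => hyx (eq_of_ends (x := y) (y := x) a b c d)
      have e4 := lo_eq_of_hi_eq hy hx
      by_cases hy2 : y.2 % 2 = 0
      · by_cases hy1 : y.1 % 2 = 0
        · clear hψ hself e4
          split_ifs <;> omega
        · have hy1' : y.1 % 2 = 1 := by omega
          have : hi y ≠ hi x := fun h => e3 (e4 h hy1' h1') h (by omega) (by omega)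
          clear hψ hself e4
          split_ifs <;> omega
      · clear hψ hself e4
        split_ifs <;> omega

theorem g_ne_zero_iff {a : ℕ × ℕ} (ha : Λ.IsBox a) (i : Fin Λ.n) :
    Λ.g a i ≠ 0 ↔ Λ.Pos a (i + 1) ∨ Λ.Neg a (i + 1) := by
  have h : ¬ (Λ.Pos a (i + 1) ∧ Λ.Neg a (i + 1)) := fun h =>
    (coh_self ha).1 (Or.inr ⟨_, h.1, h.2⟩)
  by_cases h1 : Λ.Pos a (i + 1) <;> by_cases h2 : Λ.Neg a (i + 1) <;> simp_all [g]

/-- A longer arc with the same lower code and a longer arc with the same upper code would be in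
conflict over `m`. If `m` turns at only one end, its other end is a leg end, and the longer arc
would contain it strictly inside. -/
theorem not_longer_both {M : Set (ℕ × ℕ)} {m : ℕ × ℕ} (hm : Λ.IsReg m) (hM : ∀ a ∈ M, Λ.IsReg a)
    (hcl : ∀ a ∈ M, ∀ b ∈ M, Λ.Coh a b)
    (hA : m.1 % 2 = 0 → ∃ m' ∈ M, m'.1 = m.1 ∧ m.2 < m'.2)
    (hB : m.2 % 2 = 0 → ∃ m' ∈ M, m'.2 = m.2 ∧ m'.1 < m.1) : False := by
  have hm12 : m.1 ≠ m.2 := fun e => hm.2 (Or.inl e)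
  have hlen := hm.1.fst_le_snd
  have hodd : ¬ (m.1 % 2 = 1 ∧ m.2 % 2 = 1) := fun h => hm.2 (Or.inr h)
  have htc := hm.1.trivial_codes
  by_cases h1 : m.1 % 2 = 0
  · obtain ⟨a, haM, ha1, ha2⟩ := hA h1
    by_cases h2 : m.2 % 2 = 0
    · obtain ⟨b, hbM, hb1, hb2⟩ := hB h2
      clear hA hB
      refine (hcl b hbM a haM).1 (Or.inl ⟨by omega, ?_, by omega⟩)
      simp only [lo, hi]; omega
    · have h3 := (hM a haM).1.inner _ (hm.1.bd_hi (by omega))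
      have h4 := (hM a haM).1.hi_le
      have h5 := hm.1.lo_le
      clear hA hB
      simp only [lo, hi] at *
      omega
  · obtain ⟨b, hbM, hb1, hb2⟩ := hB (by omega)
    have h3 := (hM b hbM).1.inner _ (hm.1.bd_lo (by omega))
    have h4 := (hM b hbM).1.lo_pos
    have h5 := hm.1.lo_le
    clear hA hB
    simp only [lo, hi] at *
    omega

/-- Cliques are linearly independent. -/
theorem linearIndepOn_g {M : Set (ℕ × ℕ)} (hM : ∀ a ∈ M, Λ.IsReg a)
    (hcl : ∀ a ∈ M, ∀ b ∈ M, Λ.Coh a b) : LinearIndepOn ℝ Λ.g M := by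
  classical
  rw [linearIndepOn_iff']
  intro t c htM hsum
  by_contra hne
  push Not at hne
  obtain ⟨i0, hi0, hci0⟩ := hne
  -- A shortest arc of the support leads to a contradiction with `not_longer_both`.
  obtain ⟨m, hmS, hmin⟩ := (t.filter (fun i => c i ≠ 0)).exists_min_image (fun a => a.2 - a.1)
    ⟨i0, by simp [hi0, hci0]⟩
  rw [Finset.mem_filter] at hmS
  have hmM := htM hmS.1
  have hm := hM m hmM
  -- a nonzero coordinate is shared with another element of the support
  have key : ∀ v, (Λ.Pos m v ∨ Λ.Neg m v) → ∃ m' ∈ t, c m' ≠ 0 ∧ m' ≠ m ∧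
      (Λ.Pos m' v ∨ Λ.Neg m' v) := by
    intro v hv
    have hv1 : 1 ≤ v ∧ v ≤ Λ.n := by
      rcases hv with ⟨-, -, rfl⟩ | ⟨-, -, rfl⟩
      · exact hm.1.vtx_hi_mem
      · exact hm.1.vtx_lo_mem
    by_contra hno
    push Not at hno
    have hv' : v - 1 + 1 = v := by omega
    set i : Fin Λ.n := ⟨v - 1, by omega⟩ with hi'
    have h0 := congrFun hsum i
    rw [Finset.sum_apply, Finset.sum_eq_single m] at h0
    · have := (g_ne_zero_iff hm.1 i).2 (by simpa [hi', hv'] using hv)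
      simp only [Pi.smul_apply, smul_eq_mul, Pi.zero_apply, mul_eq_zero] at h0
      exact h0.elim hmS.2 this
    · intro b hb hbm
      by_cases hcb : c b = 0
      · simp [hcb]
      · have h1 := hno b hb hcb hbm
        have h2 : Λ.g b i = 0 := by
          by_contra h3
          have h4 := (g_ne_zero_iff (hM b (htM hb)).1 i).1 h3
          simp only [hi', hv'] at h4
          tauto
        simp [h2]
    · exact fun h => absurd hmS.1 h
  have hm12 : m.1 ≠ m.2 := fun e => hm.2 (Or.inl e)
  have hlen := hm.1.fst_le_snd
  have hA : m.1 % 2 = 0 → ∃ m' ∈ M, m'.1 = m.1 ∧ m.2 < m'.2 := by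
    intro h
    have hneg : Λ.Neg m (Λ.vtx (lo m)) := ⟨h, hm12, rfl⟩
    obtain ⟨m', hm't, hc', hne', hpn⟩ := key _ (Or.inr hneg)
    have hm'M := htM hm't
    -- Coherent arcs never have opposite signs at a vertex, so the second arc has the same lower
    -- code and, by minimality, is longer.
    have hn' : Λ.Neg m' (Λ.vtx (lo m)) := by
      refine hpn.resolve_left fun hp => ?_
      exact (hcl m' hm'M m hmM).1 (Or.inr ⟨_, hp, hneg⟩)
    have e := (vtx_lo_eq_iff (hM m' hm'M).1 hm.1).1 hn'.2.2
    have e1 : m'.1 = m.1 := by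
      have := hn'.1
      simp only [lo] at e; omega
    have hlen' := (hM m' hm'M).1.fst_le_snd
    have hmn : m.2 - m.1 ≤ m'.2 - m'.1 := hmin m' (by simp [hm't, hc'])
    have e2 : m'.2 ≠ m.2 := fun e2 => hne' (Prod.ext e1 e2)
    exact ⟨m', hm'M, e1, by omega⟩
  have hB : m.2 % 2 = 0 → ∃ m' ∈ M, m'.2 = m.2 ∧ m'.1 < m.1 := by
    intro h
    have hpos : Λ.Pos m (Λ.vtx (hi m)) := ⟨h, hm12, rfl⟩
    obtain ⟨m', hm't, hc', hne', hpn⟩ := key _ (Or.inl hpos)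
    have hm'M := htM hm't
    have hn' : Λ.Pos m' (Λ.vtx (hi m)) := by
      refine hpn.resolve_right fun hp => ?_
      exact (hcl m hmM m' hm'M).1 (Or.inr ⟨_, hpos, hp⟩)
    have e := (vtx_hi_eq_iff (hM m' hm'M).1 hm.1).1 hn'.2.2
    have e1 : m'.2 = m.2 := by
      have := hn'.1
      simp only [hi] at e; omega
    have hlen' := (hM m' hm'M).1.fst_le_snd
    have hmn : m.2 - m.1 ≤ m'.2 - m'.1 := hmin m' (by simp [hm't, hc'])
    have e2 : m'.1 ≠ m.1 := fun e2 => hne' (Prod.ext e2 e1)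
    exact ⟨m', hm'M, e1, by omega⟩
  exact not_longer_both hm hM hcl hA hB

end Vectors

end LegData
end PullDKK

/-! ### The coherence system of arcs and witnesses for violated steps. -/

namespace PullDKK

namespace LegData

variable {Λ : LegData}

theorem IsBox.isReg_of_sub {x a : ℕ × ℕ} (hx : Λ.IsBox x) (h1 : lo x ≤ lo a) (h2 : hi a ≤ hi x)
    (h3 : lo a < hi a) (h4 : a.1 % 2 = 1 → Λ.Bd (lo a)) (h5 : a.2 % 2 = 1 → Λ.Bd (hi a))
    (h6 : ¬ (a.1 % 2 = 1 ∧ a.2 % 2 = 1)) : Λ.IsReg a := by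
  refine ⟨⟨hx.lo_pos.trans h1, h3.le, h2.trans hx.hi_le, fun p hp h => hx.inner p hp (by omega),
    h4, h5, fun e => absurd e h3.ne⟩, ?_⟩
  rintro (e | e)
  · simp only [lo, hi] at h3; omega
  · exact h6 e

/-- Neighbours of `x` in both lower families form two corners of a resolution. The missing partner
combines the lower code of `y'` with the upper code of `y`. When `y` is on the adjacent leg, the
partner is `y` with its turn at the common leg end restored, and `y'` is then forced to be `x`
without its turn. -/
theorem lo_corner {x y y' : ℕ × ℕ} (hx : Λ.IsReg x) (hy : Λ.IsReg y) (hy' : Λ.IsReg y')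
    (h : y ∈ Λ.loA x) (h' : y' ∈ Λ.loB x) : ∃ z, Λ.IsReg z ∧
      ((Λ.Crossing z x ∧ y = (x.1, z.2) ∧ y' = (z.1, x.2)) ∨
       (Λ.Opposite z x ∧ y = (z.1, z.2 + 1) ∧ y' = (x.1 - 1, x.2))) := by
  obtain ⟨-, h⟩ := h
  obtain ⟨-, h1, h2⟩ := h'
  have o1 : ¬ (y.1 % 2 = 1 ∧ y.2 % 2 = 1) := fun h => hy.2 (Or.inr h)
  have o2 : ¬ (y'.1 % 2 = 1 ∧ y'.2 % 2 = 1) := fun h => hy'.2 (Or.inr h)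
  have o3 : ¬ (x.1 % 2 = 1 ∧ x.2 % 2 = 1) := fun h => hx.2 (Or.inr h)
  have p1 := hy'.1.lo_pos
  have p2 := hx.1.hi_le
  have p3 := hx.1.lo_pos
  rcases h with ⟨h3, h4⟩ | ⟨h3, h4, h5, h6⟩
  · have hlt : lo x < hi y := by
      have c := hy.1.trivial_codes
      have e : ¬ y.1 = y.2 := fun e => hy.2 (Or.inl e)
      have l := hy.1.lo_le
      simp only [lo, hi] at *
      omega
    have b : y'.1 % 2 = 1 → y.2 % 2 = 1 → False := by
      intro e1 e2
      have := hy'.1.inner _ (hy.1.bd_hi e2)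
      simp only [lo, hi] at *
      omega
    refine ⟨(y'.1, y.2), hy'.1.isReg_of_sub le_rfl ?_ ?_ hy'.1.bd_lo hy.1.bd_hi
      (fun h => b h.1 h.2), Or.inl ⟨⟨h2, ?_, h4, Or.inl hlt⟩, ?_, ?_⟩⟩
    · simp only [hi] at *; omega
    · simp only [lo, hi] at *; omega
    · simp only [lo, hi] at *; omega
    · exact Prod.ext h3 rfl
    · exact Prod.ext rfl h1
  · have hin := hy'.1.inner (lo x)
    have hv := (vtx_eq_iff hy.1 hx.1).1 h5
    have hb : Λ.Bd (lo x) := by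
      by_cases e : x.1 % 2 = 1
      · exact hx.1.bd_lo e
      · rcases hv with hv | hv
        · exact hv ▸ hy.1.bd_hi (h6.1 (by omega))
        · exact hv.2.2 ▸ Λ.bd_one
    have hin := hin hb
    have e1 : lo x = lo y' := by simp only [lo, hi] at *; omega
    have e2 : x.1 % 2 = 0 := by simp only [lo] at e1; omega
    have e3 := h6.1 e2
    have e4 : hi (y.1, y.2 - 1) = hi y := by simp only [hi]; omega
    have hby := hy.1.bd_hi e3
    have p4 := hy.1.lo_pos
    refine ⟨(y.1, y.2 - 1), hy.1.isReg_of_sub le_rfl e4.le (e4 ▸ h3) hy.1.bd_lo ?_ ?_,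
      Or.inr ⟨⟨?_, e2, e4 ▸ hby, hb, e4 ▸ h3, h4, ?_⟩, ?_, ?_⟩⟩
    · exact fun _ => e4 ▸ hby
    · simp only; omega
    · simp only; omega
    · rw [e4]; omega
    · exact Prod.ext rfl (by simp only; omega)
    · refine Prod.ext ?_ h1
      simp only [lo] at e1; simp only; omega

theorem hi_corner {x y y' : ℕ × ℕ} (hx : Λ.IsReg x) (hy : Λ.IsReg y) (hy' : Λ.IsReg y')
    (h : y ∈ Λ.hiA x) (h' : y' ∈ Λ.hiB x) : ∃ z, Λ.IsReg z ∧
      ((Λ.Crossing x z ∧ y = (x.1, z.2) ∧ y' = (z.1, x.2)) ∨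
       (Λ.Opposite x z ∧ y = (x.1, x.2 + 1) ∧ y' = (z.1 - 1, z.2))) := by
  obtain ⟨-, h1, h2⟩ := h
  obtain ⟨-, h⟩ := h'
  have o1 : ¬ (y.1 % 2 = 1 ∧ y.2 % 2 = 1) := fun h => hy.2 (Or.inr h)
  have o2 : ¬ (y'.1 % 2 = 1 ∧ y'.2 % 2 = 1) := fun h => hy'.2 (Or.inr h)
  have o3 : ¬ (x.1 % 2 = 1 ∧ x.2 % 2 = 1) := fun h => hx.2 (Or.inr h)
  have p1 := hy.1.hi_le
  have p2 := hx.1.hi_le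
  have p3 := hx.1.lo_pos
  rcases h with ⟨h3, h4⟩ | ⟨h3, h4, h5, h6⟩
  · have hlt : lo y' < hi x := by
      have c := hy'.1.trivial_codes
      have e : ¬ y'.1 = y'.2 := fun e => hy'.2 (Or.inl e)
      have l := hy'.1.lo_le
      simp only [lo, hi] at *
      omega
    have b : y'.1 % 2 = 1 → y.2 % 2 = 1 → False := by
      intro e1 e2
      have := hy.1.inner _ (hy'.1.bd_lo e1)
      simp only [lo, hi] at *
      omega
    refine ⟨(y'.1, y.2), hy.1.isReg_of_sub ?_ le_rfl ?_ hy'.1.bd_lo hy.1.bd_hi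
      (fun h => b h.1 h.2), Or.inl ⟨⟨h4, ?_, h2, Or.inl hlt⟩, ?_, ?_⟩⟩
    · simp only [lo] at *; omega
    · simp only [lo, hi] at *; omega
    · simp only [lo, hi] at *; omega
    · exact Prod.ext h1 rfl
    · exact Prod.ext rfl h3
  · have hin := hy.1.inner (hi x)
    have hv := (vtx_eq_iff hx.1 hy'.1).1 h5
    have hb : Λ.Bd (hi x) := by
      by_cases e : x.2 % 2 = 1
      · exact hx.1.bd_hi e
      · rcases hv with hv | hv
        · exact hv ▸ hy'.1.bd_lo (by omega)
        · exact hv.2.1 ▸ Λ.bd_last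
    have hin := hin hb
    have e1 : hi x = hi y := by simp only [lo, hi] at *; omega
    have e2 : x.2 % 2 = 0 := by simp only [hi] at e1; omega
    have e3 : y'.1 % 2 = 1 := by omega
    have e4 : lo (y'.1 + 1, y'.2) = lo y' := by simp only [lo]; omega
    have hby := hy'.1.bd_lo e3
    have p4 := hy'.1.hi_le
    refine ⟨(y'.1 + 1, y'.2), hy'.1.isReg_of_sub e4.ge le_rfl (e4 ▸ h4) ?_ hy'.1.bd_hi ?_,
      Or.inr ⟨⟨e2, ?_, hb, e4 ▸ hby, h3, e4 ▸ h4, ?_⟩, ?_, ?_⟩⟩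
    · exact fun _ => e4 ▸ hby
    · simp only; omega
    · simp only; omega
    · have := hx.1.lo_pos
      rw [e4]; omega
    · refine Prod.ext h1 ?_
      simp only [hi] at e1; simp only; omega
    · exact Prod.ext rfl rfl

variable (Λ) in
/-- The coherence system of arcs. -/
noncomputable def system : CoherenceSystem (ℕ × ℕ) Λ.n where
  box := {a | Λ.IsBox a}
  exc := {a | Exc a}
  g := Λ.g
  Coh := Λ.Coh
  loA := Λ.loA
  loB := Λ.loB
  hiA := Λ.hiA
  hiB := Λ.hiB
  finite_box := finite_isBox
  coh_symm _ _ h := h.symm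
  coh_self _ h := coh_self h
  g_exc _ h := g_exc h
  exposed x hx := by
    obtain ⟨ψ, h0, h⟩ := exposed (Λ := Λ) hx
    exact ⟨ψ, h0, fun y hy => h y hy⟩
  indep M hM hcl := linearIndepOn_g (fun a ha => hM ha) hcl
  span := span_g
  resolve x hx y hy h := by
    rw [Coh, not_and_or, not_not, not_not] at h
    rcases h with h | h
    · rcases NW.resolve hx hy h with h0 | ⟨z, z', h1, h2, h3, h4, h5, -⟩
      · exact Or.inl h0
      · exact Or.inr ⟨z, h4.1, z', h5.1, h1, h2, fun w hw => h3 w hw, Or.inr ⟨h4, h5⟩⟩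
    · rcases NW.resolve hy hx h with h0 | ⟨z, z', h1, ⟨c1, c2, c3, c4⟩, h3, h4, h5, h6 | h6⟩
      · exact Or.inl (by rw [add_comm]; exact h0)
      · exact Or.inr ⟨z, h4.1, z', h5.1, by rw [add_comm]; exact h1, ⟨c3, c4, c1, c2⟩,
          fun w hw hwx hwy => h3 w hw hwy hwx, Or.inl h6⟩
      · exact Or.inr ⟨z', h5.1, z, h4.1, by rw [add_comm, h1, add_comm], ⟨c4, c3, c2, c1⟩,
          fun w hw hwx hwy => (h3 w hw hwy hwx).symm, Or.inl h6⟩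

/-- If each of two elements may be pulled only after the other, neither can come first. -/
theorem _root_.PullDKK.CoherenceSystem.not_mem_of_mutual {ι : Type*} {n : ℕ}
    {Γ : CoherenceSystem ι n} {a b : ι} {V : List ι}
    (hV : Γ.AllSteps V) (ha : ∀ V', V' <+: V → Γ.Step V' a → b ∈ V')
    (hb : ∀ V', V' <+: V → Γ.Step V' b → a ∈ V') : a ∉ V ∧ b ∉ V := by
  induction V using List.reverseRecOn with
  | nil => simp
  | append_singleton V w ih =>
    have hstep : Γ.Step V w := hV V w [] rfl
    have hpre : V <+: V ++ [w] := List.prefix_append _ _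
    obtain ⟨h1, h2⟩ := ih (fun V' x W e => hV V' x (W ++ [w]) (by simp [e]))
      (fun V' h => ha V' (h.trans hpre)) (fun V' h => hb V' (h.trans hpre))
    constructor
    · intro h
      rcases List.mem_append.1 h with h | h
      · exact h1 h
      · rw [List.mem_singleton] at h
        exact h2 (ha V hpre (h ▸ hstep))
    · intro h
      rcases List.mem_append.1 h with h | h
      · exact h2 h
      · rw [List.mem_singleton] at h
        exact h1 (hb V hpre (h ▸ hstep))

section Special

variable {x z : ℕ × ℕ} {V : List (ℕ × ℕ)}

/-- While the two shortened arcs are unpulled, the lower side of `(x.1, 2 * t)` can be satisfied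
only after `(x.1 - 1, 2 * t)` is pulled. The upper side of the latter likewise waits for the former.
So the pair blocks itself. -/
theorem not_mem_of_blocked_left (hx : Λ.IsReg x) (hz : Λ.IsReg z) (h : Λ.Opposite z x)
    (h' : Λ.Opposite x z)
    (hV : Λ.system.AllSteps V) (hu : (x.1 - 1, x.2) ∉ V) (hu' : (z.1, z.2 + 1) ∉ V) {t : ℕ}
    (h1 : lo x < t) (h2 : t < hi x) : (x.1, 2 * t) ∉ V ∧ (x.1 - 1, 2 * t) ∉ V := by
  have hb := h.isBox_lo hx
  have hb' := h.isBox_hi hz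
  have hv := h.vtx_eq hz hx
  obtain ⟨e1, e2, e3, e4, e5, e6, -⟩ := h
  obtain ⟨f1, f2, -⟩ := h'
  have hp := hx.1.lo_pos
  have ea : lo (x.1 - 1, 2 * t) = lo x := by simp only [lo] at *; omega
  have eh : hi (z.1, z.2 + 1) = hi z := by simp only [hi]; omega
  have ra : Λ.IsReg (x.1, 2 * t) := hx.1.isReg_of_sub le_rfl
    (by simp only [hi] at *; omega) (by simp only [lo, hi] at *; omega) hx.1.bd_lo
    (by simp only; omega) (by simp only; omega)
  have rb : Λ.IsReg (x.1 - 1, 2 * t) := hx.1.isReg_of_sub ea.ge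
    (by simp only [hi] at *; omega) (by rw [ea]; simp only [lo, hi] at *; omega)
    (fun _ => ea ▸ e4) (by simp only; omega) (by simp only; omega)
  have nu : ¬ Exc (x.1 - 1, x.2) := by
    simp only [Exc, lo, hi] at *; omega
  have nu' : ¬ Exc (z.1, z.2 + 1) := by
    simp only [Exc, lo, hi] at *; omega
  apply CoherenceSystem.not_mem_of_mutual hV
  · intro V' hV' hs
    rcases hs.1 with hs | hs
    · have : (z.1, z.2 + 1) ∈ Λ.system.done V' := by
        refine hs ⟨hb', Or.inr ⟨?_, ?_, ?_, ?_⟩⟩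
        · rw [eh]; exact e5
        · simp only [lo, hi] at *; omega
        · rw [eh]; exact hv
        · simp only; omega
      exact absurd (hV'.subset (this.resolve_left nu')) hu'
    · exact (hs (show (x.1 - 1, 2 * t) ∈ Λ.loB (x.1, 2 * t) from
        ⟨rb.1, rfl, by simp only [lo] at *; omega⟩)).resolve_left rb.2
  · intro V' hV' hs
    rcases hs.2 with hs | hs
    · have : (x.1 - 1, x.2) ∈ Λ.system.done V' :=
        hs ⟨hb, rfl, by simp only [hi] at *; omega⟩
      exact absurd (hV'.subset (this.resolve_left nu)) hu
    · exact (hs (show (x.1, 2 * t) ∈ Λ.hiB (x.1 - 1, 2 * t) from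
        ⟨ra.1, Or.inl ⟨rfl, by simp only [lo] at *; omega⟩⟩)).resolve_left ra.2

theorem not_mem_of_blocked_right (hx : Λ.IsReg x) (hz : Λ.IsReg z) (h : Λ.Opposite z x)
    (h' : Λ.Opposite x z)
    (hV : Λ.system.AllSteps V) (hu : (x.1 - 1, x.2) ∉ V) (hu' : (z.1, z.2 + 1) ∉ V) {t : ℕ}
    (h1 : lo z < t) (h2 : t < hi z) : (2 * t, z.2 + 1) ∉ V ∧ (2 * t, z.2) ∉ V := by
  have hb := h.isBox_lo hx
  have hb' := h.isBox_hi hz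
  have hv := h.vtx_eq hz hx
  obtain ⟨e1, e2, e3, e4, e5, e6, -⟩ := h
  obtain ⟨f1, f2, -⟩ := h'
  have hp := hx.1.lo_pos
  have ea : lo (x.1 - 1, x.2) = lo x := by simp only [lo] at *; omega
  have eh : hi (2 * t, z.2 + 1) = hi z := by simp only [hi]; omega
  have ra : Λ.IsReg (2 * t, z.2 + 1) := hz.1.isReg_of_sub
    (by simp only [lo] at *; omega) eh.le (by rw [eh]; simp only [lo, hi] at *; omega)
    (by simp only; omega) (fun _ => eh ▸ e3) (by simp only; omega)
  have rb : Λ.IsReg (2 * t, z.2) := hz.1.isReg_of_sub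
    (by simp only [lo] at *; omega) le_rfl (by simp only [lo, hi] at *; omega)
    (by simp only; omega) hz.1.bd_hi (by simp only; omega)
  have nu : ¬ Exc (x.1 - 1, x.2) := by
    simp only [Exc, lo, hi] at *; omega
  have nu' : ¬ Exc (z.1, z.2 + 1) := by
    simp only [Exc, lo, hi] at *; omega
  apply CoherenceSystem.not_mem_of_mutual hV
  · intro V' hV' hs
    rcases hs.1 with hs | hs
    · exact (hs (show (2 * t, z.2) ∈ Λ.loA (2 * t, z.2 + 1) from
        ⟨rb.1, Or.inl ⟨rfl, Nat.lt_succ_self _⟩⟩)).resolve_left rb.2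
    · have : (z.1, z.2 + 1) ∈ Λ.system.done V' :=
        hs ⟨hb', rfl, by simp only [lo] at *; omega⟩
      exact absurd (hV'.subset (this.resolve_left nu')) hu'
  · intro V' hV' hs
    rcases hs.2 with hs | hs
    · exact (hs (show (2 * t, z.2 + 1) ∈ Λ.hiA (2 * t, z.2) from
        ⟨ra.1, rfl, Nat.lt_succ_self _⟩)).resolve_left ra.2
    · have : (x.1 - 1, x.2) ∈ Λ.system.done V' := by
        refine hs ⟨hb, Or.inr ⟨?_, ?_, ?_, ?_⟩⟩
        · simp only [lo, hi] at *; omega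
        · rw [ea]; exact e6
        · rw [ea]; exact hv
        · simp only [lo] at *; omega
      exact absurd (hV'.subset (this.resolve_left nu)) hu

/-- Two arcs opposite at both ends cover both legs of a cycle. Since `K ≥ 3`, one of the legs has an
interior vertex; this is where `k ≠ (1,1)` matters. -/
theorem exists_interior (h : Λ.Opposite z x) (h' : Λ.Opposite x z) :
    (∃ t, lo x < t ∧ t < hi x) ∨ ∃ t, lo z < t ∧ t < hi z := by
  obtain ⟨e1, e2, e3, e4, e5, e6, e7⟩ := h
  obtain ⟨f1, f2, f3, f4, f5, f6, f7⟩ := h'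
  have hn : Λ.n = Λ.K := by omega
  have := (Λ.cycle hn).1
  by_cases c : lo x + 1 < hi x
  · exact Or.inl ⟨lo x + 1, by omega, c⟩
  · exact Or.inr ⟨lo z + 1, by omega, by omega⟩

end Special

section Witness

variable {x z : ℕ × ℕ}

theorem Crossing.witness (hx : Λ.IsReg x) (hz : Λ.IsReg z) (h : Λ.Crossing x z)
    (hy : Λ.IsReg (x.1, z.2)) (hy' : Λ.IsReg (z.1, x.2)) :
    Λ.Coh (z.1, x.2) (x.1, z.2) ∧ Λ.Coh (x.1, z.2) x ∧ Λ.Coh (z.1, x.2) x ∧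
      Λ.Coh (x.1, z.2) z ∧ Λ.Coh (z.1, x.2) z ∧ ¬ Λ.Coh x z :=
  have h1 := coh_of_snd_eq hy'.1 hx.1 rfl
  have h2 := coh_of_fst_eq hy'.1 hz.1 rfl
  ⟨h.coh_outer hx hz hy' h1 h2, coh_of_fst_eq hy.1 hx.1 rfl, h1,
    coh_of_snd_eq hy.1 hz.1 rfl, h2, fun hc => hc.1 (h.nw hx hz)⟩

theorem Opposite.witness (hx : Λ.IsReg x) (hz : Λ.IsReg z) (h : Λ.Opposite x z)
    (hnw : ¬ Λ.NW z x) (hy : Λ.IsReg (x.1, x.2 + 1)) (hy' : Λ.IsReg (z.1 - 1, z.2)) :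
    Λ.Coh (x.1, x.2 + 1) (z.1 - 1, z.2) ∧ Λ.Coh (x.1, x.2 + 1) x ∧ Λ.Coh (z.1 - 1, z.2) x ∧
      Λ.Coh (x.1, x.2 + 1) z ∧ Λ.Coh (z.1 - 1, z.2) z ∧ ¬ Λ.Coh x z :=
  have h1 := coh_of_fst_eq hy.1 hx.1 rfl
  have h2 := (h.coh_right_hi hx hz hnw).symm
  ⟨h.coh_lo hx hz hy h1 h2, h1, (h.coh_left_lo hx hz hnw).symm, h2,
    coh_of_snd_eq hy'.1 hz.1 rfl, fun hc => hc.1 (h.nw hx hz)⟩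

/-- The conclusion of `CoherenceSystem.HasWitnesses`. -/
def Witness (Λ : LegData) (V : List (ℕ × ℕ)) (x : ℕ × ℕ) : Prop :=
  ∃ y, Λ.IsReg y ∧ ∃ y', Λ.IsReg y' ∧ ∃ z, Λ.IsReg z ∧ Λ.Coh y y' ∧ Λ.Coh y z ∧ Λ.Coh y' z ∧
    ¬ Λ.Coh x z ∧ y ∉ V ∧ y' ∉ V ∧ Λ.g x + Λ.g z = Λ.g y + Λ.g y'

variable {V : List (ℕ × ℕ)} {y y' : ℕ × ℕ}

/-- The partner found by `lo_corner` is a witness unless `x` and `z` are opposite at both ends, when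
the shortened arcs need not be coherent with them. -/
theorem lo_witness_or (hx : Λ.IsReg x) (hy : Λ.IsReg y) (hy' : Λ.IsReg y')
    (h : y ∈ Λ.loA x) (h' : y' ∈ Λ.loB x) (hV : y ∉ V) (hV' : y' ∉ V) : Λ.Witness V x ∨
    ∃ z, Λ.IsReg z ∧ Λ.Opposite z x ∧ Λ.Opposite x z ∧ y = (z.1, z.2 + 1) ∧
      y' = (x.1 - 1, x.2) := by
  obtain ⟨z, hz, ⟨hc, rfl, rfl⟩ | ⟨ho, rfl, rfl⟩⟩ := lo_corner hx hy hy' h h'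
  · obtain ⟨w1, w2, w3, w4, w5, w6⟩ := hc.witness hz hx hy' hy
    exact Or.inl ⟨_, hy, _, hy', z, hz, w1, w3, w2, fun h => w6 h.symm, hV, hV',
      g_add_swap x z⟩
  · by_cases hnw : Λ.NW x z
    · exact Or.inr ⟨z, hz, ho, ho.of_nw_symm hz hx hnw, rfl, rfl⟩
    · obtain ⟨w1, w2, w3, w4, w5, w6⟩ := ho.witness hz hx hnw hy hy'
      exact Or.inl ⟨_, hy, _, hy', z, hz, w1, w2, w3, fun h => w6 h.symm, hV, hV',
        by rw [add_comm]; exact ho.g_add hz hx⟩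

theorem hi_witness_or (hx : Λ.IsReg x) (hy : Λ.IsReg y) (hy' : Λ.IsReg y')
    (h : y ∈ Λ.hiA x) (h' : y' ∈ Λ.hiB x) (hV : y ∉ V) (hV' : y' ∉ V) : Λ.Witness V x ∨
    ∃ z, Λ.IsReg z ∧ Λ.Opposite x z ∧ Λ.Opposite z x ∧ y = (x.1, x.2 + 1) ∧
      y' = (z.1 - 1, z.2) := by
  obtain ⟨z, hz, ⟨hc, rfl, rfl⟩ | ⟨ho, rfl, rfl⟩⟩ := hi_corner hx hy hy' h h'
  · obtain ⟨w1, w2, w3, w4, w5, w6⟩ := hc.witness hx hz hy hy'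
    exact Or.inl ⟨_, hy, _, hy', z, hz, w1.symm, w4, w5, w6, hV, hV', g_add_swap x z⟩
  · by_cases hnw : Λ.NW z x
    · exact Or.inr ⟨z, hz, ho, ho.of_nw_symm hx hz hnw, rfl, rfl⟩
    · obtain ⟨w1, w2, w3, w4, w5, w6⟩ := ho.witness hx hz hnw hy hy'
      exact Or.inl ⟨_, hy, _, hy', z, hz, w1, w4, w5, w6, hV, hV', ho.g_add hx hz⟩

/-- In the doubly opposite case `y` is replaced by an unpulled arc with an end at an interior vertex
of one of the legs, found by the blocking lemmas. For this arc the doubly opposite case cannot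
recur: it would need either a different parity of the upper code or a leg end in the interior. -/
theorem lo_witness (hx : Λ.IsReg x) (hy : Λ.IsReg y) (hy' : Λ.IsReg y')
    (h : y ∈ Λ.loA x) (h' : y' ∈ Λ.loB x) (hV : y ∉ V) (hV' : y' ∉ V)
    (hall : Λ.system.AllSteps V) : Λ.Witness V x := by
  refine (lo_witness_or hx hy hy' h h' hV hV').elim id ?_
  rintro ⟨z, hz, ho, ho', rfl, rfl⟩
  have hv := ho.vtx_eq hz hx
  obtain ⟨e1, e2, e3, e4, e5, e6, -⟩ := id ho
  rcases exists_interior ho ho' with ⟨t, ht1, ht2⟩ | ⟨t, ht1, ht2⟩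
  · have hn := (not_mem_of_blocked_left hx hz ho ho' hall hV' hV ht1 ht2).1
    have hr : Λ.IsReg (x.1, 2 * t) := hx.1.isReg_of_sub le_rfl
      (by simp only [hi] at *; omega) (by simp only [lo, hi] at *; omega) hx.1.bd_lo
      (by simp only; omega) (by simp only; omega)
    refine (lo_witness_or hx hr hy' ⟨hr.1, Or.inl ⟨rfl, ?_⟩⟩ h' hn hV').elim id ?_
    · simp only [hi] at *; omega
    · rintro ⟨w, -, ho2, -, e, -⟩
      have h1 := congrArg Prod.snd e
      have h2 := ho2.1
      simp only at h1
      omega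
  · have hn := (not_mem_of_blocked_right hx hz ho ho' hall hV' hV ht1 ht2).1
    have eh : hi (2 * t, z.2 + 1) = hi z := by simp only [hi]; omega
    have hr : Λ.IsReg (2 * t, z.2 + 1) := hz.1.isReg_of_sub
      (by simp only [lo] at *; omega) eh.le (by rw [eh]; simp only [lo, hi] at *; omega)
      (by simp only; omega) (fun _ => eh ▸ e3) (by simp only; omega)
    refine (lo_witness_or hx hr hy' ⟨hr.1, Or.inr ⟨?_, e6, ?_, ?_⟩⟩ h' hn hV').elim id ?_
    · rw [eh]; simp only [lo, hi] at *; omega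
    · rw [eh]; exact hv
    · simp only; omega
    · rintro ⟨w, -, -, ho2, e, -⟩
      have h1 := congrArg Prod.fst e
      have h2 := congrArg Prod.snd e
      have h3 : lo w = t := by simp only [lo] at *; omega
      exact absurd ⟨ht1, ht2⟩ (hz.1.inner _ (h3 ▸ ho2.2.2.2.1))

theorem hi_witness (hx : Λ.IsReg x) (hy : Λ.IsReg y) (hy' : Λ.IsReg y')
    (h : y ∈ Λ.hiA x) (h' : y' ∈ Λ.hiB x) (hV : y ∉ V) (hV' : y' ∉ V)
    (hall : Λ.system.AllSteps V) : Λ.Witness V x := by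
  refine (hi_witness_or hx hy hy' h h' hV hV').elim id ?_
  rintro ⟨z, hz, ho, ho', rfl, rfl⟩
  have hv := ho.vtx_eq hx hz
  obtain ⟨e1, e2, e3, e4, e5, e6, -⟩ := id ho
  rcases exists_interior ho ho' with ⟨t, ht1, ht2⟩ | ⟨t, ht1, ht2⟩
  · have hn := (not_mem_of_blocked_left hz hx ho ho' hall hV' hV ht1 ht2).2
    have hp := hz.1.lo_pos
    have ea : lo (z.1 - 1, 2 * t) = lo z := by simp only [lo] at *; omega
    have hr : Λ.IsReg (z.1 - 1, 2 * t) := hz.1.isReg_of_sub ea.ge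
      (by simp only [hi] at *; omega) (by rw [ea]; simp only [lo, hi] at *; omega)
      (fun _ => ea ▸ e4) (by simp only; omega) (by simp only; omega)
    refine (hi_witness_or hx hy hr h ⟨hr.1, Or.inr ⟨e5, ?_, ?_, ?_⟩⟩ hV hn).elim id ?_
    · rw [ea]; simp only [lo, hi] at *; omega
    · rw [ea]; exact hv
    · simp only [lo] at *; omega
    · rintro ⟨w, hw, -, ho2, -, e⟩
      have h1 := congrArg Prod.snd e
      have h3 : hi w = t := by simp only [hi] at *; omega
      exact absurd ⟨ht1, ht2⟩ (hz.1.inner _ (h3 ▸ ho2.2.2.1))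
  · have hn := (not_mem_of_blocked_right hz hx ho ho' hall hV' hV ht1 ht2).2
    have hr : Λ.IsReg (2 * t, x.2) := hx.1.isReg_of_sub
      (by simp only [lo] at *; omega) le_rfl (by simp only [lo, hi] at *; omega)
      (by simp only; omega) hx.1.bd_hi (by simp only; omega)
    refine (hi_witness_or hx hy hr h ⟨hr.1, Or.inl ⟨rfl, ?_⟩⟩ hV hn).elim id ?_
    · simp only [lo] at *; omega
    · rintro ⟨w, hw, ho2, -, -, e⟩
      have h1 := congrArg Prod.fst e
      have h2 := ho2.2.1
      have h3 := hw.1.lo_pos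
      simp only [lo] at *
      omega

end Witness

variable (Λ) in
theorem system_hasWitnesses : Λ.system.HasWitnesses := by
  intro V x hall hV hx hxV hstep
  have key : ∀ y, Λ.IsBox y → y ∉ Λ.system.done V → Λ.IsReg y ∧ y ∉ V := fun y hy h =>
    ⟨⟨hy, fun he => h (Or.inl he)⟩, fun he => h (Or.inr he)⟩
  rw [CoherenceSystem.Step, not_and_or, not_or, not_or] at hstep
  rcases hstep with ⟨h1, h2⟩ | ⟨h1, h2⟩
  · obtain ⟨y, hy, hyV⟩ := Set.not_subset.1 h1
    obtain ⟨y', hy', hyV'⟩ := Set.not_subset.1 h2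
    obtain ⟨ry, ny⟩ := key y hy.1 hyV
    obtain ⟨ry', ny'⟩ := key y' hy'.1 hyV'
    exact lo_witness hx ry ry' hy hy' ny ny' hall
  · obtain ⟨y, hy, hyV⟩ := Set.not_subset.1 h1
    obtain ⟨y', hy', hyV'⟩ := Set.not_subset.1 h2
    obtain ⟨ry, ny⟩ := key y hy.1 hyV
    obtain ⟨ry', ny'⟩ := key y' hy'.1 hyV'
    exact hi_witness hx ry ry' hy hy' ny ny' hall

end LegData
end PullDKK

/-! ### From the graph to leg data: which source and sink edges exist. -/

namespace PullDKK

/-- The conditions on `k` and `n` under which `legDAG k n` is `Path(k)`, or `Cycle(k)` with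
`k ≠ (1, 1)`. -/
structure LegShape (k : List ℕ) (n : ℕ) : Prop where
  n_eq : n = k.sum ∨ n = k.sum + 1
  sum_pos : 1 ≤ k.sum
  forward_one : IsForward k 1
  cycle : n = k.sum → 3 ≤ k.sum ∧ ¬ IsForward k k.sum

namespace LegShape

variable {k : List ℕ} {n : ℕ}

/-- Leg ends are the extremes and the positions where the direction changes. In a cycle there is an
inner leg end, since otherwise the last edge would be forward like the first. -/
def arcs (h : LegShape k n) : LegData where
  K := k.sum
  n := n
  Bd p := p = 1 ∨ p = k.sum + 1 ∨ ¬ (IsForward k (p - 1) ↔ IsForward k p)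
  n_eq := h.n_eq
  K_pos := h.sum_pos
  bd_one := Or.inl rfl
  bd_last := Or.inr (Or.inl rfl)
  cycle hn := by
    refine ⟨(h.cycle hn).1, ?_⟩
    by_contra hno
    push Not at hno
    refine (h.cycle hn).2 ?_
    have : ∀ p, 1 ≤ p → p ≤ k.sum → IsForward k p := by
      intro p hp
      induction p, hp using Nat.le_induction with
      | base => exact fun _ => h.forward_one
      | succ p hp ih =>
        intro hle
        have := (hno (p + 1) (by omega) (by omega)).2.2
        exact this.1 (ih (by omega))
    exact this _ h.sum_pos le_rfl

/-- The direction of the leg of an arc. -/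
def Fwd (k : List ℕ) (a : ℕ × ℕ) : Prop := IsForward k (min (lo a) k.sum)

open Classical in
/-- The source or sink edge at the lower end of an arc. -/
noncomputable def lowEdge (h : LegShape k n) (a : ℕ × ℕ) : Edge :=
  if Fwd k a then .src (h.arcs.vtx (lo a)) (if a.1 % 2 = 0 then 1 else 2)
  else .snk (h.arcs.vtx (lo a)) (if a.1 % 2 = 0 then 2 else 1)

open Classical in
/-- The source or sink edge at the upper end of an arc. -/
noncomputable def upEdge (h : LegShape k n) (a : ℕ × ℕ) : Edge :=
  if Fwd k a then .snk (h.arcs.vtx (hi a)) (if a.2 % 2 = 0 then 1 else 2)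
  else .src (h.arcs.vtx (hi a)) (if a.2 % 2 = 0 then 2 else 1)

/-- The edges of the route of an arc, from the lower end to the upper end. -/
noncomputable def ascending (h : LegShape k n) (a : ℕ × ℕ) : List Edge :=
  h.lowEdge a :: ((List.range' (lo a) (hi a - lo a)).map Edge.inner ++ [h.upEdge a])

open Classical in
/-- The route of an arc. -/
noncomputable def route (h : LegShape k n) (a : ℕ × ℕ) : List Edge :=
  if Fwd k a then h.ascending a else (h.ascending a).reverse

section Edges

theorem vtx_def (h : LegShape k n) (p : ℕ) : h.arcs.vtx p = if p ≤ n then p else 1 := rfl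

theorem vtx_mem (h : LegShape k n) {p : ℕ} (h1 : 1 ≤ p) :
    1 ≤ h.arcs.vtx p ∧ h.arcs.vtx p ≤ n := by
  have := h.n_eq
  have := h.sum_pos
  simp only [vtx_def]
  split_ifs <;> omega

theorem mod_add_one (h : LegShape k n) {i : ℕ} (h2 : i ≤ k.sum) : i % n + 1 = h.arcs.vtx (i + 1) := by
  have := h.n_eq
  simp only [vtx_def]
  split_ifs with hlt
  · rw [Nat.mod_eq_of_lt (by omega)]
  · have : i = n := by omega
    rw [this, Nat.mod_self]

theorem vtx_of_le (h : LegShape k n) {p : ℕ} (h2 : p ≤ k.sum) : h.arcs.vtx p = p := by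
  have := h.n_eq
  simp only [vtx_def]
  split_ifs <;> omega

theorem vtx_last (h : LegShape k n) : h.arcs.vtx (k.sum + 1) = k.sum + 1 ∧ n = k.sum + 1 ∨
    h.arcs.vtx (k.sum + 1) = 1 ∧ n = k.sum := by
  have := h.n_eq
  simp only [vtx_def]
  split_ifs <;> omega

theorem vtx_inj (h : LegShape k n) {p q : ℕ} (hp : 2 ≤ p) (hp' : p ≤ k.sum + 1) (hq : 2 ≤ q)
    (hq' : q ≤ k.sum + 1) : h.arcs.vtx p = h.arcs.vtx q ↔ p = q := by
  have := h.n_eq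
  simp only [vtx_def]
  split_ifs <;> omega

theorem innerTail_forward {i : ℕ} (hf : IsForward k i) : innerTail k n i = i := if_pos hf

theorem innerTail_backward (h : LegShape k n) {i : ℕ} (h2 : i ≤ k.sum) (hf : ¬ IsForward k i) :
    innerTail k n i = h.arcs.vtx (i + 1) := by
  rw [← h.mod_add_one h2]; exact if_neg hf

theorem innerHead_forward (h : LegShape k n) {i : ℕ} (h2 : i ≤ k.sum) (hf : IsForward k i) :
    innerHead k n i = h.arcs.vtx (i + 1) := by
  rw [← h.mod_add_one h2]; exact if_pos hf

theorem innerHead_backward {i : ℕ} (hf : ¬ IsForward k i) : innerHead k n i = i := if_neg hf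

theorem mem_edges_inner {i : ℕ} : Edge.inner i ∈ (legDAG k n).edges ↔ 1 ≤ i ∧ i ≤ k.sum := Iff.rfl

theorem mem_edges_src {v l : ℕ} : Edge.src v l ∈ (legDAG k n).edges ↔
    (1 ≤ v ∧ v ≤ n) ∧ (l = 1 ∨ l = 2) ∧
      ∀ i, 1 ≤ i → i ≤ k.sum → ¬ (innerHead k n i = v ∧ innerLabel k i = l) := Iff.rfl

theorem mem_edges_snk {v l : ℕ} : Edge.snk v l ∈ (legDAG k n).edges ↔
    (1 ≤ v ∧ v ≤ n) ∧ (l = 1 ∨ l = 2) ∧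
      ∀ i, 1 ≤ i → i ≤ k.sum → ¬ (innerTail k n i = v ∧ innerLabel k i = l) := Iff.rfl

theorem innerLabel_eq_one {i : ℕ} : innerLabel k i = 1 ↔ ¬ IsForward k i := by
  simp only [innerLabel]; split_ifs <;> simp_all

theorem innerLabel_eq_two {i : ℕ} : innerLabel k i = 2 ↔ IsForward k i := by
  simp only [innerLabel]; split_ifs <;> simp_all

variable (h : LegShape k n) {p : ℕ} (h1 : 1 ≤ p) (h2 : p ≤ k.sum + 1)
include h1 h2

/-- A source or sink edge exists exactly when no inner edge takes its place. The incoming edge of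
label `1` at `p` is the inner edge `p` if that is backward, and the outgoing edge of label `2` is
the same inner edge if it is forward. The other two labels are decided in the same way by the inner
edge `p - 1`. Extreme positions are treated separately because a cycle identifies them. -/
theorem src_one_mem : Edge.src (h.arcs.vtx p) 1 ∈ (legDAG k n).edges ↔
    p = k.sum + 1 ∨ IsForward k p := by
  rw [mem_edges_src]
  simp only [h.vtx_mem h1, and_self, true_and, true_or, innerLabel_eq_one]
  constructor
  · intro H
    by_contra hc
    push Not at hc
    refine H p h1 (by omega) ⟨?_, hc.2⟩
    rw [innerHead_backward hc.2, h.vtx_of_le (by omega)]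
  · rintro H i i1 i2 ⟨e, hf⟩
    rw [innerHead_backward hf] at e
    by_cases hp : p = k.sum + 1
    · rw [hp] at e
      rcases h.vtx_last with ⟨hl, -⟩ | ⟨hl, -⟩
      · omega
      · rw [hl] at e
        exact hf (e ▸ h.forward_one)
    · rw [h.vtx_of_le (by omega)] at e
      exact hf (e ▸ H.resolve_left hp)

theorem snk_two_mem : Edge.snk (h.arcs.vtx p) 2 ∈ (legDAG k n).edges ↔
    (p ≤ k.sum ∧ ¬ IsForward k p) ∨ (p = k.sum + 1 ∧ n = k.sum + 1) := by
  rw [mem_edges_snk]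
  simp only [h.vtx_mem h1, and_self, true_and, or_true, innerLabel_eq_two]
  constructor
  · intro H
    by_cases hp : p = k.sum + 1
    · refine Or.inr ⟨hp, ?_⟩
      rcases h.vtx_last with ⟨hl, hn⟩ | ⟨hl, -⟩
      · exact hn
      · refine absurd ⟨?_, h.forward_one⟩ (H 1 le_rfl h.sum_pos)
        rw [innerTail_forward h.forward_one, hp, hl]
    · refine Or.inl ⟨by omega, fun hf => H p h1 (by omega) ⟨?_, hf⟩⟩
      rw [innerTail_forward hf, h.vtx_of_le (by omega)]
  · rintro H i i1 i2 ⟨e, hf⟩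
    rw [innerTail_forward hf] at e
    rcases H with ⟨H1, H2⟩ | ⟨H1, H2⟩
    · rw [h.vtx_of_le (by omega)] at e
      exact H2 (e ▸ hf)
    · have := h.vtx_last
      rw [H1] at e
      omega

theorem src_two_mem : Edge.src (h.arcs.vtx p) 2 ∈ (legDAG k n).edges ↔
    p = 1 ∨ ¬ IsForward k (p - 1) := by
  rw [mem_edges_src]
  simp only [h.vtx_mem h1, and_self, true_and, or_true, innerLabel_eq_two]
  constructor
  · intro H
    by_contra hc
    push Not at hc
    have h3 : p - 1 + 1 = p := by omega
    refine H (p - 1) (by omega) (by omega) ⟨?_, hc.2⟩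
    rw [h.innerHead_forward (by omega) hc.2, h3]
  · rintro H i i1 i2 ⟨e, hf⟩
    rw [h.innerHead_forward i2 hf] at e
    by_cases hp : p = 1
    · rw [hp, h.vtx_of_le h.sum_pos] at e
      have hn := h.n_eq
      have hc := h.cycle
      by_cases hi : i = k.sum
      · subst hi
        rcases h.vtx_last with ⟨hl, -⟩ | ⟨-, hn⟩
        · omega
        · exact (hc hn).2 hf
      · rw [h.vtx_of_le (by omega)] at e
        omega
    · rw [h.vtx_inj (by omega) (by omega) (by omega) h2] at e
      refine H.resolve_left hp ?_
      rw [← e]; exact hf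

theorem snk_one_mem : Edge.snk (h.arcs.vtx p) 1 ∈ (legDAG k n).edges ↔
    (p = 1 ∧ n = k.sum + 1) ∨ (2 ≤ p ∧ IsForward k (p - 1)) := by
  rw [mem_edges_snk]
  simp only [h.vtx_mem h1, and_self, true_and, true_or, innerLabel_eq_one]
  constructor
  · intro H
    by_cases hp : p = 1
    · refine Or.inl ⟨hp, ?_⟩
      rcases h.vtx_last with ⟨-, hn⟩ | ⟨hl, hn⟩
      · exact hn
      · refine absurd ⟨?_, (h.cycle hn).2⟩ (H k.sum h.sum_pos le_rfl)
        rw [h.innerTail_backward le_rfl (h.cycle hn).2, hl, hp, h.vtx_of_le h.sum_pos]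
    · refine Or.inr ⟨by omega, ?_⟩
      by_contra hf
      have h3 : p - 1 + 1 = p := by omega
      refine H (p - 1) (by omega) (by omega) ⟨?_, hf⟩
      rw [h.innerTail_backward (by omega) hf, h3]
  · rintro H i i1 i2 ⟨e, hf⟩
    rw [h.innerTail_backward i2 hf] at e
    rcases H with ⟨H1, H2⟩ | ⟨H1, H2⟩
    · rw [H1, h.vtx_of_le h.sum_pos] at e
      have := h.vtx_last
      by_cases hi : i = k.sum
      · subst hi; omega
      · rw [h.vtx_of_le (by omega)] at e
        omega
    · rw [h.vtx_inj (by omega) (by omega) H1 h2] at e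
      rw [← e] at H2
      exact hf H2

end Edges

section Boxes

theorem forward_iff_of_isBox (h : LegShape k n) {a : ℕ × ℕ} (ha : h.arcs.IsBox a) {t : ℕ}
    (h1 : lo a ≤ t) (h2 : t < hi a) : IsForward k t ↔ Fwd k a := by
  have h3 : hi a ≤ k.sum + 1 := ha.hi_le
  have e : min (lo a) k.sum = lo a := by omega
  rw [Fwd, e]
  induction t, h1 using Nat.le_induction with
  | base => rfl
  | succ t ht ih =>
    refine Iff.trans ?_ (ih (by omega))
    have := ha.inner (t + 1)
    by_contra hc
    exact this (Or.inr (Or.inr fun h => hc h.symm)) ⟨by omega, h2⟩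

/-- An arc that stays on one leg is a box if its end edges exist. -/
theorem isBox_iff (h : LegShape k n) {a : ℕ × ℕ} (h1 : 1 ≤ lo a) (h2 : lo a ≤ hi a)
    (h3 : hi a ≤ k.sum + 1) (hf : ∀ t, lo a ≤ t → t < hi a → (IsForward k t ↔ Fwd k a)) :
    h.arcs.IsBox a ↔
      h.lowEdge a ∈ (legDAG k n).edges ∧ h.upEdge a ∈ (legDAG k n).edges := by
  -- Constant direction along the arc already excludes interior leg ends, so only the conditions at
  -- the two ends remain.
  have key : h.arcs.IsBox a ↔ (a.1 % 2 = 1 → h.arcs.Bd (lo a)) ∧ (a.2 % 2 = 1 → h.arcs.Bd (hi a)) ∧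
      (lo a = hi a → (n = k.sum + 1 ∧ lo a = 1 ∧ a.2 = 2) ∨
        (n = k.sum + 1 ∧ lo a = k.sum + 1 ∧ a.1 = 2 * (k.sum + 1)) ∨ ¬ h.arcs.Bd (lo a)) := by
    refine ⟨fun H => ⟨H.bd_lo, H.bd_hi, H.triv⟩, fun H => ⟨h1, h2, h3, fun p hp hlt => ?_, H.1,
      H.2.1, H.2.2⟩⟩
    have e1 := hf p hlt.1.le hlt.2
    have e2 := hf (p - 1) (by omega) (by omega)
    rcases hp with hp | hp | hp
    · omega
    · omega
    · exact hp (e2.trans e1.symm)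
  rw [key]
  have m1 := h.src_one_mem h1 (h2.trans h3)
  have m2 := h.src_two_mem h1 (h2.trans h3)
  have m3 := h.snk_one_mem h1 (h2.trans h3)
  have m4 := h.snk_two_mem h1 (h2.trans h3)
  have m5 := h.src_one_mem (h1.trans h2) h3
  have m6 := h.src_two_mem (h1.trans h2) h3
  have m7 := h.snk_one_mem (h1.trans h2) h3
  have m8 := h.snk_two_mem (h1.trans h2) h3
  have hn := h.n_eq
  have hK := h.sum_pos
  have hc := h.cycle
  have f1 := h.forward_one
  have a1 : (if a.1 % 2 = 0 then 1 else 2) = 1 ∧ a.1 % 2 = 0 ∨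
      (if a.1 % 2 = 0 then 1 else 2) = 2 ∧ a.1 % 2 = 1 := by split_ifs <;> omega
  have a2 : (if a.1 % 2 = 0 then 2 else 1) = 2 ∧ a.1 % 2 = 0 ∨
      (if a.1 % 2 = 0 then 2 else 1) = 1 ∧ a.1 % 2 = 1 := by split_ifs <;> omega
  have a3 : (if a.2 % 2 = 0 then 1 else 2) = 1 ∧ a.2 % 2 = 0 ∨
      (if a.2 % 2 = 0 then 1 else 2) = 2 ∧ a.2 % 2 = 1 := by split_ifs <;> omega
  have a4 : (if a.2 % 2 = 0 then 2 else 1) = 2 ∧ a.2 % 2 = 0 ∨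
      (if a.2 % 2 = 0 then 2 else 1) = 1 ∧ a.2 % 2 = 1 := by split_ifs <;> omega
  have hb : ∀ p, h.arcs.Bd p ↔ p = 1 ∨ p = k.sum + 1 ∨ ¬ (IsForward k (p - 1) ↔ IsForward k p) :=
    fun _ => Iff.rfl
  rw [hb, hb, lowEdge, upEdge]
  have e0 : min (lo a) k.sum = k.sum ∧ lo a = k.sum + 1 ∨ min (lo a) k.sum = lo a ∧ lo a ≤ k.sum := by
    omega
  have hF : Fwd k a ↔ IsForward k (min (lo a) k.sum) := Iff.rfl
  rcases h2.lt_or_eq with hlt | heq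
  · have e1 := hf (lo a) le_rfl hlt
    have e2 := hf (hi a - 1) (by omega) (by omega)
    clear hf key hb
    by_cases hF : Fwd k a
    · simp only [hF, if_true]
      grind
    · simp only [hF, if_false]
      grind
  · clear hf key hb
    have l1 : lo a = (a.1 + 1) / 2 := rfl
    have l2 : lo a = a.2 / 2 := heq
    clear m5 m6 m7 m8
    rw [← heq]
    by_cases hF : Fwd k a
    · simp only [hF, if_true]
      grind
    · simp only [hF, if_false]
      grind

end Boxes

end LegShape
end PullDKK

/-! ### The bijection between routes and arcs. -/

namespace PullDKK

namespace LegShape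

variable {k : List ℕ} {n : ℕ}

section Ascending

open Classical in
/-- The edge of an arc that joins `s` to `s + 1`, or the end edge below or above. -/
noncomputable def slot (h : LegShape k n) (a : ℕ × ℕ) (s : ℕ) : Edge :=
  if s < lo a then h.lowEdge a else if s < hi a then .inner s else h.upEdge a

theorem slot_low (h : LegShape k n) {a : ℕ × ℕ} {s : ℕ} (hs : s < lo a) :
    h.slot a s = h.lowEdge a := if_pos hs

theorem slot_inner (h : LegShape k n) {a : ℕ × ℕ} {s : ℕ} (h1 : lo a ≤ s) (h2 : s < hi a) :
    h.slot a s = .inner s := by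
  rw [slot, if_neg (by omega), if_pos h2]

theorem slot_up (h : LegShape k n) {a : ℕ × ℕ} {s : ℕ} (h1 : lo a ≤ s) (h2 : hi a ≤ s) :
    h.slot a s = h.upEdge a := by
  rw [slot, if_neg (by omega), if_neg (by omega)]

/-- A uniform indexing: `slot a (p - 1)` and `slot a p` are the edges below and above position `p`.
It starts at `lo a - 1` so that both end edges are included. -/
theorem ascending_eq (h : LegShape k n) {a : ℕ × ℕ} (h1 : 1 ≤ lo a) (h2 : lo a ≤ hi a) :
    h.ascending a = (List.range' (lo a - 1) (hi a - lo a + 2)).map (h.slot a) := by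
  rw [List.range'_succ, List.map_cons, h.slot_low (by omega), ascending, Nat.sub_add_cancel h1,
    List.range'_1_concat, List.map_append]
  congr 2
  · apply List.map_congr_left
    intro s hs
    rw [List.mem_range'_1] at hs
    rw [h.slot_inner hs.1 (by omega)]
  · rw [List.map_singleton, h.slot_up (by omega) (by omega)]

theorem mem_route (h : LegShape k n) {a : ℕ × ℕ} {e : Edge} : e ∈ h.route a ↔
    e = h.lowEdge a ∨ (∃ s, lo a ≤ s ∧ s < hi a ∧ e = .inner s) ∨ e = h.upEdge a := by
  have : e ∈ h.route a ↔ e ∈ h.ascending a := by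
    rw [route]; split_ifs <;> simp
  rw [this, ascending, List.mem_cons, List.mem_append, List.mem_map, List.mem_singleton]
  refine or_congr_right (or_congr_left (exists_congr fun s => ?_))
  rw [List.mem_range'_1]
  constructor
  · rintro ⟨⟨h1, h2⟩, rfl⟩; exact ⟨h1, by omega, rfl⟩
  · rintro ⟨h1, h2, rfl⟩; exact ⟨⟨h1, by omega⟩, rfl⟩

theorem lowEdge_ne_inner (h : LegShape k n) (a : ℕ × ℕ) (s : ℕ) : h.lowEdge a ≠ .inner s := by
  rw [lowEdge]; split_ifs <;> simp

theorem upEdge_ne_inner (h : LegShape k n) (a : ℕ × ℕ) (s : ℕ) : h.upEdge a ≠ .inner s := by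
  rw [upEdge]; split_ifs <;> simp

theorem inner_mem_route (h : LegShape k n) {a : ℕ × ℕ} {s : ℕ} :
    .inner s ∈ h.route a ↔ lo a ≤ s ∧ s < hi a := by
  rw [mem_route]
  constructor
  · rintro (e | ⟨t, h1, h2, e⟩ | e)
    · exact absurd e.symm (h.lowEdge_ne_inner a s)
    · cases e; exact ⟨h1, h2⟩
    · exact absurd e.symm (h.upEdge_ne_inner a s)
  · exact fun e => Or.inr (Or.inl ⟨s, e.1, e.2, rfl⟩)

theorem head?_route (h : LegShape k n) (a : ℕ × ℕ) :
    (h.route a).head? = some (by classical exact if Fwd k a then h.lowEdge a else h.upEdge a) := by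
  rw [route, ascending]; split_ifs <;> simp

theorem getLast?_route (h : LegShape k n) (a : ℕ × ℕ) :
    (h.route a).getLast? =
      some (by classical exact if Fwd k a then h.upEdge a else h.lowEdge a) := by
  rw [route, ascending]; split_ifs <;> simp [List.getLast?_cons]

end Ascending

section Incidence

variable (h : LegShape k n) {a : ℕ × ℕ} (ha : h.arcs.IsBox a) {p : ℕ} (h1 : lo a ≤ p)
  (h2 : p ≤ hi a)
include ha h1 h2

theorem head_slot_pred (hF : Fwd k a) : (legDAG k n).head (h.slot a (p - 1)) = h.arcs.vtx p := by
  have h0 := ha.lo_pos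
  have h3 : hi a ≤ k.sum + 1 := ha.hi_le
  rcases h1.eq_or_lt with rfl | hlt
  · rw [h.slot_low (by omega), lowEdge, if_pos hF]; rfl
  · rw [h.slot_inner (by omega) (by omega)]
    have hf := (h.forward_iff_of_isBox ha (t := p - 1) (by omega) (by omega)).2 hF
    have := h.innerHead_forward (by omega) hf
    rwa [Nat.sub_add_cancel (by omega)] at this

theorem tail_slot (hF : Fwd k a) : (legDAG k n).tail (h.slot a p) = h.arcs.vtx p := by
  have h3 : hi a ≤ k.sum + 1 := ha.hi_le
  rcases h2.eq_or_lt with rfl | hlt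
  · rw [h.slot_up h1 le_rfl, upEdge, if_pos hF]; rfl
  · rw [h.slot_inner h1 hlt]
    have hf := (h.forward_iff_of_isBox ha h1 hlt).2 hF
    rw [h.vtx_of_le (by omega)]
    exact innerTail_forward hf

theorem tail_slot_pred (hF : ¬ Fwd k a) :
    (legDAG k n).tail (h.slot a (p - 1)) = h.arcs.vtx p := by
  have h0 := ha.lo_pos
  have h3 : hi a ≤ k.sum + 1 := ha.hi_le
  rcases h1.eq_or_lt with rfl | hlt
  · rw [h.slot_low (by omega), lowEdge, if_neg hF]; rfl
  · rw [h.slot_inner (by omega) (by omega)]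
    have hf := mt (h.forward_iff_of_isBox ha (t := p - 1) (by omega) (by omega)).1 hF
    have := h.innerTail_backward (by omega) hf
    rwa [Nat.sub_add_cancel (by omega)] at this

theorem head_slot (hF : ¬ Fwd k a) : (legDAG k n).head (h.slot a p) = h.arcs.vtx p := by
  have h3 : hi a ≤ k.sum + 1 := ha.hi_le
  rcases h2.eq_or_lt with rfl | hlt
  · rw [h.slot_up h1 le_rfl, upEdge, if_neg hF]; rfl
  · rw [h.slot_inner h1 hlt]
    have hf := mt (h.forward_iff_of_isBox ha h1 hlt).1 hF
    rw [h.vtx_of_le (by omega)]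
    exact innerHead_backward hf

open Classical in
theorem label_slot_pred : (legDAG k n).label (h.slot a (p - 1)) =
    if (Fwd k a ↔ a.1 = 2 * p) then 1 else 2 := by
  have h0 := ha.lo_pos
  rcases h1.eq_or_lt with rfl | hlt
  · have e : a.1 % 2 = 0 ↔ a.1 = 2 * lo a := by simp only [lo]; omega
    rw [h.slot_low (by omega), lowEdge]
    by_cases hF : Fwd k a <;> by_cases he : a.1 % 2 = 0 <;> simp [hF, he, ← e, legDAG]
  · have e : ¬ a.1 = 2 * p := by simp only [lo] at hlt; omega
    have hf := h.forward_iff_of_isBox ha (t := p - 1) (by omega) (by omega)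
    rw [h.slot_inner (by omega) (by omega)]
    by_cases hF : Fwd k a <;> simp [hF, e, legDAG, innerLabel, hf]

open Classical in
theorem label_slot : (legDAG k n).label (h.slot a p) =
    if (Fwd k a ↔ a.2 = 2 * p) then 1 else 2 := by
  rcases h2.eq_or_lt with rfl | hlt
  · have e : a.2 % 2 = 0 ↔ a.2 = 2 * hi a := by simp only [hi]; omega
    rw [h.slot_up h1 le_rfl, upEdge]
    by_cases hF : Fwd k a <;> by_cases he : a.2 % 2 = 0 <;> simp [hF, he, ← e, legDAG]
  · have e : ¬ a.2 = 2 * p := by simp only [hi] at hlt; omega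
    have hf := h.forward_iff_of_isBox ha h1 hlt
    rw [h.slot_inner h1 hlt]
    by_cases hF : Fwd k a <;> simp [hF, e, legDAG, innerLabel, hf]

end Incidence

theorem isRoute_route (h : LegShape k n) {a : ℕ × ℕ} (ha : h.arcs.IsBox a) :
    (legDAG k n).IsRoute (h.route a) := by
  have h1 := ha.lo_pos
  have h2 := ha.lo_le
  have h3 : hi a ≤ k.sum + 1 := ha.hi_le
  obtain ⟨e1, e2⟩ := (h.isBox_iff h1 h2 h3 fun t => h.forward_iff_of_isBox ha).1 ha
  refine ⟨fun e he => ?_, ?_, ?_, ?_⟩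
  · rw [mem_route] at he
    rcases he with rfl | ⟨s, s1, s2, rfl⟩ | rfl
    · exact e1
    · exact mem_edges_inner.2 ⟨by omega, by omega⟩
    · exact e2
  · refine ⟨_, h.head?_route a, ?_⟩
    split_ifs with hF
    · rw [lowEdge, if_pos hF]; rfl
    · rw [upEdge, if_neg hF]; rfl
  · refine ⟨_, h.getLast?_route a, ?_⟩
    split_ifs with hF
    · rw [upEdge, if_pos hF]; rfl
    · rw [lowEdge, if_neg hF]; rfl
  · rw [route, h.ascending_eq h1 h2]
    split_ifs with hF
    · rw [List.isChain_iff_getElem]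
      intro i hi'
      simp only [List.length_map, List.length_range'] at hi'
      simp only [List.getElem_map, List.getElem_range', one_mul]
      have := h.head_slot_pred ha (p := lo a + i) (by omega) (by omega) hF
      rw [show lo a - 1 + (i + 1) = lo a + i by omega, h.tail_slot ha (by omega) (by omega) hF,
        ← this]
      congr 2
      omega
    · rw [List.isChain_reverse, List.isChain_iff_getElem]
      intro i hi'
      simp only [List.length_map, List.length_range'] at hi'
      simp only [List.getElem_map, List.getElem_range', one_mul]
      have := h.tail_slot_pred ha (p := lo a + i) (by omega) (by omega) hF
      rw [show lo a - 1 + (i + 1) = lo a + i by omega, h.head_slot ha (by omega) (by omega) hF,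
        ← this]
      congr 2
      omega

/-- The direction is read off from any inner edge. For a single-vertex arc it is read off from the
vertex. Then the end edges determine both codes. -/
theorem route_injOn (h : LegShape k n) {a b : ℕ × ℕ} (ha : h.arcs.IsBox a) (hb : h.arcs.IsBox b)
    (hab : h.route a = h.route b) : a = b := by
  have hd : Fwd k a ↔ Fwd k b := by
    rcases ha.lo_le.lt_or_eq with hlt | heq
    · have hm : .inner (lo a) ∈ h.route a := h.inner_mem_route.2 ⟨le_rfl, hlt⟩
      have hm' := h.inner_mem_route.1 (hab ▸ hm)
      exact (h.forward_iff_of_isBox ha le_rfl hlt).symm.trans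
        (h.forward_iff_of_isBox hb hm'.1 hm'.2)
    · have heq' : lo b = hi b := by
        by_contra hne
        have hlt := lt_of_le_of_ne hb.lo_le hne
        have hm : .inner (lo b) ∈ h.route b := h.inner_mem_route.2 ⟨le_rfl, hlt⟩
        have hm' := h.inner_mem_route.1 (hab ▸ hm)
        omega
      have e1 := h.head?_route a
      have e2 := h.head?_route b
      rw [hab, e2, Option.some_inj] at e1
      have hv : h.arcs.vtx (lo b) = h.arcs.vtx (lo a) := by
        simp only [lowEdge, upEdge, ← heq, ← heq'] at e1
        split_ifs at e1 <;> exact (Edge.src.inj e1).1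
      rw [LegData.vtx_lo_eq_iff hb ha] at hv
      rw [Fwd, Fwd, hv]
  have e1 := h.head?_route a
  have e2 := h.head?_route b
  have e3 := h.getLast?_route a
  have e4 := h.getLast?_route b
  rw [hab, e2, Option.some_inj] at e1
  rw [hab, e4, Option.some_inj] at e3
  by_cases hF : Fwd k a
  · have hF' := hd.1 hF
    simp only [hF, hF', if_true, lowEdge, upEdge, Edge.src.injEq, Edge.snk.injEq] at e1 e3
    refine LegData.eq_of_ends ((LegData.vtx_lo_eq_iff ha hb).1 e1.1.symm)
      ((LegData.vtx_hi_eq_iff ha hb).1 e3.1.symm) ?_ ?_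
    · have := e1.2; split_ifs at this <;> omega
    · have := e3.2; split_ifs at this <;> omega
  · have hF' := mt hd.2 hF
    simp only [hF, hF', if_false, lowEdge, upEdge, Edge.src.injEq, Edge.snk.injEq] at e1 e3
    refine LegData.eq_of_ends ((LegData.vtx_lo_eq_iff ha hb).1 e3.1.symm)
      ((LegData.vtx_hi_eq_iff ha hb).1 e1.1.symm) ?_ ?_
    · have := e3.2; split_ifs at this <;> omega
    · have := e1.2; split_ifs at this <;> omega

section Classification

theorem tail_pos (h : LegShape k n) {e : Edge} (he : e ∈ (legDAG k n).edges) :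
    (legDAG k n).tail e = 0 ↔ ∃ v l, e = .src v l := by
  cases e with
  | inner i =>
    have : (legDAG k n).tail (.inner i) ≠ 0 := by
      change innerTail k n i ≠ 0
      have hi := mem_edges_inner.1 he
      by_cases hf : IsForward k i
      · rw [innerTail_forward hf]; omega
      · rw [h.innerTail_backward hi.2 hf]
        have := (h.vtx_mem (p := i + 1) (by omega)).1
        omega
    simp [this]
  | src v l => simp [legDAG]
  | snk v l =>
    have : (legDAG k n).tail (.snk v l) ≠ 0 := by
      have := (mem_edges_snk.1 he).1.1
      change v ≠ 0
      omega
    simp [this]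

theorem tail_le (h : LegShape k n) {e : Edge} (he : e ∈ (legDAG k n).edges) :
    (legDAG k n).tail e ≤ n := by
  cases e with
  | inner i =>
    change innerTail k n i ≤ n
    have hi := mem_edges_inner.1 he
    have := h.n_eq
    by_cases hf : IsForward k i
    · rw [innerTail_forward hf]; omega
    · rw [h.innerTail_backward hi.2 hf]
      exact (h.vtx_mem (p := i + 1) (by omega)).2
  | src v l => exact Nat.zero_le _
  | snk v l => exact (mem_edges_snk.1 he).1.2

theorem head_inner_mem (h : LegShape k n) {i : ℕ} (h1 : 1 ≤ i) (h2 : i ≤ k.sum) :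
    1 ≤ (legDAG k n).head (.inner i) ∧ (legDAG k n).head (.inner i) ≤ n := by
  have := h.n_eq
  change 1 ≤ innerHead k n i ∧ innerHead k n i ≤ n
  by_cases hf : IsForward k i
  · rw [h.innerHead_forward h2 hf]
    exact h.vtx_mem (by omega)
  · rw [innerHead_backward hf]; omega

theorem nil_of_snk (h : LegShape k n) {v l : ℕ} {R : List Edge}
    (hR : ∀ e ∈ R, e ∈ (legDAG k n).edges)
    (hc : (Edge.snk v l :: R).IsChain fun e f => (legDAG k n).head e = (legDAG k n).tail f) :
    R = [] := by
  cases R with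
  | nil => rfl
  | cons e R =>
    rw [List.isChain_cons_cons] at hc
    have h1 := h.tail_le (hR e (by simp))
    have h2 : n + 1 = (legDAG k n).tail e := hc.1
    omega

/-- After a forward inner edge a route can only take the next inner edge, again forward, or leave to
the sink. -/
theorem forward_tail (h : LegShape k n) (R : List Edge) : ∀ p, 1 ≤ p → p ≤ k.sum →
    IsForward k p → (∀ e ∈ R, e ∈ (legDAG k n).edges) →
    ((Edge.inner p :: R).IsChain fun e f => (legDAG k n).head e = (legDAG k n).tail f) →
    (∃ e, (Edge.inner p :: R).getLast? = some e ∧ (legDAG k n).head e = n + 1) →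
    ∃ q l, p < q ∧ q ≤ k.sum + 1 ∧ (∀ t, p ≤ t → t < q → IsForward k t) ∧
      Edge.snk (h.arcs.vtx q) l ∈ (legDAG k n).edges ∧
      R = (List.range' (p + 1) (q - (p + 1))).map Edge.inner ++ [.snk (h.arcs.vtx q) l] := by
  induction R with
  | nil =>
    rintro p h1 h2 - - - ⟨e, he, he'⟩
    simp only [List.getLast?_singleton, Option.some_inj] at he
    have := h.head_inner_mem h1 h2
    rw [he, he'] at this
    omega
  | cons e R ih =>
    intro p h1 h2 hf hR hc hl
    rw [List.isChain_cons_cons] at hc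
    have he := hR e (by simp)
    have ht : h.arcs.vtx (p + 1) = (legDAG k n).tail e := by
      rw [← hc.1]; exact (h.innerHead_forward h2 hf).symm
    have hv := h.vtx_mem (p := p + 1) (by omega)
    cases e with
    | src v l =>
      have : h.arcs.vtx (p + 1) = 0 := ht
      omega
    | snk v l =>
      have hv : h.arcs.vtx (p + 1) = v := ht
      have hnil := h.nil_of_snk (fun x hx => hR x (by simp [hx])) hc.2
      refine ⟨p + 1, l, by omega, by omega, ?_, hv ▸ he, ?_⟩
      · intro t t1 t2
        have : t = p := by omega
        exact this ▸ hf
      · simp [hnil, hv]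
    | inner j =>
      obtain ⟨j1, j2⟩ := mem_edges_inner.1 he
      have ht' : h.arcs.vtx (p + 1) = innerTail k n j := ht
      have hn := h.n_eq
      have hj : j = p + 1 ∧ IsForward k j := by
        by_cases hfj : IsForward k j
        · refine ⟨?_, hfj⟩
          rw [innerTail_forward hfj] at ht'
          by_cases hp : p = k.sum
          · rcases h.vtx_last with ⟨hl, -⟩ | ⟨-, hn⟩
            · rw [← hp, ht'] at hl; omega
            · exact absurd (hp ▸ hf) (h.cycle hn).2
          · rw [← ht', h.vtx_of_le (by omega)]
        · rw [h.innerTail_backward j2 hfj, h.vtx_inj (by omega) (by omega) (by omega) (by omega)]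
            at ht'
          have : p = j := by omega
          exact absurd (this ▸ hf) hfj
      obtain ⟨rfl, hfj⟩ := hj
      obtain ⟨q, l, q1, q2, q3, q4, q5⟩ := ih (p + 1) j1 j2 hfj (fun x hx => hR x (by simp [hx]))
        hc.2 (by simpa [List.getLast?_cons] using hl)
      refine ⟨q, l, by omega, q2, fun t t1 t2 => ?_, q4, ?_⟩
      · rcases t1.eq_or_lt with rfl | t1
        · exact hf
        · exact q3 t t1 t2
      · rw [q5, show q - (p + 1) = q - (p + 1 + 1) + 1 by omega, List.range'_succ]
        rfl

theorem backward_tail (h : LegShape k n) (R : List Edge) : ∀ p, 1 ≤ p → p ≤ k.sum →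
    ¬ IsForward k p → (∀ e ∈ R, e ∈ (legDAG k n).edges) →
    ((Edge.inner p :: R).IsChain fun e f => (legDAG k n).head e = (legDAG k n).tail f) →
    (∃ e, (Edge.inner p :: R).getLast? = some e ∧ (legDAG k n).head e = n + 1) →
    ∃ q l, 1 ≤ q ∧ q ≤ p ∧ (∀ t, q ≤ t → t ≤ p → ¬ IsForward k t) ∧
      Edge.snk (h.arcs.vtx q) l ∈ (legDAG k n).edges ∧
      R = ((List.range' q (p - q)).map Edge.inner).reverse ++ [.snk (h.arcs.vtx q) l] := by
  induction R with
  | nil =>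
    rintro p h1 h2 - - - ⟨e, he, he'⟩
    simp only [List.getLast?_singleton, Option.some_inj] at he
    have := h.head_inner_mem h1 h2
    rw [he, he'] at this
    omega
  | cons e R ih =>
    intro p h1 h2 hf hR hc hl
    rw [List.isChain_cons_cons] at hc
    have he := hR e (by simp)
    have ht : p = (legDAG k n).tail e := by
      rw [← hc.1]; exact (innerHead_backward hf).symm
    cases e with
    | src v l =>
      have : p = 0 := ht
      omega
    | snk v l =>
      have hv : p = v := ht
      have hv' := h.vtx_of_le h2
      have hnil := h.nil_of_snk (fun x hx => hR x (by simp [hx])) hc.2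
      refine ⟨p, l, h1, le_rfl, ?_, ?_, ?_⟩
      · intro t t1 t2
        have : t = p := by omega
        exact this ▸ hf
      · rw [hv', hv]; exact he
      · rw [hnil, hv', hv]; simp
    | inner j =>
      obtain ⟨j1, j2⟩ := mem_edges_inner.1 he
      have ht' : p = innerTail k n j := ht
      have hn := h.n_eq
      have hj : j + 1 = p ∧ ¬ IsForward k j := by
        by_cases hfj : IsForward k j
        · rw [innerTail_forward hfj] at ht'
          exact absurd (ht' ▸ hfj) hf
        · refine ⟨?_, hfj⟩
          rw [h.innerTail_backward j2 hfj] at ht'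
          by_cases hj : j = k.sum
          · rw [hj] at ht'
            rcases h.vtx_last with ⟨hl, -⟩ | ⟨hl, -⟩
            · omega
            · rw [hl] at ht'
              exact absurd (ht' ▸ h.forward_one) hf
          · rw [h.vtx_of_le (by omega)] at ht'
            exact ht'.symm
      obtain ⟨rfl, hfj⟩ := hj
      obtain ⟨q, l, q1, q2, q3, q4, q5⟩ := ih j j1 j2 hfj (fun x hx => hR x (by simp [hx]))
        hc.2 (by simpa [List.getLast?_cons] using hl)
      refine ⟨q, l, q1, by omega, fun t t1 t2 => ?_, q4, ?_⟩
      · rcases t2.eq_or_lt with rfl | t2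
        · exact hf
        · exact q3 t t1 (by omega)
      · rw [q5, show j + 1 - q = j - q + 1 by omega, List.range'_1_concat]
        simp [show q + (j - q) = j by omega]

theorem exists_route_forward (h : LegShape k n) {p q l m : ℕ} (h1 : 1 ≤ p) (h2 : p ≤ q)
    (h3 : q ≤ k.sum + 1) (hd : IsForward k (min p k.sum))
    (hf : ∀ t, p ≤ t → t < q → IsForward k t)
    (hs : Edge.src (h.arcs.vtx p) l ∈ (legDAG k n).edges)
    (hs' : Edge.snk (h.arcs.vtx q) m ∈ (legDAG k n).edges) :
    ∃ a, h.arcs.IsBox a ∧ h.route a = Edge.src (h.arcs.vtx p) l ::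
      ((List.range' p (q - p)).map Edge.inner ++ [.snk (h.arcs.vtx q) m]) := by
  have hl := (mem_edges_src.1 hs).2.1
  have hm := (mem_edges_snk.1 hs').2.1
  obtain ⟨α, a1, a2⟩ : ∃ α, (α + 1) / 2 = p ∧ (if α % 2 = 0 then 1 else 2) = l := by
    rcases hl with rfl | rfl
    · exact ⟨2 * p, by omega, if_pos (by omega)⟩
    · exact ⟨2 * p - 1, by omega, if_neg (by omega)⟩
  obtain ⟨β, b1, b2⟩ : ∃ β, β / 2 = q ∧ (if β % 2 = 0 then 1 else 2) = m := by
    rcases hm with rfl | rfl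
    · exact ⟨2 * q, by omega, if_pos (by omega)⟩
    · exact ⟨2 * q + 1, by omega, if_neg (by omega)⟩
  have e1 : lo (α, β) = p := a1
  have e2 : hi (α, β) = q := b1
  have hF : Fwd k (α, β) := by rw [Fwd, e1]; exact hd
  have el : h.lowEdge (α, β) = Edge.src (h.arcs.vtx p) l := by
    rw [lowEdge, if_pos hF, e1, a2]
  have eu : h.upEdge (α, β) = Edge.snk (h.arcs.vtx q) m := by
    rw [upEdge, if_pos hF, e2, b2]
  refine ⟨(α, β), (h.isBox_iff ?_ ?_ ?_ ?_).2 ⟨?_, ?_⟩, ?_⟩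
  · rwa [e1]
  · rwa [e1, e2]
  · rwa [e2]
  · rw [e1, e2]; exact fun t t1 t2 => iff_of_true (hf t t1 t2) hF
  · rwa [el]
  · rwa [eu]
  · rw [route, if_pos hF, ascending, el, eu, e1, e2]

theorem exists_route_backward (h : LegShape k n) {p q l m : ℕ} (h1 : 1 ≤ p) (h2 : p ≤ q)
    (h3 : q ≤ k.sum + 1) (hd : ¬ IsForward k (min p k.sum))
    (hf : ∀ t, p ≤ t → t < q → ¬ IsForward k t)
    (hs : Edge.src (h.arcs.vtx q) l ∈ (legDAG k n).edges)
    (hs' : Edge.snk (h.arcs.vtx p) m ∈ (legDAG k n).edges) :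
    ∃ a, h.arcs.IsBox a ∧ h.route a = Edge.src (h.arcs.vtx q) l ::
      (((List.range' p (q - p)).map Edge.inner).reverse ++ [.snk (h.arcs.vtx p) m]) := by
  have hl := (mem_edges_src.1 hs).2.1
  have hm := (mem_edges_snk.1 hs').2.1
  obtain ⟨α, a1, a2⟩ : ∃ α, (α + 1) / 2 = p ∧ (if α % 2 = 0 then 2 else 1) = m := by
    rcases hm with rfl | rfl
    · exact ⟨2 * p - 1, by omega, if_neg (by omega)⟩
    · exact ⟨2 * p, by omega, if_pos (by omega)⟩
  obtain ⟨β, b1, b2⟩ : ∃ β, β / 2 = q ∧ (if β % 2 = 0 then 2 else 1) = l := by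
    rcases hl with rfl | rfl
    · exact ⟨2 * q + 1, by omega, if_neg (by omega)⟩
    · exact ⟨2 * q, by omega, if_pos (by omega)⟩
  have e1 : lo (α, β) = p := a1
  have e2 : hi (α, β) = q := b1
  have hF : ¬ Fwd k (α, β) := by rw [Fwd, e1]; exact hd
  have el : h.lowEdge (α, β) = Edge.snk (h.arcs.vtx p) m := by
    rw [lowEdge, if_neg hF, e1, a2]
  have eu : h.upEdge (α, β) = Edge.src (h.arcs.vtx q) l := by
    rw [upEdge, if_neg hF, e2, b2]
  refine ⟨(α, β), (h.isBox_iff ?_ ?_ ?_ ?_).2 ⟨?_, ?_⟩, ?_⟩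
  · rwa [e1]
  · rwa [e1, e2]
  · rwa [e2]
  · rw [e1, e2]; exact fun t t1 t2 => iff_of_false (hf t t1 t2) hF
  · rwa [el]
  · rwa [eu]
  · rw [route, if_neg hF, ascending, el, eu, e1, e2]
    simp

/-- Every route is the route of an arc. -/
theorem exists_arc (h : LegShape k n) {R : List Edge} (hR : (legDAG k n).IsRoute R) :
    ∃ a, h.arcs.IsBox a ∧ h.route a = R := by
  obtain ⟨hE, ⟨e, he, he0⟩, hl, hc⟩ := hR
  cases R with
  | nil => simp at he
  | cons e' R =>
    simp only [List.head?_cons, Option.some_inj] at he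
    subst he
    obtain ⟨v, l, rfl⟩ := (h.tail_pos (hE _ (by simp))).1 he0
    have hs := hE _ (List.mem_cons_self)
    have hv := (mem_edges_src.1 hs).1
    cases R with
    | nil =>
      obtain ⟨e, h1, h2⟩ := hl
      simp only [List.getLast?_singleton, Option.some_inj] at h1
      subst h1
      have : v = n + 1 := h2
      omega
    | cons e R =>
      rw [List.isChain_cons_cons] at hc
      have he := hE e (by simp)
      have ht : v = (legDAG k n).tail e := hc.1
      have hE' : ∀ x ∈ R, x ∈ (legDAG k n).edges := fun x hx => hE x (by simp [hx])
      have hl' : ∃ x, (e :: R).getLast? = some x ∧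
          (legDAG k n).head x = (legDAG k n).n + 1 := by
        simpa [List.getLast?_cons] using hl
      have hn := h.n_eq
      cases e with
      | src w m =>
        have : v = 0 := ht
        omega
      | snk w m =>
        obtain rfl : v = w := ht
        obtain rfl := h.nil_of_snk hE' hc.2
        have hvv : h.arcs.vtx v = v := by rw [vtx_def, if_pos hv.2]
        rw [← hvv] at hs he ⊢
        -- A single-vertex route has no inner edge; its direction is the one that `Fwd` assigns to
        -- its position.
        by_cases hd : IsForward k (min v k.sum)
        · obtain ⟨a, ha, e⟩ := h.exists_route_forward hv.1 le_rfl (by omega) hd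
            (fun t t1 t2 => by omega) hs he
          exact ⟨a, ha, by rw [e]; simp⟩
        · obtain ⟨a, ha, e⟩ := h.exists_route_backward hv.1 le_rfl (by omega) hd
            (fun t t1 t2 => by omega) hs he
          exact ⟨a, ha, by rw [e]; simp⟩
      | inner j =>
        obtain ⟨j1, j2⟩ := mem_edges_inner.1 he
        by_cases hfj : IsForward k j
        · obtain ⟨q, m, q1, q2, q3, q4, q5⟩ := h.forward_tail R j j1 j2 hfj hE' hc.2 hl'
          have hvj : v = h.arcs.vtx j := by
            rw [ht, h.vtx_of_le j2]; exact innerTail_forward hfj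
          rw [hvj] at hs ⊢
          obtain ⟨a, ha, e⟩ := h.exists_route_forward j1 q1.le q2
            (by rwa [min_eq_left j2]) q3 hs q4
          refine ⟨a, ha, ?_⟩
          rw [e, q5, show q - j = q - (j + 1) + 1 by omega, List.range'_succ]
          rfl
        · obtain ⟨q, m, q1, q2, q3, q4, q5⟩ := h.backward_tail R j j1 j2 hfj hE' hc.2 hl'
          have hvj : v = h.arcs.vtx (j + 1) := by
            rw [ht]; exact h.innerTail_backward j2 hfj
          rw [hvj] at hs ⊢
          obtain ⟨a, ha, e⟩ := h.exists_route_backward q1 (by omega : q ≤ j + 1) (by omega)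
            (by rw [min_eq_left (by omega)]; exact q3 q le_rfl q2)
            (fun t t1 t2 => q3 t t1 (by omega)) hs q4
          refine ⟨a, ha, ?_⟩
          rw [e, q5, show j + 1 - q = j - q + 1 by omega, List.range'_1_concat]
          simp [show q + (j - q) = j by omega]

end Classification

end LegShape
end PullDKK

/-! ### Conflicts, vectors and exceptional routes in terms of codes. -/

namespace PullDKK

theorem exists_of_map_range'_eq {α : Type*} {F : ℕ → α} {s N : ℕ} {A M A' : List α} {e e' : α}
    (h : (List.range' s N).map F = A ++ e :: (M ++ e' :: A')) :
    ∃ u w, s ≤ u ∧ u < w ∧ w < s + N ∧ e = F u ∧ e' = F w ∧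
      M = (List.range' (u + 1) (w - (u + 1))).map F := by
  have hlen := congrArg List.length h
  simp only [List.length_map, List.length_range', List.length_append, List.length_cons] at hlen
  have hget : ∀ i, i < N → (A ++ e :: (M ++ e' :: A'))[i]? = some (F (s + i)) := by
    intro i hi
    rw [← h]
    simp [hi]
  refine ⟨s + A.length, s + A.length + 1 + M.length, by omega, by omega, by omega, ?_, ?_, ?_⟩
  · have := hget A.length (by omega)
    simpa using this
  · have := hget (A.length + (1 + M.length)) (by omega)
    rw [List.getElem?_append_right (by omega)] at this
    simp only [Nat.add_sub_cancel_left, Nat.add_comm 1, List.getElem?_cons_succ] at this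
    rw [List.getElem?_append_right le_rfl] at this
    simp only [Nat.sub_self, List.getElem?_cons_zero, Option.some_inj] at this
    rw [this]
    congr 1
    omega
  · apply List.ext_getElem
    · simp
    · intro i h1 h2
      have := hget (A.length + (1 + i)) (by omega)
      rw [List.getElem?_append_right (by omega)] at this
      simp only [Nat.add_sub_cancel_left, Nat.add_comm 1, List.getElem?_cons_succ] at this
      rw [List.getElem?_append_left h1, List.getElem?_eq_getElem h1, Option.some_inj] at this
      rw [this]
      simp only [List.getElem_map, List.getElem_range', one_mul]
      congr 1
      omega

theorem map_range'_eq {α : Type*} (F : ℕ → α) {s N u w : ℕ} (h1 : s ≤ u) (h2 : u < w)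
    (h3 : w < s + N) : (List.range' s N).map F = (List.range' s (u - s)).map F ++
      F u :: ((List.range' (u + 1) (w - (u + 1))).map F ++
        F w :: (List.range' (w + 1) (s + N - (w + 1))).map F) := by
  have e1 : List.range' s N = List.range' s (u - s) ++ List.range' u (s + N - u) := by
    have := List.range'_append_1 (s := s) (m := u - s) (n := s + N - u)
    rw [show s + (u - s) = u by omega, show u - s + (s + N - u) = N by omega] at this
    exact this.symm
  have e2 : List.range' u (s + N - u) = u :: List.range' (u + 1) (s + N - (u + 1)) := by
    rw [show s + N - u = s + N - (u + 1) + 1 by omega, List.range'_succ]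
  have e3 : List.range' (u + 1) (s + N - (u + 1)) =
      List.range' (u + 1) (w - (u + 1)) ++ List.range' w (s + N - w) := by
    have := List.range'_append_1 (s := u + 1) (m := w - (u + 1)) (n := s + N - w)
    rw [show u + 1 + (w - (u + 1)) = w by omega,
      show w - (u + 1) + (s + N - w) = s + N - (u + 1) by omega] at this
    exact this.symm
  have e4 : List.range' w (s + N - w) = w :: List.range' (w + 1) (s + N - (w + 1)) := by
    rw [show s + N - w = s + N - (w + 1) + 1 by omega, List.range'_succ]
  rw [e1, e2, e3, e4]
  simp

/-- The common parts inside the two partial-route orders are absorbed into the common subroute. A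
conflict then amounts to a shared window with different entering and leaving edges whose labels are
ordered oppositely. -/
theorem FramedDAG.inConflict_iff {E : Type} (G : FramedDAG E) (R S : List E) :
    G.InConflict R S ↔ ∃ M e e' f f', (∃ A A', R = A ++ e :: (M ++ e' :: A')) ∧
      (∃ B B', S = B ++ f :: (M ++ f' :: B')) ∧ G.head e = G.head f ∧ G.tail e' = G.tail f' ∧
      ((G.label e < G.label f ∧ G.label f' < G.label e') ∨
        (G.label f < G.label e ∧ G.label e' < G.label f')) := by
  constructor
  · rintro ⟨C, R₁, R₂, S₁, S₂, rfl, rfl,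
      ⟨⟨A, B, D, a, b, rfl, rfl, h1, h2⟩, A', B', D', a', b', rfl, rfl, h3, h4⟩ |
      ⟨⟨A, B, D, a, b, rfl, rfl, h1, h2⟩, A', B', D', a', b', rfl, rfl, h3, h4⟩⟩
    · exact ⟨D ++ C ++ D', a, b', b, a', ⟨A, B', by simp⟩, ⟨B, A', by simp⟩, h1, h3.symm,
        Or.inl ⟨h2, h4⟩⟩
    · exact ⟨D ++ C ++ D', b, a', a, b', ⟨B, A', by simp⟩, ⟨A, B', by simp⟩, h1.symm, h3,
        Or.inr ⟨h2, h4⟩⟩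
  · rintro ⟨M, e, e', f, f', ⟨A, A', rfl⟩, ⟨B, B', rfl⟩, h1, h2, h3⟩
    refine ⟨M, A ++ [e], e' :: A', B ++ [f], f' :: B', by simp, by simp, ?_⟩
    rcases h3 with ⟨h3, h4⟩ | ⟨h3, h4⟩
    · exact Or.inl ⟨⟨A, B, [], e, f, rfl, rfl, h1, h3⟩, ⟨B', A', [], f', e', rfl, rfl, h2.symm, h4⟩⟩
    · exact Or.inr ⟨⟨B, A, [], f, e, rfl, rfl, h1.symm, h3⟩,
        ⟨A', B', [], e', f', rfl, rfl, h2, h4⟩⟩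

theorem FramedDAG.turns_iff {E : Type} (G : FramedDAG E) (R : List E) (v x y : ℕ) :
    G.Turns R v x y ↔ ∃ e e', (∃ A A', R = A ++ e :: ([] ++ e' :: A')) ∧ G.head e = v ∧
      G.label e = x ∧ G.label e' = y := by
  constructor
  · rintro ⟨e, f, ⟨A, A', rfl⟩, h⟩
    exact ⟨e, f, ⟨A, A', by simp⟩, h⟩
  · rintro ⟨e, f, ⟨A, A', rfl⟩, h⟩
    exact ⟨e, f, ⟨A, A', by simp⟩, h⟩

namespace LegShape

variable {k : List ℕ} {n : ℕ}

section Windows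

open Classical in
/-- The edge by which a route enters the part of its arc between `p` and `q`. -/
noncomputable def enter (h : LegShape k n) (a : ℕ × ℕ) (p q : ℕ) : Edge :=
  if Fwd k a then h.slot a (p - 1) else h.slot a q

open Classical in
/-- The edge by which a route leaves the part of its arc between `p` and `q`. -/
noncomputable def leave (h : LegShape k n) (a : ℕ × ℕ) (p q : ℕ) : Edge :=
  if Fwd k a then h.slot a q else h.slot a (p - 1)

open Classical in
/-- The part of a route between `p` and `q`. -/
noncomputable def between (k : List ℕ) (a : ℕ × ℕ) (p q : ℕ) : List Edge :=
  if Fwd k a then (List.range' p (q - p)).map .inner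
  else ((List.range' p (q - p)).map .inner).reverse

theorem inner_mem_between {a : ℕ × ℕ} {p q s : ℕ} :
    .inner s ∈ between k a p q ↔ p ≤ s ∧ s < q := by
  have : Edge.inner s ∈ between k a p q ↔ Edge.inner s ∈ (List.range' p (q - p)).map Edge.inner := by
    rw [between]; split_ifs <;> simp
  rw [this, List.mem_map]
  constructor
  · rintro ⟨t, ht, e⟩
    cases e
    rw [List.mem_range'_1] at ht
    omega
  · intro hs
    exact ⟨s, by rw [List.mem_range'_1]; omega, rfl⟩

theorem between_self (a : ℕ × ℕ) (p : ℕ) : between k a p p = [] := by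
  simp [between]

/-- Marking two edges of a route amounts to choosing the positions `p ≤ q` between them. On a
backward leg the ascending list is traversed in reverse, so the roles of the two edges are
exchanged. -/
theorem split_iff (h : LegShape k n) {a : ℕ × ℕ} (ha : h.arcs.IsBox a) {e e' : Edge}
    {M : List Edge} : (∃ A A', h.route a = A ++ e :: (M ++ e' :: A')) ↔
      ∃ p q, lo a ≤ p ∧ p ≤ q ∧ q ≤ hi a ∧ e = h.enter a p q ∧ e' = h.leave a p q ∧
        M = between k a p q := by
  have h1 := ha.lo_pos
  have h2 := ha.lo_le
  have hM : ∀ p q, lo a ≤ p → q ≤ hi a →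
      (List.range' p (q - p)).map (h.slot a) = (List.range' p (q - p)).map Edge.inner := by
    intro p q hp hq
    apply List.map_congr_left
    intro s hs
    rw [List.mem_range'_1] at hs
    exact h.slot_inner (by omega) (by omega)
  have key : ∀ e e' M, (∃ A A', h.ascending a = A ++ e :: (M ++ e' :: A')) ↔
      ∃ p q, lo a ≤ p ∧ p ≤ q ∧ q ≤ hi a ∧ e = h.slot a (p - 1) ∧ e' = h.slot a q ∧
        M = (List.range' p (q - p)).map .inner := by
    intro e e' M
    rw [h.ascending_eq h1 h2]
    constructor
    · rintro ⟨A, A', H⟩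
      obtain ⟨u, w, u1, u2, u3, u4, u5, u6⟩ := exists_of_map_range'_eq H
      refine ⟨u + 1, w, by omega, by omega, by omega, u4, u5, ?_⟩
      rw [u6, hM _ _ (by omega) (by omega)]
    · rintro ⟨p, q, p1, p2, p3, rfl, rfl, rfl⟩
      have := map_range'_eq (h.slot a) (s := lo a - 1) (N := hi a - lo a + 2) (u := p - 1) (w := q)
        (by omega) (by omega) (by omega)
      rw [show p - 1 + 1 = p by omega, hM p q p1 p3] at this
      exact ⟨_, _, this⟩
  by_cases hF : Fwd k a
  · simp only [route, enter, leave, between, if_pos hF]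
    exact key e e' M
  · simp only [route, enter, leave, between, if_neg hF]
    have := key e' e M.reverse
    constructor
    · rintro ⟨A, A', H⟩
      have H' := congrArg List.reverse H
      rw [List.reverse_reverse] at H'
      obtain ⟨p, q, p1, p2, p3, p4, p5, p6⟩ := this.1 ⟨A'.reverse, A.reverse, by rw [H']; simp⟩
      exact ⟨p, q, p1, p2, p3, p5, p4, by rw [← p6, List.reverse_reverse]⟩
    · rintro ⟨p, q, p1, p2, p3, p4, p5, p6⟩
      obtain ⟨A, A', H⟩ := this.2 ⟨p, q, p1, p2, p3, p5, p4, by rw [p6, List.reverse_reverse]⟩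
      exact ⟨A'.reverse, A.reverse, by rw [H]; simp⟩

variable (h : LegShape k n) {a : ℕ × ℕ} (ha : h.arcs.IsBox a) {p q : ℕ} (h1 : lo a ≤ p)
  (h2 : p ≤ q) (h3 : q ≤ hi a)
include ha h1 h2 h3

open Classical in
theorem head_enter : (legDAG k n).head (h.enter a p q) =
    if Fwd k a then h.arcs.vtx p else h.arcs.vtx q := by
  rw [enter]
  split_ifs with hF
  · exact h.head_slot_pred ha h1 (h2.trans h3) hF
  · exact h.head_slot ha (h1.trans h2) h3 hF

open Classical in
theorem tail_leave : (legDAG k n).tail (h.leave a p q) =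
    if Fwd k a then h.arcs.vtx q else h.arcs.vtx p := by
  rw [leave]
  split_ifs with hF
  · exact h.tail_slot ha (h1.trans h2) h3 hF
  · exact h.tail_slot_pred ha h1 (h2.trans h3) hF

open Classical in
theorem label_enter : (legDAG k n).label (h.enter a p q) =
    if Fwd k a then if a.1 = 2 * p then 1 else 2 else if a.2 = 2 * q then 2 else 1 := by
  rw [enter]
  by_cases hF : Fwd k a
  · rw [if_pos hF, if_pos hF, h.label_slot_pred ha h1 (h2.trans h3)]
    simp [hF]
  · rw [if_neg hF, if_neg hF, h.label_slot ha (h1.trans h2) h3]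
    by_cases e : a.2 = 2 * q <;> simp [hF, e]

open Classical in
theorem label_leave : (legDAG k n).label (h.leave a p q) =
    if Fwd k a then if a.2 = 2 * q then 1 else 2 else if a.1 = 2 * p then 2 else 1 := by
  rw [leave]
  by_cases hF : Fwd k a
  · rw [if_pos hF, if_pos hF, h.label_slot ha (h1.trans h2) h3]
    simp [hF]
  · rw [if_neg hF, if_neg hF, h.label_slot_pred ha h1 (h2.trans h3)]
    by_cases e : a.1 = 2 * p <;> simp [hF, e]

end Windows

section Turns

variable (h : LegShape k n) {a : ℕ × ℕ} (ha : h.arcs.IsBox a)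
include ha

/-- Two consecutive edges form a window with a single position. The label pair `1, 2` there says
that the lower code turns at this position and the upper one does not, whatever the direction. -/
theorem turns_one_two {v : ℕ} : (legDAG k n).Turns (h.route a) v 1 2 ↔ h.arcs.Neg a v := by
  have h1 := ha.lo_pos
  have h2 := ha.lo_le
  rw [FramedDAG.turns_iff]
  constructor
  · rintro ⟨e, e', hs, hv, he, he'⟩
    obtain ⟨p, q, p1, p2, p3, rfl, rfl, hb⟩ := (h.split_iff ha).1 hs
    have hpq : p = q := by
      by_contra hne
      have : Edge.inner p ∈ between k a p q := inner_mem_between.2 ⟨le_rfl, by omega⟩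
      rw [← hb] at this
      simp at this
    subst hpq
    rw [h.head_enter ha p1 p2 p3, ite_self] at hv
    rw [h.label_enter ha p1 p2 p3] at he
    rw [h.label_leave ha p1 p2 p3] at he'
    have : a.1 = 2 * p ∧ a.2 ≠ 2 * p := by
      split_ifs at he he' <;> omega
    have e : lo a = p := by simp only [lo]; omega
    exact ⟨by omega, by omega, by rw [e]; exact hv⟩
  · rintro ⟨n1, n2, n3⟩
    have e : a.1 = 2 * lo a := by simp only [lo]; omega
    have e' : a.2 ≠ 2 * lo a := by omega
    refine ⟨_, _, (h.split_iff ha).2 ⟨lo a, lo a, le_rfl, le_rfl, h2, rfl, rfl,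
      (between_self _ _).symm⟩, ?_, ?_, ?_⟩
    · rw [h.head_enter ha le_rfl le_rfl h2, ite_self, n3]
    · rw [h.label_enter ha le_rfl le_rfl h2, if_pos e, if_neg e', ite_self]
    · rw [h.label_leave ha le_rfl le_rfl h2, if_pos e, if_neg e', ite_self]

theorem turns_two_one {v : ℕ} : (legDAG k n).Turns (h.route a) v 2 1 ↔ h.arcs.Pos a v := by
  have h1 := ha.lo_pos
  have h2 := ha.lo_le
  rw [FramedDAG.turns_iff]
  constructor
  · rintro ⟨e, e', hs, hv, he, he'⟩
    obtain ⟨p, q, p1, p2, p3, rfl, rfl, hb⟩ := (h.split_iff ha).1 hs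
    have hpq : p = q := by
      by_contra hne
      have : Edge.inner p ∈ between k a p q := inner_mem_between.2 ⟨le_rfl, by omega⟩
      rw [← hb] at this
      simp at this
    subst hpq
    rw [h.head_enter ha p1 p2 p3, ite_self] at hv
    rw [h.label_enter ha p1 p2 p3] at he
    rw [h.label_leave ha p1 p2 p3] at he'
    have : a.2 = 2 * p ∧ a.1 ≠ 2 * p := by
      split_ifs at he he' <;> omega
    have e : hi a = p := by simp only [hi]; omega
    exact ⟨by omega, by omega, by rw [e]; exact hv⟩
  · rintro ⟨n1, n2, n3⟩
    have e : a.2 = 2 * hi a := by simp only [hi]; omega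
    have e' : a.1 ≠ 2 * hi a := by omega
    refine ⟨_, _, (h.split_iff ha).2 ⟨hi a, hi a, h2, le_rfl, le_rfl, rfl, rfl,
      (between_self _ _).symm⟩, ?_, ?_, ?_⟩
    · rw [h.head_enter ha h2 le_rfl le_rfl, ite_self, n3]
    · rw [h.label_enter ha h2 le_rfl le_rfl, if_pos e, if_neg e', ite_self]
    · rw [h.label_leave ha h2 le_rfl le_rfl, if_pos e, if_neg e', ite_self]

open Classical in
theorem gVec_route : (legDAG k n).gVec (h.route a) = h.arcs.g a := by
  funext i
  have hno : ¬ (h.arcs.Pos a (i + 1) ∧ h.arcs.Neg a (i + 1)) := fun H =>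
    (LegData.coh_self ha).1 (Or.inr ⟨_, H.1, H.2⟩)
  have e : h.arcs.g a i = (if h.arcs.Pos a (i + 1) then 1 else 0) -
    (if h.arcs.Neg a (i + 1) then 1 else 0) := rfl
  rw [e, FramedDAG.gVec]
  simp only [h.turns_one_two ha, h.turns_two_one ha]
  by_cases hp : h.arcs.Pos a (i + 1) <;> by_cases hn : h.arcs.Neg a (i + 1)
  · exact absurd ⟨hp, hn⟩ hno
  · simp [hp, hn]
  · simp [hp, hn]
  · simp [hp, hn]

end Turns

section Conflicts

variable (h : LegShape k n) {a b : ℕ × ℕ}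

theorem nw_of_window {p q : ℕ} (ha1 : lo a ≤ p) (hpq : p < q) (hb2 : q ≤ hi b)
    (H : a.1 ≠ 2 * p ∧ b.1 = 2 * p ∧ a.2 = 2 * q ∧ b.2 ≠ 2 * q) : h.arcs.NW a b := by
  refine Or.inl ?_
  simp only [lo, hi] at *
  omega

/-- An odd code at either end of the overlap would place a leg end strictly inside the other arc. So
both arcs separate with a turn. -/
theorem exists_window_of_nw (ha : h.arcs.IsBox a) (hb : h.arcs.IsBox b) (h1 : a.1 < b.1)
    (h2 : lo b < hi a) (h3 : a.2 < b.2) : b.1 = 2 * lo b ∧ a.2 = 2 * hi a := by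
  have e1 := fun e => ha.inner _ (hb.bd_lo e)
  have e2 := fun e => hb.inner _ (ha.bd_hi e)
  simp only [lo, hi] at *
  omega

/-- Overlapping arcs are in conflict at their whole overlap, from `lo b` to `hi a`; opposite signs
give a conflict at one vertex. -/
theorem inConflict_of_nw (ha : h.arcs.IsBox a) (hb : h.arcs.IsBox b) (hnw : h.arcs.NW a b) :
    (legDAG k n).InConflict (h.route a) (h.route b) := by
  rw [FramedDAG.inConflict_iff]
  have la := ha.lo_le
  have lb := hb.lo_le
  rcases hnw with ⟨h1, h2, h3⟩ | ⟨v, ⟨p1, p2, p3⟩, n1, n2, n3⟩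
  · obtain ⟨e1, e2⟩ := h.exists_window_of_nw ha hb h1 h2 h3
    have w1 : lo a ≤ lo b := by simp only [lo]; omega
    have w2 : hi a ≤ hi b := by simp only [hi]; omega
    have d : Fwd k a ↔ Fwd k b := (h.forward_iff_of_isBox ha w1 h2).symm.trans
      (h.forward_iff_of_isBox hb le_rfl (h2.trans_le w2))
    have e3 : a.1 ≠ 2 * lo b := by omega
    have e4 : b.2 ≠ 2 * hi a := by omega
    refine ⟨_, _, _, _, _, (h.split_iff ha).2 ⟨lo b, hi a, w1, h2.le, le_rfl, rfl, rfl, rfl⟩,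
      (h.split_iff hb).2 ⟨lo b, hi a, le_rfl, h2.le, w2, rfl, rfl, ?_⟩, ?_, ?_, ?_⟩
    · rw [between, between, propext d]
    · rw [h.head_enter ha w1 h2.le le_rfl, h.head_enter hb le_rfl h2.le w2]
      rw [propext d]
    · rw [h.tail_leave ha w1 h2.le le_rfl, h.tail_leave hb le_rfl h2.le w2]
      rw [propext d]
    · rw [h.label_enter ha w1 h2.le le_rfl, h.label_enter hb le_rfl h2.le w2,
        h.label_leave ha w1 h2.le le_rfl, h.label_leave hb le_rfl h2.le w2]
      rw [propext d, if_pos e1, if_pos e2, if_neg e3, if_neg e4]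
      split_ifs <;> omega
  · have e1 : a.2 = 2 * hi a := by simp only [hi]; omega
    have e2 : a.1 ≠ 2 * hi a := by omega
    have e3 : b.1 = 2 * lo b := by simp only [lo]; omega
    have e4 : b.2 ≠ 2 * lo b := by omega
    refine ⟨_, _, _, _, _, (h.split_iff ha).2 ⟨hi a, hi a, la, le_rfl, le_rfl, rfl, rfl, rfl⟩,
      (h.split_iff hb).2 ⟨lo b, lo b, le_rfl, le_rfl, lb, rfl, rfl, ?_⟩, ?_, ?_, ?_⟩
    · rw [between_self, between_self]
    · rw [h.head_enter ha la le_rfl le_rfl, h.head_enter hb le_rfl le_rfl lb, ite_self, ite_self,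
        p3, n3]
    · rw [h.tail_leave ha la le_rfl le_rfl, h.tail_leave hb le_rfl le_rfl lb, ite_self, ite_self,
        p3, n3]
    · rw [h.label_enter ha la le_rfl le_rfl, h.label_enter hb le_rfl le_rfl lb,
        h.label_leave ha la le_rfl le_rfl, h.label_leave hb le_rfl le_rfl lb]
      simp only [if_pos e1, if_neg e2, if_pos e3, if_neg e4, ite_self]
      omega

theorem coherent_route_iff (ha : h.arcs.IsBox a) (hb : h.arcs.IsBox b) :
    (legDAG k n).Coherent (h.route a) (h.route b) ↔ h.arcs.Coh a b := by
  constructor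
  · intro hc
    refine ⟨fun H => hc (h.inConflict_of_nw ha hb H), fun H => hc ?_⟩
    obtain ⟨C, R₁, R₂, S₁, S₂, e1, e2, e3⟩ := h.inConflict_of_nw hb ha H
    exact ⟨C, S₁, S₂, R₁, R₂, e2, e1, e3.symm⟩
  · intro hc H
    rw [FramedDAG.inConflict_iff] at H
    obtain ⟨M, e, e', f, f', hs, hs', hh, ht, hl⟩ := H
    obtain ⟨p, q, p1, p2, p3, rfl, rfl, hb1⟩ := (h.split_iff ha).1 hs
    obtain ⟨p', q', p1', p2', p3', rfl, rfl, hb2⟩ := (h.split_iff hb).1 hs'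
    rw [h.label_enter ha p1 p2 p3, h.label_enter hb p1' p2' p3',
      h.label_leave ha p1 p2 p3, h.label_leave hb p1' p2' p3'] at hl
    rw [h.head_enter ha p1 p2 p3, h.head_enter hb p1' p2' p3'] at hh
    -- A window with an inner edge is determined by the inner edges it contains, so the two windows
    -- coincide and lie on the same leg.
    have mem : ∀ s, (p ≤ s ∧ s < q) ↔ (p' ≤ s ∧ s < q') := fun s => by
      rw [← inner_mem_between (k := k) (a := a), ← inner_mem_between (k := k) (a := b), ← hb1, hb2]
    rcases p2.lt_or_eq with hlt | heq
    · have m1 := (mem p).1 ⟨le_rfl, hlt⟩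
      have m2 := (mem p').2 ⟨le_rfl, by omega⟩
      have m3 := (mem (q - 1)).1 ⟨by omega, by omega⟩
      have m4 := (mem (q' - 1)).2 ⟨by omega, by omega⟩
      obtain rfl : p = p' := by omega
      obtain rfl : q = q' := by omega
      have d : Fwd k a ↔ Fwd k b := (h.forward_iff_of_isBox ha p1 (by omega)).symm.trans
        (h.forward_iff_of_isBox hb p1' (by omega))
      have key : (a.1 ≠ 2 * p ∧ b.1 = 2 * p ∧ a.2 = 2 * q ∧ b.2 ≠ 2 * q) ∨
          (b.1 ≠ 2 * p ∧ a.1 = 2 * p ∧ b.2 = 2 * q ∧ a.2 ≠ 2 * q) := by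
        rw [propext d] at hl
        clear hh ht hs hs' mem
        split_ifs at hl <;> omega
      rcases key with key | key
      · exact hc.1 (h.nw_of_window p1 hlt p3' key)
      · exact hc.2 (h.nw_of_window p1' hlt p3 key)
    -- For empty windows the positions need only name the same vertex; they may differ as `1` and `K
    -- + 1` do in a cycle.
    · have heq' : p' = q' := by
        by_contra hne
        have := (mem p').2 ⟨le_rfl, by omega⟩
        omega
      subst heq heq'
      rw [ite_self, ite_self] at hh
      have key : (a.1 ≠ 2 * p ∧ a.2 = 2 * p ∧ b.1 = 2 * p' ∧ b.2 ≠ 2 * p') ∨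
          (a.1 = 2 * p ∧ a.2 ≠ 2 * p ∧ b.1 ≠ 2 * p' ∧ b.2 = 2 * p') := by
        clear ht hs hs' mem hh
        split_ifs at hl <;> omega
      rcases key with ⟨k1, k2, k3, k4⟩ | ⟨k1, k2, k3, k4⟩
      · have e1 : hi a = p := by simp only [hi]; omega
        have e2 : lo b = p' := by simp only [lo]; omega
        exact hc.1 (Or.inr ⟨_, ⟨by omega, by omega, rfl⟩, by omega, by omega,
          by rw [e1, e2]; exact hh.symm⟩)
      · have e1 : lo a = p := by simp only [lo]; omega
        have e2 : hi b = p' := by simp only [hi]; omega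
        exact hc.2 (Or.inr ⟨_, ⟨by omega, by omega, rfl⟩, by omega, by omega,
          by rw [e1, e2]; exact hh⟩)

/-- A non-exceptional arc has a nonzero coordinate at some vertex, and the arc with the opposite
unit vector there is in conflict with it. -/
theorem isExceptional_route_iff (ha : h.arcs.IsBox a) :
    (legDAG k n).IsExceptional (h.route a) ↔ LegData.Exc a := by
  constructor
  · rintro ⟨-, hc⟩
    by_contra hne
    have hcoh : ∀ b, h.arcs.IsBox b → h.arcs.Coh a b := fun b hb =>
      (h.coherent_route_iff ha hb).1 (hc _ (h.isRoute_route hb))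
    have h1 : a.1 ≠ a.2 := fun e => hne (Or.inl e)
    have h2 : ¬ (a.1 % 2 = 1 ∧ a.2 % 2 = 1) := fun e => hne (Or.inr e)
    by_cases he : a.1 % 2 = 0
    · obtain ⟨b, hb, -, hp⟩ := LegData.exists_pos (Λ := h.arcs) ha.vtx_lo_mem.1 ha.vtx_lo_mem.2
      exact (hcoh b hb.1).2 (Or.inr ⟨_, hp, he, h1, rfl⟩)
    · obtain ⟨b, hb, -, hp⟩ := LegData.exists_neg (Λ := h.arcs) ha.vtx_hi_mem.1 ha.vtx_hi_mem.2
      exact (hcoh b hb.1).1 (Or.inr ⟨_, ⟨by omega, h1, rfl⟩, hp⟩)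
  · intro he
    refine ⟨h.isRoute_route ha, fun S hS => ?_⟩
    obtain ⟨b, hb, rfl⟩ := h.exists_arc hS
    exact (h.coherent_route_iff ha hb).2 (LegData.coh_exc ha he hb)

end Conflicts

end LegShape
end PullDKK

/-! ### The coherence diagram in terms of codes. -/

namespace PullDKK

namespace LegShape

variable {k : List ℕ} {n : ℕ}

section Neighbours

variable (h : LegShape k n) {a b : ℕ × ℕ}

theorem lo_le_sum_or (ha : h.arcs.IsBox a) : lo a ≤ k.sum ∨
    (lo a = k.sum + 1 ∧ hi a = k.sum + 1 ∧ n = k.sum + 1 ∧ a.1 % 2 = 0) := by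
  have h2 := ha.lo_le
  have h3 : hi a ≤ k.sum + 1 := ha.hi_le
  have hK := h.sum_pos
  by_cases hlo : lo a ≤ k.sum
  · exact Or.inl hlo
  · right
    have e : lo a = k.sum + 1 := by omega
    rcases ha.triv (by omega) with ht | ht | ht
    · have : lo a = 1 := ht.2.1
      omega
    · have h4 : n = k.sum + 1 := ht.1
      have h5 : a.1 = 2 * (k.sum + 1) := ht.2.2
      omega
    · exact absurd h.arcs.bd_last (e ▸ ht)

theorem fwd_iff_pred (ha : h.arcs.IsBox a) (h2 : 2 ≤ hi a) : Fwd k a ↔ IsForward k (hi a - 1) := by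
  rcases ha.lo_le.lt_or_eq with hlt | heq
  · exact (h.forward_iff_of_isBox ha (by omega) (by omega)).symm
  · rcases h.lo_le_sum_or ha with hl | hl
    · have hb : ¬ h.arcs.Bd (lo a) := by
        rcases ha.triv heq with ht | ht | ht
        · have : lo a = 1 := ht.2.1
          omega
        · have : lo a = k.sum + 1 := ht.2.1
          omega
        · exact ht
      have hb' : IsForward k (lo a - 1) ↔ IsForward k (lo a) := by
        by_contra hc
        exact hb (Or.inr (Or.inr hc))
      rw [Fwd, min_eq_left hl, ← heq, hb']
    · rw [Fwd, min_eq_right (by omega), hl.2.1]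
      rfl

theorem fwd_of_fst_eq (e : a.1 = b.1) : Fwd k a ↔ Fwd k b := by
  rw [Fwd, Fwd, lo, lo, e]

theorem fwd_of_snd_eq (ha : h.arcs.IsBox a) (hb : h.arcs.IsBox b) (e : a.2 = b.2) :
    Fwd k a ↔ Fwd k b := by
  have e' : hi a = hi b := by rw [hi, hi, e]
  by_cases h2 : 2 ≤ hi a
  · rw [h.fwd_iff_pred ha h2, h.fwd_iff_pred hb (e' ▸ h2), e']
  · have := ha.lo_pos
    have := hb.lo_pos
    have := ha.lo_le
    have := hb.lo_le
    have e'' : lo a = lo b := by omega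
    rw [Fwd, Fwd, e'']

theorem vtx_lo (ha : h.arcs.IsBox a) : h.arcs.vtx (lo a) = lo a := by
  rcases h.lo_le_sum_or ha with hl | ⟨hl, -, hn, -⟩
  · exact h.vtx_of_le hl
  · rw [vtx_def, if_pos (by omega)]

theorem vtx_hi (ha : h.arcs.IsBox a) (hn : ¬ (¬ Fwd k a ∧ n = k.sum ∧ hi a = k.sum + 1)) :
    h.arcs.vtx (hi a) = hi a := by
  have h3 : hi a ≤ k.sum + 1 := ha.hi_le
  have := h.n_eq
  by_cases he : hi a ≤ n
  · rw [vtx_def, if_pos he]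
  · have e1 : hi a = k.sum + 1 := by omega
    have e2 : n = k.sum := by omega
    have hK := h.sum_pos
    have hF : Fwd k a := by tauto
    rw [h.fwd_iff_pred ha (by omega), e1] at hF
    exact absurd hF (h.cycle e2).2

/-- Adjacent arcs have opposite directions because the direction changes at their common leg end.
Conversely, meeting arcs of opposite directions cannot be single vertices, since such an arc would
inherit the direction of the other. -/
theorem adj_iff (ha : h.arcs.IsBox a) (hb : h.arcs.IsBox b) : h.arcs.Adj a b ↔
    (Fwd k a ↔ ¬ Fwd k b) ∧ h.arcs.vtx (hi a) = h.arcs.vtx (lo b) ∧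
      (b.1 % 2 = 0 ↔ a.2 % 2 = 1) := by
  have a1 := ha.lo_pos
  have b1 := hb.lo_pos
  have a2 := ha.lo_le
  have b2 := hb.lo_le
  have b3 : hi b ≤ k.sum + 1 := hb.hi_le
  constructor
  · rintro ⟨h1, h2, h3, h4⟩
    refine ⟨?_, h3, h4⟩
    rw [h.fwd_iff_pred ha (by omega)]
    have eb : Fwd k b ↔ IsForward k (lo b) := by rw [Fwd, min_eq_left (by omega)]
    rw [eb]
    rcases (LegData.vtx_eq_iff ha hb).1 h3 with e | ⟨e1, e2, e3⟩
    · have hbd : h.arcs.Bd (lo b) := by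
        by_cases he : b.1 % 2 = 1
        · exact hb.bd_lo he
        · exact e ▸ ha.bd_hi (h4.1 (by omega))
      rcases hbd with e' | e' | e'
      · omega
      · omega
      · rw [e]; tauto
    · have hn : n = k.sum := e1
      have e2 : hi a = k.sum + 1 := e2
      rw [e2, e3]
      have := (h.cycle hn).2
      have := h.forward_one
      simp only [Nat.add_sub_cancel]
      tauto
  · rintro ⟨h1, h3, h4⟩
    have hv := (LegData.vtx_eq_iff ha hb).1 h3
    refine ⟨lt_of_le_of_ne a2 fun e => ?_, lt_of_le_of_ne b2 fun e => ?_, h3, h4⟩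
    · rcases hv with hv | ⟨e1, e2, e3⟩
      · have : Fwd k a ↔ Fwd k b := by rw [Fwd, Fwd, e, hv]
        tauto
      · have := (ha.cycle e1).1
        omega
    · rcases hv with hv | ⟨e1, e2, e3⟩
      · by_cases h2 : 2 ≤ hi a
        · have : Fwd k a ↔ Fwd k b := by
            rw [h.fwd_iff_pred ha h2, h.fwd_iff_pred hb (by omega), hv, e]
          tauto
        · have : Fwd k a ↔ Fwd k b := by rw [Fwd, Fwd, show lo a = lo b by omega]
          tauto
      · have := (hb.cycle e1).2.1
        omega

/-- Arcs on legs of opposite directions can share a source or sink edge only where the legs meet.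
One of them turns there and the other does not, so that the labels agree. -/
theorem upEdge_eq_lowEdge_iff (ha : h.arcs.IsBox a) (hb : h.arcs.IsBox b)
    (hd : Fwd k a ↔ ¬ Fwd k b) : h.upEdge a = h.lowEdge b ↔ h.arcs.Adj a b := by
  rw [h.adj_iff ha hb, upEdge, lowEdge]
  by_cases hF : Fwd k a
  · have hF' := hd.1 hF
    rw [if_pos hF, if_neg hF', Edge.snk.injEq]
    simp only [hF, hF', not_false_eq_true, iff_self, true_and]
    refine and_congr_right fun _ => ?_
    split_ifs <;> omega
  · have hF' : Fwd k b := by tauto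
    rw [if_neg hF, if_pos hF', Edge.src.injEq]
    simp only [hF, hF', not_true_eq_false, iff_self, true_and]
    refine and_congr_right fun _ => ?_
    split_ifs <;> omega

theorem lowEdge_eq_iff (ha : h.arcs.IsBox a) (hb : h.arcs.IsBox b) (hd : Fwd k a ↔ Fwd k b) :
    h.lowEdge a = h.lowEdge b ↔ a.1 = b.1 := by
  rw [lowEdge, lowEdge]
  by_cases hF : Fwd k a
  · rw [if_pos hF, if_pos (hd.1 hF), Edge.src.injEq, LegData.vtx_lo_eq_iff ha hb, lo, lo]
    split_ifs <;> omega
  · rw [if_neg hF, if_neg (mt hd.2 hF), Edge.snk.injEq, LegData.vtx_lo_eq_iff ha hb, lo, lo]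
    split_ifs <;> omega

theorem upEdge_eq_iff (ha : h.arcs.IsBox a) (hb : h.arcs.IsBox b) (hd : Fwd k a ↔ Fwd k b) :
    h.upEdge a = h.upEdge b ↔ a.2 = b.2 := by
  rw [upEdge, upEdge]
  by_cases hF : Fwd k a
  · rw [if_pos hF, if_pos (hd.1 hF), Edge.snk.injEq, LegData.vtx_hi_eq_iff ha hb, hi, hi]
    split_ifs <;> omega
  · rw [if_neg hF, if_neg (mt hd.2 hF), Edge.src.injEq, LegData.vtx_hi_eq_iff ha hb, hi, hi]
    split_ifs <;> omega

end Neighbours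

section Positions

variable (h : LegShape k n) {a b : ℕ × ℕ}

/-- The position of the edge at the lower end. -/
noncomputable def lowPos (a : ℕ × ℕ) : ℤ := edgePos (legDAG k n) (h.lowEdge a)

/-- The position of the edge at the upper end, with the two rows at the vertex `1` that a wrapping
arc reaches moved to the bottom. -/
noncomputable def upPos (a : ℕ × ℕ) : ℤ :=
  edgePos (legDAG k n) (h.upEdge a) + 3 * ((hi a : ℤ) - h.arcs.vtx (hi a))

/-- Odd lower codes take the place just before the vertex name, even ones the name itself or the
place after it. Hence the order of edge names is the order of lower codes. -/
theorem lowPos_bounds (ha : h.arcs.IsBox a) :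
    (a.1 % 2 = 1 ∧ h.lowPos a = 3 * lo a - 1) ∨
      (a.1 % 2 = 0 ∧ 3 * (lo a : ℤ) ≤ h.lowPos a ∧ h.lowPos a ≤ 3 * lo a + 1) := by
  have hlo := h.lo_le_sum_or ha
  have hlo' : lo a ≤ k.sum + 1 := by omega
  have hv := h.vtx_lo ha
  rw [lowPos, lowEdge]
  by_cases he : a.1 % 2 = 0
  · right
    refine ⟨he, ?_⟩
    by_cases hF : Fwd k a
    · rw [if_pos hF, if_pos he, hv, edgePos]
      split_ifs <;> omega
    · rw [if_neg hF, if_pos he, hv, edgePos]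
      split_ifs <;> omega
  · left
    refine ⟨by omega, ?_⟩
    have hK : lo a ≤ k.sum := by omega
    by_cases hF : Fwd k a
    · have hm := h.snk_two_mem ha.lo_pos hlo'
      have hF' := hF
      rw [Fwd, min_eq_left hK] at hF'
      have hm' : Edge.snk (h.arcs.vtx (lo a)) 2 ∉ (legDAG k n).edges := by
        rw [hm]; rintro (⟨-, hx⟩ | hx)
        · exact hx hF'
        · omega
      rw [if_pos hF, if_neg he, edgePos, if_neg hm', hv]
      simp only [if_true]; omega
    · have hm := h.src_one_mem ha.lo_pos hlo'
      have hF' := hF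
      rw [Fwd, min_eq_left hK] at hF'
      have hm' : Edge.src (h.arcs.vtx (lo a)) 1 ∉ (legDAG k n).edges := by
        rw [hm]; rintro (hx | hx)
        · omega
        · exact hF' hx
      rw [if_neg hF, if_neg he, edgePos, if_neg hm', hv, if_neg (by omega)]
      omega

theorem upPos_bounds (ha : h.arcs.IsBox a) :
    (a.2 % 2 = 1 ∧ h.upPos a = 3 * hi a + 1) ∨
      (a.2 % 2 = 0 ∧ 3 * (hi a : ℤ) - 1 ≤ h.upPos a ∧ h.upPos a ≤ 3 * hi a) := by
  have h1 := ha.lo_pos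
  have h2 := ha.lo_le
  have h3 : hi a ≤ k.sum + 1 := ha.hi_le
  rw [upPos, upEdge]
  by_cases he : a.2 % 2 = 0
  · right
    refine ⟨he, ?_⟩
    by_cases hF : Fwd k a
    · rw [if_pos hF, if_pos he, edgePos]
      split_ifs <;> omega
    · rw [if_neg hF, if_pos he, edgePos]
      split_ifs <;> omega
  · left
    refine ⟨by omega, ?_⟩
    have hK : 2 ≤ hi a := by
      by_contra hc
      have e : lo a = 1 := by omega
      rcases ha.triv (by omega) with ht | ht | ht
      · omega
      · have : lo a = k.sum + 1 := ht.2.1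
        have := h.sum_pos
        omega
      · exact ht (e ▸ h.arcs.bd_one)
    have hF' := h.fwd_iff_pred ha hK
    by_cases hF : Fwd k a
    · have hm := h.src_two_mem (h1.trans h2) h3
      have hm' : Edge.src (h.arcs.vtx (hi a)) 2 ∉ (legDAG k n).edges := by
        rw [hm]; rintro (hx | hx)
        · omega
        · exact hx (hF'.1 hF)
      rw [if_pos hF, if_neg he, edgePos, if_neg hm']
      simp only [if_true]; omega
    · have hm := h.snk_one_mem (h1.trans h2) h3
      have hm' : Edge.snk (h.arcs.vtx (hi a)) 1 ∉ (legDAG k n).edges := by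
        rw [hm]; rintro (hx | hx)
        · omega
        · exact hF (hF'.2 hx.2)
      rw [if_neg hF, if_neg he, edgePos, if_neg hm', if_neg (by omega)]
      omega

theorem lowPos_lt_iff (ha : h.arcs.IsBox a) (hb : h.arcs.IsBox b) :
    h.lowPos a < h.lowPos b ↔ a.1 < b.1 := by
  rcases lt_trichotomy a.1 b.1 with hlt | heq | hlt
  · have := h.lowPos_bounds ha
    have := h.lowPos_bounds hb
    simp only [lo] at *
    omega
  · have : h.lowPos a = h.lowPos b := by
      rw [lowPos, (h.lowEdge_eq_iff ha hb (fwd_of_fst_eq heq)).2 heq, lowPos]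
    omega
  · have := h.lowPos_bounds ha
    have := h.lowPos_bounds hb
    simp only [lo] at *
    omega

theorem upPos_lt_iff (ha : h.arcs.IsBox a) (hb : h.arcs.IsBox b) :
    h.upPos a < h.upPos b ↔ a.2 < b.2 := by
  rcases lt_trichotomy a.2 b.2 with hlt | heq | hlt
  · have := h.upPos_bounds ha
    have := h.upPos_bounds hb
    simp only [hi] at *
    omega
  · have : h.upPos a = h.upPos b := by
      rw [upPos, (h.upEdge_eq_iff ha hb (h.fwd_of_snd_eq ha hb heq)).2 heq, upPos, hi, hi, heq]
    omega
  · have := h.upPos_bounds ha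
    have := h.upPos_bounds hb
    simp only [hi] at *
    omega

theorem wraps_iff (ha : h.arcs.IsBox a) : Wraps (legDAG k n) (h.route a) ↔
    ¬ Fwd k a ∧ n = k.sum ∧ hi a = k.sum + 1 := by
  have h1 := ha.lo_pos
  have h3 : hi a ≤ k.sum + 1 := ha.hi_le
  have hn := h.n_eq
  constructor
  · rintro ⟨l, R', e⟩
    have hm : Edge.inner n ∈ h.route a := by rw [e]; simp [legDAG]
    have hm' := h.inner_mem_route.1 hm
    have e1 : n = k.sum := by omega
    refine ⟨fun hF => ?_, e1, by omega⟩
    exact (h.cycle e1).2 (e1 ▸ (h.forward_iff_of_isBox ha hm'.1 hm'.2).2 hF)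
  · rintro ⟨hF, e1, e2⟩
    have e3 := (ha.cycle e1).1
    have e3 : lo a ≤ k.sum := e3
    have hv : h.arcs.vtx (hi a) = 1 := by
      rw [e2]; rcases h.vtx_last with ⟨-, hl⟩ | ⟨hl, -⟩
      · omega
      · exact hl
    rw [route, if_neg hF, ascending, upEdge, if_neg hF, hv,
      show hi a - lo a = k.sum - lo a + 1 by omega, List.range'_1_concat,
      show lo a + (k.sum - lo a) = n by omega]
    refine ⟨if a.2 % 2 = 0 then 2 else 1,
      ((List.range' (lo a) (k.sum - lo a)).map Edge.inner).reverse ++ [h.lowEdge a], ?_⟩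
    simp [legDAG]

theorem rowPos_forward (ha : h.arcs.IsBox a) (hF : Fwd k a) :
    rowPos (legDAG k n) (h.route a) = h.lowPos a := by
  have hw : ¬ Wraps (legDAG k n) (h.route a) := fun hw => ((h.wraps_iff ha).1 hw).1 hF
  rw [rowPos, if_neg hw, h.head?_route, if_pos hF, lowPos]
  simp

theorem colPos_forward (ha : h.arcs.IsBox a) (hF : Fwd k a) :
    colPos (legDAG k n) (h.route a) = h.upPos a := by
  -- Wrapping routes use the last edge of a cycle, which is backward.
  have hw : ¬ Wraps (legDAG k n) (h.route a) := fun hw => ((h.wraps_iff ha).1 hw).1 hF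
  rw [colPos, if_neg hw, h.getLast?_route, if_pos hF, upPos, h.vtx_hi ha fun hc => hc.1 hF]
  simp

theorem rowPos_backward (ha : h.arcs.IsBox a) (hF : ¬ Fwd k a) :
    rowPos (legDAG k n) (h.route a) = h.upPos a := by
  rw [rowPos, h.head?_route, if_neg hF, upPos]
  simp only [Option.map_some, Option.getD_some]
  congr 1
  have hw := h.wraps_iff ha
  by_cases hc : Wraps (legDAG k n) (h.route a)
  · rw [if_pos hc]
    obtain ⟨-, hn, e⟩ := hw.1 hc
    rw [e]
    rcases h.vtx_last with ⟨-, hl⟩ | ⟨hl, -⟩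
    · omega
    · rw [hl]
      change 3 * (n : ℤ) = _
      omega
  · rw [if_neg hc, h.vtx_hi ha fun H => hc (hw.2 H)]
    simp

-- The shift depends only on the upper end, so it cancels between backward arcs in the same row.
open Classical in
theorem colPos_backward (ha : h.arcs.IsBox a) (hF : ¬ Fwd k a) :
    colPos (legDAG k n) (h.route a) =
      h.lowPos a - if n = k.sum ∧ hi a = k.sum + 1 then 3 * (n : ℤ) else 0 := by
  have hw := h.wraps_iff ha
  simp only [hF, not_false_eq_true, true_and] at hw
  rw [colPos, h.getLast?_route, if_neg hF, lowPos]
  simp only [Option.map_some, Option.getD_some]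
  congr 1
  by_cases hc : Wraps (legDAG k n) (h.route a)
  · rw [if_pos hc, if_pos (hw.1 hc)]; rfl
  · rw [if_neg hc, if_neg (mt hw.2 hc)]

theorem rowPos_lt_of_adj (ha : h.arcs.IsBox a) (hb : h.arcs.IsBox b) (hab : h.arcs.Adj a b)
    (hF : Fwd k a) :
    rowPos (legDAG k n) (h.route a) < rowPos (legDAG k n) (h.route b) := by
  have hF' := ((h.adj_iff ha hb).1 hab).1.1 hF
  rw [h.rowPos_forward ha hF, h.rowPos_backward hb hF']
  have b1 := h.lowPos_bounds ha
  have b2 := h.upPos_bounds hb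
  obtain ⟨h1, h2, h3, -⟩ := hab
  rw [h.vtx_lo hb, h.vtx_hi ha fun H => H.1 hF] at h3
  omega

theorem colPos_lt_of_adj (ha : h.arcs.IsBox a) (hb : h.arcs.IsBox b) (hab : h.arcs.Adj a b)
    (hF : ¬ Fwd k a) :
    colPos (legDAG k n) (h.route a) < colPos (legDAG k n) (h.route b) := by
  have hF' : Fwd k b := by
    have := ((h.adj_iff ha hb).1 hab).1
    tauto
  rw [h.colPos_backward ha hF, h.colPos_forward hb hF']
  have b1 := h.lowPos_bounds ha
  have b2 := h.upPos_bounds hb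
  have b3 := ha.lo_pos
  have b4 := hb.lo_pos
  have b5 : hi a ≤ k.sum + 1 := ha.hi_le
  obtain ⟨h1, h2, h3, -⟩ := hab
  split_ifs with hc
  · omega
  · rw [h.vtx_lo hb, h.vtx_hi ha fun H => hc H.2] at h3
    omega

end Positions

section Diagram

variable (h : LegShape k n) {a b : ℕ × ℕ} (ha : h.arcs.IsBox a) (hb : h.arcs.IsBox b)
include ha hb

/-- Forward arcs in the row of `a` share its lower code and are ordered by their upper codes. A
backward arc in this row is `Adj` to `a`, and its box is always to the left; for wrapping routes the
shift in `colPos` ensures this. The other seven cases follow the same pattern. -/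
theorem mem_west_forward (hF : Fwd k a) :
    h.route b ∈ west (legDAG k n) (h.route a) ↔ b ∈ h.arcs.loA a := by
  change _ ∧ _ ∧ _ ↔ _ ∧ _
  have hr := h.isRoute_route hb
  rw [h.head?_route, h.head?_route, if_pos hF, Option.some_inj]
  by_cases hF' : Fwd k b
  · have hadj : ¬ h.arcs.Adj b a := fun H => ((h.adj_iff hb ha).1 H).1.1 hF' hF
    rw [if_pos hF', h.lowEdge_eq_iff hb ha (iff_of_true hF' hF), h.colPos_forward hb hF',
      h.colPos_forward ha hF, h.upPos_lt_iff hb ha]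
    tauto
  · have hne : b.1 ≠ a.1 := fun e => hF' ((fwd_of_fst_eq e).2 hF)
    rw [if_neg hF', h.upEdge_eq_lowEdge_iff hb ha (by tauto)]
    have := fun H => h.colPos_lt_of_adj hb ha H hF'
    tauto

theorem mem_west_backward (hF : ¬ Fwd k a) :
    h.route b ∈ west (legDAG k n) (h.route a) ↔ b ∈ h.arcs.loB a := by
  change _ ∧ _ ∧ _ ↔ _ ∧ _
  have hr := h.isRoute_route hb
  rw [h.head?_route, h.head?_route, if_neg hF, Option.some_inj]
  by_cases hF' : Fwd k b
  · have hne : b.2 ≠ a.2 := fun e => hF ((h.fwd_of_snd_eq hb ha e).1 hF')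
    rw [if_pos hF', eq_comm, h.upEdge_eq_lowEdge_iff ha hb (by tauto)]
    have := fun H => (h.colPos_lt_of_adj ha hb H hF).not_gt
    tauto
  · rw [if_neg hF', h.upEdge_eq_iff hb ha (iff_of_false hF' hF), h.colPos_backward hb hF',
      h.colPos_backward ha hF]
    constructor
    · rintro ⟨-, e, hlt⟩
      rw [hi, hi, e, sub_lt_sub_iff_right, h.lowPos_lt_iff hb ha] at hlt
      exact ⟨hb, e, hlt⟩
    · rintro ⟨-, e, hlt⟩
      rw [hi, hi, e, sub_lt_sub_iff_right, h.lowPos_lt_iff hb ha]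
      exact ⟨hr, rfl, hlt⟩

theorem mem_east_forward (hF : Fwd k a) :
    h.route b ∈ east (legDAG k n) (h.route a) ↔ b ∈ h.arcs.hiA a := by
  change _ ∧ _ ∧ _ ↔ _ ∧ _
  have hr := h.isRoute_route hb
  rw [h.head?_route, h.head?_route, if_pos hF, Option.some_inj]
  by_cases hF' : Fwd k b
  · rw [if_pos hF', h.lowEdge_eq_iff hb ha (iff_of_true hF' hF), h.colPos_forward hb hF',
      h.colPos_forward ha hF, h.upPos_lt_iff ha hb]
    tauto
  · have hne : b.1 ≠ a.1 := fun e => hF' ((fwd_of_fst_eq e).2 hF)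
    rw [if_neg hF', h.upEdge_eq_lowEdge_iff hb ha (by tauto)]
    have := fun H => (h.colPos_lt_of_adj hb ha H hF').not_gt
    tauto

theorem mem_east_backward (hF : ¬ Fwd k a) :
    h.route b ∈ east (legDAG k n) (h.route a) ↔ b ∈ h.arcs.hiB a := by
  change _ ∧ _ ∧ _ ↔ _ ∧ _
  have hr := h.isRoute_route hb
  rw [h.head?_route, h.head?_route, if_neg hF, Option.some_inj]
  by_cases hF' : Fwd k b
  · have hne : b.2 ≠ a.2 := fun e => hF ((h.fwd_of_snd_eq hb ha e).1 hF')
    rw [if_pos hF', eq_comm, h.upEdge_eq_lowEdge_iff ha hb (by tauto)]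
    have := fun H => h.colPos_lt_of_adj ha hb H hF
    tauto
  · have hadj : ¬ h.arcs.Adj a b := fun H => hF (((h.adj_iff ha hb).1 H).1.2 hF')
    rw [if_neg hF', h.upEdge_eq_iff hb ha (iff_of_false hF' hF), h.colPos_backward hb hF',
      h.colPos_backward ha hF]
    constructor
    · rintro ⟨-, e, hlt⟩
      rw [hi, hi, e, sub_lt_sub_iff_right, h.lowPos_lt_iff ha hb] at hlt
      exact ⟨hb, Or.inl ⟨e, hlt⟩⟩
    · rintro ⟨-, ⟨e, hlt⟩ | H⟩
      · rw [hi, hi, e, sub_lt_sub_iff_right, h.lowPos_lt_iff ha hb]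
        exact ⟨hr, rfl, hlt⟩
      · exact absurd H hadj

theorem mem_north_forward (hF : Fwd k a) :
    h.route b ∈ north (legDAG k n) (h.route a) ↔ b ∈ h.arcs.loB a := by
  change _ ∧ _ ∧ _ ↔ _ ∧ _
  have hr := h.isRoute_route hb
  rw [h.getLast?_route, h.getLast?_route, if_pos hF, Option.some_inj]
  by_cases hF' : Fwd k b
  · rw [if_pos hF', h.upEdge_eq_iff hb ha (iff_of_true hF' hF), h.rowPos_forward hb hF',
      h.rowPos_forward ha hF, h.lowPos_lt_iff hb ha]
    tauto
  · have hne : b.2 ≠ a.2 := fun e => hF' ((h.fwd_of_snd_eq hb ha e).2 hF)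
    rw [if_neg hF', eq_comm, h.upEdge_eq_lowEdge_iff ha hb (by tauto)]
    have := fun H => (h.rowPos_lt_of_adj ha hb H hF).not_gt
    tauto

theorem mem_north_backward (hF : ¬ Fwd k a) :
    h.route b ∈ north (legDAG k n) (h.route a) ↔ b ∈ h.arcs.loA a := by
  change _ ∧ _ ∧ _ ↔ _ ∧ _
  have hr := h.isRoute_route hb
  rw [h.getLast?_route, h.getLast?_route, if_neg hF, Option.some_inj]
  by_cases hF' : Fwd k b
  · have hne : b.1 ≠ a.1 := fun e => hF ((fwd_of_fst_eq e).1 hF')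
    rw [if_pos hF', h.upEdge_eq_lowEdge_iff hb ha (by tauto)]
    have := fun H => h.rowPos_lt_of_adj hb ha H hF'
    tauto
  · have hadj : ¬ h.arcs.Adj b a := fun H => hF' (((h.adj_iff hb ha).1 H).1.2 hF)
    rw [if_neg hF', h.lowEdge_eq_iff hb ha (iff_of_false hF' hF), h.rowPos_backward hb hF',
      h.rowPos_backward ha hF, h.upPos_lt_iff hb ha]
    tauto

theorem mem_south_forward (hF : Fwd k a) :
    h.route b ∈ south (legDAG k n) (h.route a) ↔ b ∈ h.arcs.hiB a := by
  change _ ∧ _ ∧ _ ↔ _ ∧ _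
  have hr := h.isRoute_route hb
  rw [h.getLast?_route, h.getLast?_route, if_pos hF, Option.some_inj]
  by_cases hF' : Fwd k b
  · have hadj : ¬ h.arcs.Adj a b := fun H => ((h.adj_iff ha hb).1 H).1.1 hF hF'
    rw [if_pos hF', h.upEdge_eq_iff hb ha (iff_of_true hF' hF), h.rowPos_forward hb hF',
      h.rowPos_forward ha hF, h.lowPos_lt_iff ha hb]
    tauto
  · have hne : b.2 ≠ a.2 := fun e => hF' ((h.fwd_of_snd_eq hb ha e).2 hF)
    rw [if_neg hF', eq_comm, h.upEdge_eq_lowEdge_iff ha hb (by tauto)]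
    have := fun H => h.rowPos_lt_of_adj ha hb H hF
    tauto

theorem mem_south_backward (hF : ¬ Fwd k a) :
    h.route b ∈ south (legDAG k n) (h.route a) ↔ b ∈ h.arcs.hiA a := by
  change _ ∧ _ ∧ _ ↔ _ ∧ _
  have hr := h.isRoute_route hb
  rw [h.getLast?_route, h.getLast?_route, if_neg hF, Option.some_inj]
  by_cases hF' : Fwd k b
  · have hne : b.1 ≠ a.1 := fun e => hF ((fwd_of_fst_eq e).1 hF')
    rw [if_pos hF', h.upEdge_eq_lowEdge_iff hb ha (by tauto)]
    have := fun H => (h.rowPos_lt_of_adj hb ha H hF').not_gt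
    tauto
  · rw [if_neg hF', h.lowEdge_eq_iff hb ha (iff_of_false hF' hF), h.rowPos_backward hb hF',
      h.rowPos_backward ha hF, h.upPos_lt_iff ha hb]
    tauto

end Diagram

end LegShape
end PullDKK

/-! ### Transfer of the abstract criterion to `Path(k)` and `Cycle(k)`. -/

namespace PullDKK

namespace LegShape

variable {k : List ℕ} {n : ℕ}

theorem of_path (hk : ∀ a ∈ k, 0 < a) (hne : k ≠ []) : LegShape k (k.sum + 1) := by
  cases k with
  | nil => exact absurd rfl hne
  | cons a k =>
    have ha := hk a (by simp)
    refine ⟨Or.inr rfl, ?_, ?_, fun e => by omega⟩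
    · rw [List.sum_cons]; omega
    · simp [IsForward, blockIndex, ha]

/-- For an even number of legs the last index is odd, which makes the last edge of the cycle
backward. -/
theorem blockIndex_last (hk : ∀ a ∈ k, 0 < a) (hne : k ≠ []) :
    blockIndex k (k.sum - 1) = k.length - 1 := by
  induction k with
  | nil => exact absurd rfl hne
  | cons a k ih =>
    have ha := hk a (by simp)
    cases k with
    | nil => simp [blockIndex, ha]
    | cons b k =>
      have hb := hk b (by simp)
      have := ih (fun x hx => hk x (by simp [hx])) (by simp)
      rw [blockIndex, if_neg (by simp only [List.sum_cons]; omega), List.sum_cons,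
        show a + (b :: k).sum - 1 - a = (b :: k).sum - 1 by omega, this]
      simp

theorem of_cycle (hk : ∀ a ∈ k, 0 < a) (hne : k ≠ []) (he : Even k.length) (h11 : k ≠ [1, 1]) :
    LegShape k k.sum := by
  obtain ⟨-, h1, h2, -⟩ := of_path hk hne
  have hlen : k.length ≠ 0 := fun h => hne (List.eq_nil_of_length_eq_zero h)
  refine ⟨Or.inl rfl, h1, h2, fun _ => ⟨?_, ?_⟩⟩
  · match k, hk, hne, he, h11 with
    | [a], _, _, he, _ => simp at he
    | [a, b], hk, _, _, h11 =>
      have ha := hk a (by simp)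
      have hb := hk b (by simp)
      simp only [List.sum_cons, List.sum_nil]
      by_contra hlt
      exact h11 (by rw [show a = 1 by omega, show b = 1 by omega])
    | a :: b :: c :: k, hk, _, _, _ =>
      have ha := hk a (by simp)
      have hb := hk b (by simp)
      have hc := hk c (by simp)
      simp only [List.sum_cons]
      omega
  · obtain ⟨m, hm⟩ := he
    rw [IsForward, blockIndex_last hk hne]
    omega

variable (h : LegShape k n)

section Cells

theorem gPolytope_eq : (legDAG k n).gPolytope = h.arcs.system.polytope := by
  rw [FramedDAG.gPolytope, CoherenceSystem.polytope]
  congr 1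
  ext x
  constructor
  · rintro ⟨R, hR, rfl⟩
    obtain ⟨a, ha, rfl⟩ := h.exists_arc hR
    rw [h.gVec_route ha]
    by_cases he : LegData.Exc a
    · exact Or.inl (LegData.g_exc he)
    · exact Or.inr ⟨a, ⟨ha, he⟩, rfl⟩
  · rintro (rfl | ⟨a, ha, rfl⟩)
    · obtain ⟨a, ha, he⟩ := LegData.exists_exc (Λ := h.arcs)
      exact ⟨h.route a, h.isRoute_route ha, by rw [h.gVec_route ha]; exact LegData.g_exc he⟩
    · exact ⟨h.route a, h.isRoute_route ha.1, h.gVec_route ha.1⟩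

theorem pullRoutes_eq {L : List (ℕ × ℕ)} (hL : ∀ a ∈ L, h.arcs.IsBox a) :
    (legDAG k n).pullRoutes (L.map h.route) = h.arcs.system.cells L := by
  rw [FramedDAG.pullRoutes, CoherenceSystem.cells, h.gPolytope_eq, List.map_map]
  congr 2
  exact List.map_congr_left fun a ha => h.gVec_route (hL a ha)

/-- The routes of the arcs in a set together with all exceptional routes. -/
def routes (M : Set (ℕ × ℕ)) : Set (List Edge) :=
  h.route '' {a | h.arcs.IsBox a ∧ (LegData.Exc a ∨ a ∈ M)}

/-- The arcs of the non-exceptional routes in a set. -/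
def regularArcs (M : Set (List Edge)) : Set (ℕ × ℕ) := {a | h.arcs.IsReg a ∧ h.route a ∈ M}

theorem isClique_routes {M : Set (ℕ × ℕ)} (hM : h.arcs.system.IsCohClique M) :
    (legDAG k n).IsClique (h.routes M) := by
  constructor
  · rintro _ ⟨a, ha, rfl⟩
    exact h.isRoute_route ha.1
  · rintro _ ⟨a, ⟨ha, ha'⟩, rfl⟩ _ ⟨b, ⟨hb, hb'⟩, rfl⟩
    rw [h.coherent_route_iff ha hb]
    rcases ha' with ha' | ha'
    · exact LegData.coh_exc ha ha' hb
    · rcases hb' with hb' | hb'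
      · exact (LegData.coh_exc hb hb' ha).symm
      · exact hM.2 a ha' b hb'

theorem isCohClique_regularArcs {M : Set (List Edge)} (hM : (legDAG k n).IsClique M) :
    h.arcs.system.IsCohClique (h.regularArcs M) :=
  ⟨fun _ ha => ha.1, fun _ ha _ hb =>
    (h.coherent_route_iff ha.1.1 hb.1.1).1 (hM.2 _ ha.2 _ hb.2)⟩

theorem subset_routes_regularArcs {M : Set (List Edge)} (hM : (legDAG k n).IsClique M) :
    M ⊆ h.routes (h.regularArcs M) := by
  intro R hR
  obtain ⟨a, ha, rfl⟩ := h.exists_arc (hM.1 R hR)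
  refine ⟨a, ⟨ha, ?_⟩, rfl⟩
  by_cases he : LegData.Exc a
  · exact Or.inl he
  · exact Or.inr ⟨⟨ha, he⟩, hR⟩

theorem regularArcs_routes {M : Set (ℕ × ℕ)} (hM : ∀ a ∈ M, h.arcs.IsReg a) :
    h.regularArcs (h.routes M) = M := by
  ext a
  constructor
  · rintro ⟨ha, b, ⟨hb, hb'⟩, e⟩
    obtain rfl := h.route_injOn hb ha.1 e
    exact hb'.resolve_left ha.2
  · exact fun ha => ⟨hM a ha, a, ⟨(hM a ha).1, Or.inr ha⟩, rfl⟩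

theorem routes_mono {M N : Set (ℕ × ℕ)} (hMN : M ⊆ N) : h.routes M ⊆ h.routes N :=
  Set.image_mono fun _ ha => ⟨ha.1, ha.2.imp id fun h => hMN h⟩

theorem regularArcs_mono {M N : Set (List Edge)} (hMN : M ⊆ N) :
    h.regularArcs M ⊆ h.regularArcs N := fun _ ha => ⟨ha.1, hMN ha.2⟩

theorem convexHull_routes {M : Set (ℕ × ℕ)} (hM : ∀ a ∈ M, h.arcs.IsReg a) :
    convexHull ℝ ((legDAG k n).gVec '' h.routes M) = h.arcs.system.simplex M := by
  rw [CoherenceSystem.simplex]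
  congr 1
  ext x
  constructor
  · rintro ⟨_, ⟨a, ⟨ha, ha'⟩, rfl⟩, rfl⟩
    rw [h.gVec_route ha]
    exact ha'.imp LegData.g_exc fun ha' => ⟨a, ha', rfl⟩
  · rintro (rfl | ⟨a, ha, rfl⟩)
    · obtain ⟨a, ha, he⟩ := LegData.exists_exc (Λ := h.arcs)
      exact ⟨h.route a, ⟨a, ⟨ha, Or.inl he⟩, rfl⟩, by
        rw [h.gVec_route ha]; exact LegData.g_exc he⟩
    · exact ⟨h.route a, ⟨a, ⟨(hM a ha).1, Or.inr ha⟩, rfl⟩, h.gVec_route (hM a ha).1⟩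

/-- A maximal clique of routes contains all exceptional routes, so it is determined by its
non-exceptional arcs. The exceptional ones contribute exactly the vertex `0`. -/
theorem dkk_eq : (legDAG k n).DKK =
    {C | ∃ M, Maximal h.arcs.system.IsCohClique M ∧ C = h.arcs.system.simplex M} := by
  ext C
  constructor
  · rintro ⟨M, hM, rfl⟩
    have hc := h.isCohClique_regularArcs hM.1
    have e : M = h.routes (h.regularArcs M) :=
      hM.eq_of_subset (h.isClique_routes hc) (h.subset_routes_regularArcs hM.1)
    refine ⟨h.regularArcs M, ⟨hc, fun N hN hMN => ?_⟩, ?_⟩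
    · have h1 : M ⊆ h.routes N := (h.subset_routes_regularArcs hM.1).trans (h.routes_mono hMN)
      have h2 := h.regularArcs_mono (hM.2 (h.isClique_routes hN) h1)
      rwa [h.regularArcs_routes hN.1] at h2
    · conv_lhs => rw [e]
      exact h.convexHull_routes hc.1
  · rintro ⟨M, hM, rfl⟩
    refine ⟨h.routes M, ⟨h.isClique_routes hM.1, fun N hN hMN => ?_⟩,
      (h.convexHull_routes hM.1.1).symm⟩
    have h1 := h.regularArcs_mono hMN
    rw [h.regularArcs_routes hM.1.1] at h1
    exact (h.subset_routes_regularArcs hN).trans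
      (h.routes_mono (hM.2 (h.isCohClique_regularArcs hN) h1))

end Cells

section Steps

variable {V : List (ℕ × ℕ)} (hV : ∀ a ∈ V, h.arcs.IsBox a)
include hV

theorem route_mem_pulled {a : ℕ × ℕ} (ha : h.arcs.IsBox a) :
    h.route a ∈ pulled (legDAG k n) (V.map h.route) ↔ a ∈ h.arcs.system.done V := by
  refine or_congr (h.isExceptional_route_iff ha) ?_
  rw [List.mem_map]
  constructor
  · rintro ⟨b, hb, e⟩
    exact h.route_injOn (hV b hb) ha e ▸ hb
  · exact fun hm => ⟨a, hm, rfl⟩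

theorem subset_pulled_iff {X : Set (List Edge)} {Y : Set (ℕ × ℕ)}
    (hX : ∀ R ∈ X, (legDAG k n).IsRoute R) (hY : ∀ b ∈ Y, h.arcs.IsBox b)
    (hXY : ∀ b, h.arcs.IsBox b → (h.route b ∈ X ↔ b ∈ Y)) :
    X ⊆ pulled (legDAG k n) (V.map h.route) ↔ Y ⊆ h.arcs.system.done V := by
  constructor
  · intro H b hb
    exact (h.route_mem_pulled hV (hY b hb)).1 (H ((hXY b (hY b hb)).2 hb))
  · intro H R hR
    obtain ⟨b, hb, rfl⟩ := h.exists_arc (hX R hR)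
    exact (h.route_mem_pulled hV hb).2 (H ((hXY b hb).1 hR))

theorem isDKKPullStep_iff {a : ℕ × ℕ} (ha : h.arcs.IsBox a) :
    IsDKKPullStep (legDAG k n) (V.map h.route) (h.route a) ↔ h.arcs.system.Step V a := by
  rw [IsDKKPullStep, CoherenceSystem.Step]
  have l1 : ∀ b ∈ h.arcs.loA a, h.arcs.IsBox b := fun _ hb => hb.1
  have l2 : ∀ b ∈ h.arcs.loB a, h.arcs.IsBox b := fun _ hb => hb.1
  have l3 : ∀ b ∈ h.arcs.hiA a, h.arcs.IsBox b := fun _ hb => hb.1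
  have l4 : ∀ b ∈ h.arcs.hiB a, h.arcs.IsBox b := fun _ hb => hb.1
  by_cases hF : Fwd k a
  · rw [h.subset_pulled_iff hV (fun R hR => hR.1) l1 fun b hb => h.mem_west_forward ha hb hF,
      h.subset_pulled_iff hV (fun R hR => hR.1) l2 fun b hb => h.mem_north_forward ha hb hF,
      h.subset_pulled_iff hV (fun R hR => hR.1) l3 fun b hb => h.mem_east_forward ha hb hF,
      h.subset_pulled_iff hV (fun R hR => hR.1) l4 fun b hb => h.mem_south_forward ha hb hF]
    exact Iff.rfl
  · rw [h.subset_pulled_iff hV (fun R hR => hR.1) l2 fun b hb => h.mem_west_backward ha hb hF,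
      h.subset_pulled_iff hV (fun R hR => hR.1) l1 fun b hb => h.mem_north_backward ha hb hF,
      h.subset_pulled_iff hV (fun R hR => hR.1) l4 fun b hb => h.mem_east_backward ha hb hF,
      h.subset_pulled_iff hV (fun R hR => hR.1) l3 fun b hb => h.mem_south_backward ha hb hF]
    exact and_congr or_comm or_comm

theorem allDKKPullSteps_iff :
    AllDKKPullSteps (legDAG k n) (V.map h.route) ↔ h.arcs.system.AllSteps V := by
  constructor
  · rintro H V' a W rfl
    exact (h.isDKKPullStep_iff (fun b hb => hV b (by simp [hb])) (hV a (by simp))).1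
      (H _ _ (W.map h.route) (by simp))
  · intro H V' R W e
    obtain ⟨V₁, V₂, rfl, rfl, e2⟩ := List.map_eq_append_iff.1 e
    obtain ⟨a, W', rfl, rfl, rfl⟩ := List.map_eq_cons_iff.1 e2
    exact (h.isDKKPullStep_iff (fun b hb => hV b (by simp [hb])) (hV a (by simp))).2 (H _ _ _ rfl)

end Steps

theorem exists_map_route {L : List (List Edge)} (hL : ∀ R ∈ L, (legDAG k n).IsRoute R) :
    ∃ L' : List (ℕ × ℕ), (∀ a ∈ L', h.arcs.IsBox a) ∧ L = L'.map h.route := by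
  induction L with
  | nil => exact ⟨[], by simp, rfl⟩
  | cons R L ih =>
    obtain ⟨L', h1, rfl⟩ := ih fun S hS => hL S (by simp [hS])
    obtain ⟨a, ha, rfl⟩ := h.exists_arc (hL R (by simp))
    exact ⟨a :: L', by simpa using ⟨ha, fun a b => h1 (a, b)⟩, rfl⟩

include h in
theorem pull_criterion (L : List (List Edge)) (hnodup : L.Nodup)
    (hL : ∀ R ∈ L, (legDAG k n).IsRoute R ∧ ¬ (legDAG k n).IsExceptional R) :
    ((legDAG k n).PullCoherent L ↔ AllDKKPullSteps (legDAG k n) L) ∧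
    ((∀ R, (legDAG k n).IsRoute R → ¬ (legDAG k n).IsExceptional R → R ∈ L) →
      ((legDAG k n).pullRoutes L = (legDAG k n).DKK ↔ AllDKKPullSteps (legDAG k n) L)) := by
  obtain ⟨L, hbox, rfl⟩ := h.exists_map_route fun R hR => (hL R hR).1
  have hn : 0 < n := by
    have := h.n_eq
    have := h.sum_pos
    omega
  have hreg : ∀ a ∈ L, a ∈ h.arcs.system.reg := fun a ha =>
    ⟨hbox a ha, fun he => (hL _ (List.mem_map_of_mem ha)).2
      ((h.isExceptional_route_iff (hbox a ha)).2 he)⟩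
  have hnd : L.Nodup := List.Nodup.of_map _ hnodup
  have hw := LegData.system_hasWitnesses h.arcs
  rw [h.allDKKPullSteps_iff hbox, FramedDAG.PullCoherent, h.pullRoutes_eq hbox, h.dkk_eq]
  refine ⟨?_, fun hfull => CoherenceSystem.cells_eq_iff_allSteps hn hw hnd hreg fun a ha => ?_⟩
  · refine Iff.trans ?_ (CoherenceSystem.refines_iff_allSteps hn hw hnd hreg)
    constructor
    · exact fun H M hM => H _ ⟨M, hM, rfl⟩
    · rintro H _ ⟨M, hM, rfl⟩
      exact H M hM
  · obtain ⟨b, hb, e⟩ := List.mem_map.1 (hfull (h.route a) (h.isRoute_route ha.1)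
      fun he => ha.2 ((h.isExceptional_route_iff ha.1).1 he))
    exact h.route_injOn (hbox b hb) ha.1 e ▸ hb

end LegShape
end PullDKK

theorem corollary4p15 (k : List ℕ) (hk : ∀ a ∈ k, 0 < a) (hne : k ≠ [])
    (G : PullDKK.FramedDAG PullDKK.Edge)
    (hG : G = PullDKK.pathDAG k ∨
      (G = PullDKK.cycleDAG k ∧ Even k.length ∧ k ≠ [1, 1]))
    (L : List (List PullDKK.Edge)) (hnodup : L.Nodup)
    (hL : ∀ R ∈ L, G.IsRoute R ∧ ¬ G.IsExceptional R) :
    (G.PullCoherent L ↔ PullDKK.AllDKKPullSteps G L) ∧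
    ((∀ R, G.IsRoute R → ¬ G.IsExceptional R → R ∈ L) →
      (G.pullRoutes L = G.DKK ↔ PullDKK.AllDKKPullSteps G L)) := by
  rcases hG with rfl | ⟨rfl, he, h11⟩
  · exact (PullDKK.LegShape.of_path hk hne).pull_criterion L hnodup hL
  · exact (PullDKK.LegShape.of_cycle hk hne he h11).pull_criterion L hnodup hL
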